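/- Let $L$ be a finite set, let $I\subseteq L\times L$ be an irreflexive symmetric relation (independence), and for each $\alpha\in L$ let $G_\alpha$ be a group generated by a finite set $\Sigma_\alpha=\Sigma_\alpha^{-1}\subseteq G_\alpha\setminus\{1\}$. Let $\Gamma$ be the disjoint union of the (possibly infinite) alphabets $\Gamma_\alpha=G_\alpha\setminus\{1\}$. The dependence graph $D(w)$ of a word $w=a_1\cdots a_n\in\Gamma^*$ with $a_i\in\Gamma_{\alpha_i}$ is the directed graph with vertices $1,\dots,n$, where vertex $i$ is labelled by the letter $a_i$, and with an arc from $i$ to $j$ if and only if $i<j$ and $(\alpha_i,\alpha_j)\notin I$. Write $w\equiv w'$ if $D(w)$ and $D(w')$ are isomorphic as node-labelled directed graphs. A word $a_1\cdots a_n\in\Gamma^*$ is given as input in the form $[u_1]\cdots[u_n]$, where $u_i$ is a word over $\Sigma_{\alpha_i}$ with value $a_i$ in $G_{\alpha_i}$; a pair of words is given by two such strings with a separator between them. A problem is in logspace if it is decided by a deterministic Turing machine with a read-only input tape that halts on every input and uses $O(\log n)$ cells of its work tapes on inputs of length $n$. Proposition (pattern matching on dependence graphs). Let $G=G(L,I;(G_\alpha)_{\alpha\in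 L})$ be the graph product of the groups $G_\alpha$, and suppose that for every $\alpha\in L$ the word problem of $G_\alpha$, that is $\{w\in\Sigma_\alpha^*: w=1\text{ in }G_\alpha\}$, is in logspace. Then the following problem is in logspace. Input: words $p,t\in\Gamma^*$. Question: do words $x,y\in\Gamma^*$ exist such that $t\equiv x\,p\,y$? -/

import Mathlib

universe u v

/-! ### Deterministic logarithmic space -/

namespace Logspace

/-- A head movement. -/
inductive Move : Type
  | left
  | stay
  | right

/-- What the input head can see: an end marker or a letter of the input. -/
inductive InSym (A : Type u) : Type u
  | leftEnd
  | rightEnd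
  | letter (a : A)

/-- The cell `i` of the input tape, which holds `w` between two end markers: cell `0` is the left
end marker, cells `1, …, |w|` hold the letters of `w`, and cell `|w| + 1` is the right end marker. -/
def inputCell {A : Type u} (w : List A) : ℕ → InSym A
  | 0 => InSym.leftEnd
  | i + 1 =>
    match w[i]? with
    | some a => InSym.letter a
    | none => InSym.rightEnd

/-- The input head moves within the cells `0, …, n + 1`, where `n` is the input length. -/
def moveInput (n : ℕ) : Move → ℕ → ℕ
  | Move.left, i => i - 1
  | Move.stay, i => i
  | Move.right, i => min (i + 1) (n + 1)

/-- The head of a work tape moves on a two-way infinite tape. -/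
def moveWork : Move → ℤ → ℤ
  | Move.left, i => i - 1
  | Move.stay, i => i
  | Move.right, i => i + 1

/-- A deterministic Turing machine with a read-only two-way input tape over `A` and finitely many
read-write work tapes. The machine halts when the transition function returns `none`. -/
structure Machine (A : Type u) where
  State : Type
  finite_state : Finite State
  WorkSym : Type
  finite_workSym : Finite WorkSym
  blank : WorkSym
  tapes : ℕ
  start : State
  accept : Set State
  trans : State → InSym A → (Fin tapes → WorkSym) →
    Option (State × Move × (Fin tapes → WorkSym × Move))

namespace Machine

variable {A : Type u}

/-- A configuration: the state, the position of the input head, and the contents and the head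
position of each work tape. -/
structure Cfg (M : Machine A) where
  state : M.State
  inputHead : ℕ
  work : Fin M.tapes → ℤ → M.WorkSym
  workHead : Fin M.tapes → ℤ

/-- The initial configuration: all work tapes are blank. -/
def initCfg (M : Machine A) : M.Cfg where
  state := M.start
  inputHead := 0
  work := fun _ _ => M.blank
  workHead := fun _ => 0

/-- One step of the machine on the input `w`; `none` if the machine has halted. -/
def step (M : Machine A) (w : List A) (c : M.Cfg) : Option M.Cfg :=
  (M.trans c.state (inputCell w c.inputHead) (fun i => c.work i (c.workHead i))).map
    fun r =>
      { state := r.1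
        inputHead := moveInput w.length r.2.1 c.inputHead
        work := fun i => Function.update (c.work i) (c.workHead i) (r.2.2 i).1
        workHead := fun i => moveWork (r.2.2 i).2 (c.workHead i) }

/-- The configuration `c` occurs in the run of the machine on the input `w`. -/
def Visits (M : Machine A) (w : List A) (c : M.Cfg) : Prop :=
  Relation.ReflTransGen (fun c₁ c₂ => M.step w c₁ = some c₂) M.initCfg c

/-- The machine halts on every input, and it accepts exactly the words of `X`. -/
def Decides (M : Machine A) (X : Language A) : Prop :=
  ∀ w : List A, ∃ c : M.Cfg, M.Visits w c ∧ M.step w c = none ∧ (c.state ∈ M.accept ↔ w ∈ X)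

/-- On inputs of length `n` the machine uses `O(log n)` cells of its work tapes. -/
def RunsInLogspace (M : Machine A) : Prop :=
  ∃ C : ℕ, ∀ (w : List A) (c : M.Cfg), M.Visits w c →
    ∀ i, (c.workHead i).natAbs ≤ C * (Nat.log 2 w.length + 1)

end Machine

/-- The language `X` over the finite alphabet `A` belongs to deterministic logspace. -/
def InLogspace {A : Type u} [Finite A] (X : Language A) : Prop :=
  ∃ M : Machine A, M.Decides X ∧ M.RunsInLogspace

end Logspace

/-! ### Words over the node groups of a graph product and their dependence graphs -/

namespace GraphProduct

/-- The word problem of a group with respect to a finite set `S` of generators. -/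
def wordProblem {H : Type v} [Group H] (S : Finset H) : Language S :=
  {w | (w.map Subtype.val).prod = 1}

section

variable {L : Type u} (G : L → Type v) [∀ α, Group (G α)]

/-- The (in general infinite) alphabet `Γ`: the disjoint union of the sets `G α \ {1}`. -/
def Letter : Type (max u v) :=
  {x : Σ α, G α // x.2 ≠ 1}

end

section

variable {L : Type u} {G : L → Type v} [∀ α, Group (G α)]

/-- The node of the independence graph to which a letter belongs. -/
def Letter.node (a : Letter G) : L := a.1.1

/-- The arcs of the dependence graph of a word `w` over `Γ`. Its vertices are the positions of `w`,
and there is an arc from `i` to `j` if `i < j` and the letters at `i` and `j` belong to nodes that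
are not independent (in particular if they belong to the same node). -/
def dependenceGraph (I : SimpleGraph L) (w : List (Letter G)) : Digraph (Fin w.length) where
  Adj i j := i < j ∧ ¬ I.Adj (w.get i).node (w.get j).node

/-- `w ≡ w'`: the dependence graphs of `w` and `w'` are isomorphic as node-labelled directed
graphs, where a position is labelled by the letter at this position. -/
def DepEquiv (I : SimpleGraph L) (w w' : List (Letter G)) : Prop :=
  ∃ e : Fin w.length ≃ Fin w'.length,
    (∀ i, w'.get (e i) = w.get i) ∧
    ∀ i j, (dependenceGraph I w').Adj (e i) (e j) ↔ (dependenceGraph I w).Adj i j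

/-- The finite alphabet in which inputs are written: the generators of the node groups, two
brackets, and a separator. -/
inductive Token (S : ∀ α, Finset (G α)) : Type (max u v)
  | gen (α : L) (s : S α)
  | opening
  | closing
  | sep

instance Token.instFinite [Finite L] (S : ∀ α, Finset (G α)) : Finite (Token S) := by
  refine Finite.of_surjective
    (fun x : (Σ α, S α) ⊕ Fin 3 =>
      match x with
      | Sum.inl y => Token.gen y.1 y.2
      | Sum.inr 0 => Token.opening
      | Sum.inr 1 => Token.closing
      | Sum.inr 2 => Token.sep) ?_
  intro t
  cases t with
  | gen α s => exact ⟨Sum.inl ⟨α, s⟩, rfl⟩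
  | opening => exact ⟨Sum.inr 0, rfl⟩
  | closing => exact ⟨Sum.inr 1, rfl⟩
  | sep => exact ⟨Sum.inr 2, rfl⟩

/-- The string `[u₁]⋯[uₙ]`, where each `uᵢ` is a word over the generators of one node group. -/
def code {S : ∀ α, Finset (G α)} (b : List (Σ α, List (S α))) : List (Token S) :=
  b.flatMap fun x => Token.opening :: (x.2.map (Token.gen x.1) ++ [Token.closing])

/-- `[u₁]⋯[uₙ]` represents `w = a₁⋯aₙ`: the word `uᵢ` over the generators of `G α` has the value
`aᵢ ∈ G α \ {1}`. -/
def Represents {S : ∀ α, Finset (G α)} (b : List (Σ α, List (S α))) (w : List (Letter G)) : Prop :=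
  b.map (fun x => (⟨x.1, (x.2.map Subtype.val).prod⟩ : Σ α, G α)) = w.map Subtype.val

/-- Factor pattern matching on dependence graphs: the inputs are the pairs `p`, `t` of words over
`Γ`, written as `[u₁]⋯[uₘ] sep [v₁]⋯[vₙ]`, and the question is whether `t ≡ x p y` for some words
`x`, `y` over `Γ`. -/
def patternMatching (I : SimpleGraph L) (S : ∀ α, Finset (G α)) : Language (Token S) :=
  {z | ∃ (bp bt : List (Σ α, List (S α))) (p t : List (Letter G)),
    z = code bp ++ Token.sep :: code bt ∧ Represents bp p ∧ Represents bt t ∧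
    ∃ x y : List (Letter G), DepEquiv I t (x ++ p ++ y)}

end

end GraphProduct

/-!
Three ideas combine.

*Logarithmic space as arithmetic.* A register program whose counters stay polynomially bounded in
the length of its input runs on a Turing machine in logarithmic space, because the counters are
written in binary. Relations between positions of the input can therefore be decided by bounded
quantification and counting. Conversely, a configuration of a logspace machine is a tuple of
polynomially bounded numbers, hence such a machine can be simulated on an input that is never
written down but recomputed letter by letter. In this way the equality of the letters `[u]` and
`[v]` is decided by the word problem of the node group, for the word `u v⁻¹`.

*Projections.* Two words have isomorphic dependence graphs if and only if their projections to
every pair of dependent nodes agree.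

*Factors.* There are `x` and `y` with `t ≡ x p y` if and only if there are numbers `κ α` such that,
for all dependent nodes `α` and `β`, the projection of `p` occurs in the projection of `t`
right after a prefix with `κ α` letters of the node `α` and `κ β` letters of the node `β`. In one
direction, `κ` counts the letters of `x`. In the other direction, `x` consists of the first `κ α`
letters of every node `α` in `t`. Such a `κ` is found by a bounded search.
-/

namespace Logspace

/-! ### Register programs over an input word -/

section RegisterProgram

variable {A : Type u}

/-- The tests of a register program: whether a register is nonzero, and whether the letter under
the input head has a given property. -/
inductive Test (A : Type u) : Type u
  | nonzero (i : ℕ)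
  | sees (p : InSym A → Bool)

/-- Register programs with a head on the input word, an intermediate language between functions on
natural numbers and Turing machines. The registers are numbered by `ℕ`, but each program uses only
finitely many of them. -/
inductive Program (A : Type u) : Type u
  | inc (i : ℕ)
  | dec (i : ℕ)
  | move (d : Move)
  | seq (c c' : Program A)
  | ifThen (t : Test A) (c : Program A)
  | whileDo (t : Test A) (c : Program A)

/-- The memory of a register program: the position of the input head, and the registers. -/
abbrev Store := ℕ × (ℕ → ℕ)

/-- The test `t` succeeds in the store `s`. -/
def Test.Holds (w : List A) : Test A → Store → Prop
  | nonzero i, s => s.2 i ≠ 0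
  | sees p, s => p (inputCell w s.1) = true

/-- Big-step semantics: on the input `w`, the program leads from one store to another, and no
register is incremented beyond `B` on the way. A register with value `0` must not be decremented. -/
inductive Exec (w : List A) (B : ℕ) : Program A → Store → Store → Prop
  | inc (i : ℕ) (s : Store) (h : s.2 i + 1 ≤ B) :
      Exec w B (.inc i) s (s.1, Function.update s.2 i (s.2 i + 1))
  | dec (i : ℕ) (s : Store) (h : s.2 i ≠ 0) :
      Exec w B (.dec i) s (s.1, Function.update s.2 i (s.2 i - 1))
  | move (d : Move) (s : Store) : Exec w B (.move d) s (moveInput w.length d s.1, s.2)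
  | seq {c c' : Program A} {s s' s'' : Store} (h : Exec w B c s s') (h' : Exec w B c' s' s'') :
      Exec w B (.seq c c') s s''
  | if_true {t : Test A} {c : Program A} {s s' : Store} (ht : t.Holds w s)
      (h : Exec w B c s s') : Exec w B (.ifThen t c) s s'
  | if_false {t : Test A} {c : Program A} {s : Store} (ht : ¬ t.Holds w s) :
      Exec w B (.ifThen t c) s s
  | while_true {t : Test A} {c : Program A} {s s' s'' : Store} (ht : t.Holds w s)
      (h : Exec w B c s s') (h' : Exec w B (.whileDo t c) s' s'') : Exec w B (.whileDo t c) s s''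
  | while_false {t : Test A} {c : Program A} {s : Store} (ht : ¬ t.Holds w s) :
      Exec w B (.whileDo t c) s s

theorem Exec.mono {w : List A} {B B' : ℕ} (hB : B ≤ B') {c : Program A} {s s' : Store}
    (h : Exec w B c s s') : Exec w B' c s s' := by
  induction h with
  | inc i s h => exact .inc i s (h.trans hB)
  | dec i s h => exact .dec i s h
  | move d s => exact .move d s
  | seq _ _ ih ih' => exact .seq ih ih'
  | if_true ht _ ih => exact .if_true ht ih
  | if_false ht => exact .if_false ht
  | while_true ht _ _ ih ih' => exact .while_true ht ih ih'
  | while_false ht => exact .while_false ht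

end RegisterProgram

/-! ### Machine components -/

/-- What a Turing machine with work alphabet `Option Bool` (blank and two digits) changes during a
run, apart from its state. -/
structure Memory (K : ℕ) where
  inputHead : ℕ
  work : Fin K → ℤ → Option Bool
  workHead : Fin K → ℤ

namespace Memory

variable {K : ℕ}

/-- The head movements and the written symbols of one step of a machine. -/
abbrev Action (K : ℕ) := Move × (Fin K → Option Bool × Move)

/-- The effect of an action on an input of length `n`. -/
def act (n : ℕ) (D : Memory K) (r : Action K) : Memory K where
  inputHead := moveInput n r.1 D.inputHead
  work := fun i => Function.update (D.work i) (D.workHead i) (r.2 i).1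
  workHead := fun i => moveWork (r.2 i).2 (D.workHead i)

/-- All work heads are at distance at most `R` from the origin. -/
def Within (R : ℕ) (D : Memory K) : Prop := ∀ i, (D.workHead i).natAbs ≤ R

/-- The symbols under the work heads. -/
def reads (D : Memory K) : Fin K → Option Bool := fun i => D.work i (D.workHead i)

/-- Replace the contents and the head position of the tape `i`. -/
def setTape (D : Memory K) (i : Fin K) (f : ℤ → Option Bool) (h : ℤ) : Memory K where
  inputHead := D.inputHead
  work := Function.update D.work i f
  workHead := Function.update D.workHead i h

/-- When the work heads read `x`, the action that writes `s` on the tape `i`, moves the head of this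
tape, and changes nothing else. -/
def Action.onTape (i : Fin K) (x : Fin K → Option Bool) (s : Option Bool) (m : Move) : Action K :=
  (Move.stay, Function.update (fun j => (x j, Move.stay)) i (s, m))

theorem setTape_self (D : Memory K) (i : Fin K) : D.setTape i (D.work i) (D.workHead i) = D := by
  simp [setTape]

@[simp]
theorem reads_setTape (D : Memory K) (i : Fin K) (f : ℤ → Option Bool) (h : ℤ) :
    (D.setTape i f h).reads i = f h := by
  simp [setTape, reads]

theorem act_onTape (n : ℕ) (D : Memory K) (i : Fin K) (f : ℤ → Option Bool) (h : ℤ)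
    (s : Option Bool) (m : Move) :
    (D.setTape i f h).act n (.onTape i (D.setTape i f h).reads s m) =
      D.setTape i (Function.update f h s) (moveWork m h) := by
  simp only [act, Action.onTape, setTape, reads, moveInput, Memory.mk.injEq, true_and]
  constructor <;> funext j <;> rcases eq_or_ne j i with rfl | hj <;> simp [*, moveWork]

theorem act_moveInput (n : ℕ) (D : Memory K) (d : Move) :
    D.act n (d, fun j => (D.reads j, Move.stay)) =
      { D with inputHead := moveInput n d D.inputHead } := by
  simp [act, reads, moveWork]

theorem Within.setTape {R : ℕ} {D : Memory K} (hD : D.Within R) (i : Fin K)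
    (f : ℤ → Option Bool) {h : ℤ} (hh : h.natAbs ≤ R) : (D.setTape i f h).Within R := by
  intro j
  rcases eq_or_ne j i with rfl | hj
  · simpa [Memory.setTape] using hh
  · simpa [Memory.setTape, hj] using hD j

end Memory

/-- A part of a machine, with a Boolean result where the machine leaves it. -/
structure Component (A : Type u) (K : ℕ) where
  State : Type
  finite_state : Finite State
  start : State
  trans : State → InSym A → (Fin K → Option Bool) → (State ⊕ Bool) × Memory.Action K

namespace Component

variable {A : Type u} {K : ℕ}

/-- One step of a component: the next state or the result, and the next memory. -/
def next (M : Component A K) (w : List A) (q : M.State) (D : Memory K) :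
    (M.State ⊕ Bool) × Memory K :=
  ((M.trans q (inputCell w D.inputHead) D.reads).1,
    D.act w.length (M.trans q (inputCell w D.inputHead) D.reads).2)

/-- From the state `q` and the memory `D`, the component `M` reaches the result `b` with the memory
`D'`, and the work heads stay within distance `R` of the origin. -/
inductive Run (M : Component A K) (w : List A) (R : ℕ) :
    M.State → Memory K → Bool → Memory K → Prop
  | exit {q : M.State} {D D' : Memory K} {b : Bool} (hD : D.Within R) (hD' : D'.Within R)
      (h : M.next w q D = (Sum.inr b, D')) : Run M w R q D b D'
  | step {q q' : M.State} {D D' D'' : Memory K} {b : Bool} (hD : D.Within R)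
      (h : M.next w q D = (Sum.inl q', D')) (h' : Run M w R q' D' b D'') : Run M w R q D b D''

section link

variable {ι : Type} [Finite ι] {M : ι → Component A K} {i₀ i j : ι} {route : ι → Bool → Option ι}
  {w : List A} {R : ℕ} {D D' D'' : Memory K} {b b' : Bool}

/-- A flow chart of components. When the component `i` is left with the result `b`, the run goes on
with the component `route i b`, or ends with the result `b` if there is none. -/
def link (M : ι → Component A K) (i₀ : ι) (route : ι → Bool → Option ι) : Component A K where
  State := Σ i, (M i).State
  finite_state :=
    have := fun i => (M i).finite_state
    inferInstance
  start := ⟨i₀, (M i₀).start⟩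
  trans q a x :=
    (((M q.1).trans q.2 a x).1.elim (fun q' => Sum.inl ⟨q.1, q'⟩)
        fun b => (route q.1 b).elim (Sum.inr b) fun j => Sum.inl ⟨j, (M j).start⟩,
      ((M q.1).trans q.2 a x).2)

theorem Run.link_exit {q : (M i).State} (h : (M i).Run w R q D b D') (hr : route i b = none) :
    (link M i₀ route).Run w R ⟨i, q⟩ D b D' := by
  induction h with
  | exit hD hD' h =>
    refine .exit hD hD' ?_
    simp only [next, Prod.mk.injEq] at h
    simp [next, link, h.1, h.2, hr]
  | step hD h _ ih =>
    refine .step hD ?_ (ih hr)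
    simp only [next, Prod.mk.injEq] at h
    simp [next, link, h.1, h.2]

theorem Run.link_trans {q : (M i).State} (h : (M i).Run w R q D b D') (hr : route i b = some j)
    (h' : (link M i₀ route).Run w R ⟨j, (M j).start⟩ D' b' D'') :
    (link M i₀ route).Run w R ⟨i, q⟩ D b' D'' := by
  induction h with
  | exit hD _ h =>
    refine .step hD ?_ h'
    simp only [next, Prod.mk.injEq] at h
    simp [next, link, h.1, h.2, hr]
  | step hD h _ ih =>
    refine .step hD ?_ (ih hr h')
    simp only [next, Prod.mk.injEq] at h
    simp [next, link, h.1, h.2]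

end link

/-- The component that evaluates `p` at the letter under the input head and moves this head, in one
step. -/
def inspect (d : Move) (p : InSym A → Bool) : Component A K where
  State := Unit
  finite_state := inferInstance
  start := ()
  trans _ a x := (Sum.inr (p a), (d, fun j => (x j, Move.stay)))

theorem run_inspect (d : Move) (p : InSym A → Bool) (w : List A) {R : ℕ} {D : Memory K}
    (hD : D.Within R) :
    (inspect d p : Component A K).Run w R () D (p (inputCell w D.inputHead))
      { D with inputHead := moveInput w.length d D.inputHead } := by
  refine .exit hD hD ?_
  rw [← Memory.act_moveInput]
  rfl

/-- The component that moves right on the tape `i` and rewrites its cells by `g`, up to the first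
cell where `halt` gives a result, and then moves back to the left end of the word on the tape. -/
def sweep (i : Fin K) (halt g : Option Bool → Option Bool) : Component A K where
  State := Option Bool
  finite_state := inferInstance
  start := none
  trans q _ x :=
    match q with
    | none =>
      match halt (x i) with
      | none => (Sum.inl none, .onTape i x (g (x i)) Move.right)
      | some b => (Sum.inl (some b), .onTape i x (g (x i)) Move.left)
    | some b =>
      match x i with
      | none => (Sum.inr b, .onTape i x none Move.right)
      | some s => (Sum.inl (some b), .onTape i x (some s) Move.left)

end Component

/-- The tape that holds the word `l` in the cells `0, 1, …` and is blank elsewhere. -/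
def listTape (l : List Bool) : ℤ → Option Bool := fun z => if 0 ≤ z then l[z.toNat]? else none

theorem listTape_append_length (l l' : List Bool) : listTape (l ++ l') l.length = l'.head? := by
  cases l' <;> simp [listTape]

theorem update_listTape_append (l l' : List Bool) (b : Bool) :
    Function.update (listTape (l ++ l')) l.length (some b) = listTape (l ++ b :: l'.tail) := by
  funext z
  rcases eq_or_ne z l.length with rfl | hz
  · simp [listTape]
  rw [Function.update_of_ne hz]
  simp only [listTape]
  split_ifs with h
  · obtain ⟨n, rfl⟩ := Int.eq_ofNat_of_zero_le h
    rw [Int.toNat_natCast]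
    rcases lt_or_ge n l.length with hn | hn
    · rw [List.getElem?_append_left hn, List.getElem?_append_left hn]
    · obtain ⟨k, rfl⟩ := Nat.exists_eq_add_of_lt (hn.lt_of_ne fun h => hz (by rw [h]))
      simp [List.getElem?_append_right, add_assoc, List.getElem?_cons_succ, List.getElem?_tail]
  · rfl

namespace Component

variable {A : Type u} {K : ℕ} {i : Fin K} {halt g : Option Bool → Option Bool} {w : List A} {R : ℕ}
  {D : Memory K}

/-- The effect of `sweep` on the word on its tape: the word before, the word after, the result. -/
inductive SweepsTo (halt g : Option Bool → Option Bool) : List Bool → List Bool → Bool → Prop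
  | nil {e : Bool} (h : halt none = some e) : SweepsTo halt g [] (g none).toList e
  | halt {b b' : Bool} {l : List Bool} {e : Bool} (h : halt (some b) = some e)
      (h' : g (some b) = some b') : SweepsTo halt g (b :: l) (b' :: l) e
  | cont {b b' : Bool} {l l' : List Bool} {e : Bool} (h : halt (some b) = none)
      (h' : g (some b) = some b') (hl : SweepsTo halt g l l' e) :
      SweepsTo halt g (b :: l) (b' :: l') e

theorem run_sweep_back (hD : D.Within R) (l : List Bool) (hR : l.length + 1 ≤ R) (e : Bool)
    (k : ℕ) (hk : k ≤ l.length) :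
    (sweep i halt g : Component A K).Run w R (some e) (D.setTape i (listTape l) ((k : ℤ) - 1)) e
      (D.setTape i (listTape l) 0) := by
  induction k with
  | zero =>
    have hread : listTape l ((0 : ℕ) - 1) = none := by simp [listTape]
    have hwrite : Function.update (listTape l) ((0 : ℕ) - 1) none = listTape l := by
      rw [← hread, Function.update_eq_self]
    refine .exit (hD.setTape _ _ (by omega)) (hD.setTape _ _ (by simp)) ?_
    simp only [next, sweep, Memory.reads_setTape, hread, Memory.act_onTape, hwrite]
    simp [moveWork]
  | succ k ih =>
    have hread : listTape l ((k + 1 : ℕ) - 1) = some (l[k]'(by omega)) := by simp [listTape]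
    refine .step (hD.setTape _ _ (by omega)) ?_ (ih (by omega))
    simp only [next, sweep, Memory.reads_setTape, hread, Memory.act_onTape]
    rw [← hread, Function.update_eq_self]
    simp [moveWork]

theorem run_sweep_turn (hD : D.Within R) {l₀ l l' : List Bool} {e : Bool}
    (hhalt : halt l.head? = some e)
    (hwrite : Function.update (listTape (l₀ ++ l)) l₀.length (g l.head?) = listTape (l₀ ++ l'))
    (hR : l₀.length + l'.length + 1 ≤ R) :
    (sweep i halt g : Component A K).Run w R none (D.setTape i (listTape (l₀ ++ l)) l₀.length) e
      (D.setTape i (listTape (l₀ ++ l')) 0) := by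
  refine .step (q' := some e) (D' := D.setTape i (listTape (l₀ ++ l')) ((l₀.length : ℤ) - 1))
    (hD.setTape _ _ (by simpa using by omega)) ?_
    (run_sweep_back hD _ (by simpa using by omega) e _ (by simp))
  simp only [next, sweep, Memory.reads_setTape, listTape_append_length, hhalt, Memory.act_onTape,
    hwrite, moveWork]

theorem run_sweep (hD : D.Within R) {l l' : List Bool} {e : Bool} (h : SweepsTo halt g l l' e)
    (l₀ : List Bool) (hR : l₀.length + l.length + 2 ≤ R) :
    (sweep i halt g : Component A K).Run w R none (D.setTape i (listTape (l₀ ++ l)) l₀.length) e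
      (D.setTape i (listTape (l₀ ++ l')) 0) := by
  induction h generalizing l₀ with
  | nil h =>
    refine run_sweep_turn hD h ?_ ?_
    · cases hg : g none with
      | none =>
        have hblank : listTape (l₀ ++ []) l₀.length = none := listTape_append_length l₀ []
        rw [List.head?_nil, hg, ← hblank, Function.update_eq_self, hblank, Option.toList_none]
      | some b => rw [List.head?_nil, hg, update_listTape_append, Option.toList_some, List.tail_nil]
    · have : (g none).toList.length ≤ 1 := by cases g none <;> simp
      grind
  | halt h h' =>
    exact run_sweep_turn hD h (by rw [List.head?_cons, h', update_listTape_append, List.tail_cons])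
      (by grind)
  | @cont b b' l l' e h h' _ ih =>
    have hstep := ih (l₀ ++ [b']) (by grind)
    simp only [List.append_assoc, List.cons_append, List.nil_append] at hstep
    refine .step (hD.setTape _ _ (by simpa using by omega)) ?_ hstep
    simp only [next, sweep, Memory.reads_setTape, listTape_append_length, List.head?_cons, h, h',
      Memory.act_onTape, update_listTape_append]
    simp [moveWork]

end Component

/-! ### Binary counters -/

/-- The number with the binary digits `l`, least significant digit first. Leading zeros are
allowed. -/
def bitsVal : List Bool → ℕ
  | [] => 0
  | b :: l => 2 * bitsVal l + b.toNat

/-- The successor (`x = true`) or the predecessor (`x = false`) of a counter: the longest prefix of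
digits `x` is inverted, and the next digit becomes `x`. -/
def bump (x : Bool) : List Bool → List Bool
  | [] => [x]
  | b :: l => if b = x then (!x) :: bump x l else x :: l

theorem bitsVal_bump_true (l : List Bool) : bitsVal (bump true l) = bitsVal l + 1 := by
  induction l with
  | nil => rfl
  | cons b l ih => cases b <;> simp [bump, bitsVal, ih]; ring

theorem two_pow_length_bump_true_le (l : List Bool) :
    2 ^ (bump true l).length ≤ max (2 ^ l.length) (2 * bitsVal (bump true l)) := by
  induction l with
  | nil => simp [bump, bitsVal]
  | cons b l ih =>
    cases b
    · simp [bump]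
    · simp only [bump, if_true, bitsVal, List.length_cons, pow_succ, Bool.not_true,
        Bool.toNat_false]
      omega

theorem bitsVal_bump_false {l : List Bool} (h : bitsVal l ≠ 0) :
    bitsVal (bump false l) = bitsVal l - 1 := by
  induction l with
  | nil => exact absurd rfl h
  | cons b l ih =>
    cases b
    · simp only [bitsVal, Bool.toNat_false, add_zero] at h
      simp only [bump, if_true, bitsVal, ih (by omega), Bool.not_false, Bool.toNat_true,
        Bool.toNat_false]
      omega
    · simp [bump, bitsVal]

theorem length_bump_false {l : List Bool} (h : bitsVal l ≠ 0) :
    (bump false l).length = l.length := by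
  induction l with
  | nil => exact absurd rfl h
  | cons b l ih =>
    cases b
    · simp [bump, ih fun h0 => h (by simp [bitsVal, h0])]
    · simp [bump]

theorem sweepsTo_bump (x : Bool) (l : List Bool) :
    Component.SweepsTo (fun s => if s = some x then none else some true)
      (fun s => if s = some x then some (!x) else some x) l (bump x l) true := by
  induction l with
  | nil => exact .nil (by simp)
  | cons b l ih =>
    rcases eq_or_ne b x with rfl | hb
    · simpa [bump] using Component.SweepsTo.cont (by simp) (by simp) ih
    · simpa [bump, hb] using Component.SweepsTo.halt (by simp [hb]) (by simp [hb])

theorem sweepsTo_ne_zero (l : List Bool) :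
    Component.SweepsTo (fun s => if s = some false then none else some s.isSome) id l l
      (decide (bitsVal l ≠ 0)) := by
  induction l with
  | nil => exact .nil (by simp [bitsVal])
  | cons b l ih =>
    cases b
    · convert Component.SweepsTo.cont (b := false) (b' := false) (by simp) (by simp) ih using 2
      simp [bitsVal]
    · have : decide (bitsVal (true :: l) ≠ 0) = true := by simp [bitsVal]
      rw [this]
      exact .halt rfl rfl

/-! ### Compilation of register programs -/

section Compilation

variable {A : Type u} {K B : ℕ} {s s' : Store} {D : Memory K}

/-- The memory `D` represents the store `s`: the register `i` is written in binary on the tape `i`.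
The bound on the number of digits leaves room for a value up to `B`. -/
def Store.EncodedBy (B : ℕ) (s : Store) (D : Memory K) : Prop :=
  D.inputHead = s.1 ∧ ∀ i : Fin K, ∃ l : List Bool, bitsVal l = s.2 i ∧ 2 ^ l.length ≤ 2 * B ∧
    D.work i = listTape l ∧ D.workHead i = 0

theorem Store.EncodedBy.within {R : ℕ} (h : s.EncodedBy B D) : D.Within R := by
  intro i
  obtain ⟨l, -, -, -, h⟩ := h.2 i
  simp [h]

theorem Store.EncodedBy.setTape (h : s.EncodedBy B D) (i : Fin K) {l : List Bool}
    (hB : 2 ^ l.length ≤ 2 * B) :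
    Store.EncodedBy B (s.1, Function.update s.2 i (bitsVal l)) (D.setTape i (listTape l) 0) := by
  refine ⟨h.1, fun j => ?_⟩
  rcases eq_or_ne j i with rfl | hj
  · exact ⟨l, by simp, hB, by simp [Memory.setTape], by simp [Memory.setTape]⟩
  · obtain ⟨l', hval, hlen, hwork, hhead⟩ := h.2 j
    refine ⟨l', ?_, hlen, ?_, ?_⟩
    · simpa [Function.update_of_ne (fun h' => hj (Fin.ext h'))] using hval
    · simpa [Memory.setTape, hj] using hwork
    · simpa [Memory.setTape, hj] using hhead

/-- The space needed for sweeps over registers with values at most `B`. -/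
def spaceBound (B : ℕ) : ℕ := Nat.log 2 (2 * B) + 2

theorem length_add_two_le_spaceBound {l : List Bool} (h : 2 ^ l.length ≤ 2 * B) :
    l.length + 2 ≤ spaceBound B := by
  have := Nat.le_log_of_pow_le (by norm_num) h
  unfold spaceBound
  omega

theorem Store.EncodedBy.run_sweep (h : s.EncodedBy B D) (i : Fin K)
    {halt g : Option Bool → Option Bool} (w : List A) {f : List Bool → List Bool}
    {e : List Bool → Bool} (hw : ∀ l, Component.SweepsTo halt g l (f l) (e l)) :
    ∃ l, bitsVal l = s.2 i ∧ 2 ^ l.length ≤ 2 * B ∧ D.setTape i (listTape l) 0 = D ∧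
      (Component.sweep i halt g : Component A K).Run w (spaceBound B) none D (e l)
        (D.setTape i (listTape (f l)) 0) := by
  obtain ⟨l, hval, hlen, hwork, hhead⟩ := h.2 i
  have hD : D.setTape i (listTape l) 0 = D := by rw [← hwork, ← hhead, Memory.setTape_self]
  refine ⟨l, hval, hlen, hD, ?_⟩
  have hrun := Component.run_sweep (i := i) (w := w) (R := spaceBound B) (D := D) h.within
    (hw l) [] (by simpa using length_add_two_le_spaceBound hlen)
  simp only [List.nil_append, List.length_nil, Nat.cast_zero] at hrun
  rwa [hD] at hrun

namespace Component

open Filter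

/-- The component `M` evaluates the test `t` and leaves the memory as it is. -/
def ImplementsTest (M : Component A K) (t : Test A) : Prop :=
  ∀ (w : List A) (B : ℕ) (s : Store) (D : Memory K), s.EncodedBy B D →
    ∃ b : Bool, (b = true ↔ t.Holds w s) ∧ M.Run w (spaceBound B) M.start D b D

/-- The component `M` carries out the program `c`. Its result is irrelevant. -/
def Implements (M : Component A K) (c : Program A) : Prop :=
  ∀ (w : List A) (B : ℕ) (s s' : Store) (D : Memory K), Exec w B c s s' → s.EncodedBy B D →
    ∃ b D', s'.EncodedBy B D' ∧ M.Run w (spaceBound B) M.start D b D'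

theorem implementsTest_nonzero (i : Fin K) :
    (sweep i (fun s => if s = some false then none else some s.isSome) id :
      Component A K).ImplementsTest (.nonzero i) := by
  intro w B s D h
  obtain ⟨l, hval, -, hD, hrun⟩ := h.run_sweep i w (f := id) sweepsTo_ne_zero
  rw [id, hD] at hrun
  exact ⟨_, by simp [Test.Holds, hval], hrun⟩

theorem implementsTest_sees (p : InSym A → Bool) :
    (inspect .stay p : Component A K).ImplementsTest (.sees p) :=
  fun w _ _ _ h => ⟨_, by simp [Test.Holds, h.1], run_inspect .stay p w h.within⟩

theorem implements_inc (i : Fin K) :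
    (sweep i (fun s => if s = some true then none else some true)
      (fun s => if s = some true then some (!true) else some true) :
      Component A K).Implements (.inc i) := by
  intro w B s s' D hs h
  obtain ⟨l, hval, hlen, -, hrun⟩ := h.run_sweep i w (sweepsTo_bump true)
  cases hs with
  | inc _ _ hB =>
    have hval' : bitsVal (bump true l) = s.2 i + 1 := by rw [bitsVal_bump_true, hval]
    rw [← hval']
    exact ⟨_, _, h.setTape i ((two_pow_length_bump_true_le l).trans (by omega)), hrun⟩

theorem implements_dec (i : Fin K) :
    (sweep i (fun s => if s = some false then none else some true)
      (fun s => if s = some false then some (!false) else some false) :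
      Component A K).Implements (.dec i) := by
  intro w B s s' D hs h
  obtain ⟨l, hval, hlen, -, hrun⟩ := h.run_sweep i w (sweepsTo_bump false)
  cases hs with
  | dec _ _ h0 =>
    rw [← hval] at h0 ⊢
    rw [← bitsVal_bump_false h0]
    exact ⟨_, _, h.setTape i (by rwa [length_bump_false h0]), hrun⟩

theorem implements_move (d : Move) :
    (inspect d fun _ => true : Component A K).Implements (.move d) := by
  intro w B s s' D hs h
  cases hs
  exact ⟨_, { D with inputHead := moveInput w.length d D.inputHead },
    ⟨congrArg (moveInput w.length d) h.1, h.2⟩, run_inspect d _ w h.within⟩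

/-- `M` followed by `M'`. -/
def seq (M M' : Component A K) : Component A K :=
  link (fun i : Bool => bif i then M' else M) false
    fun i _ => if i then none else some true

/-- `M` followed by `M'` if the result of `M` is `true`. -/
def ifThen (M M' : Component A K) : Component A K :=
  link (fun i : Bool => bif i then M' else M) false
    fun i b => if i then none else if b then some true else none

/-- `M` followed by `M'` and repeated as long as the result of `M` is `true`. -/
def whileDo (M M' : Component A K) : Component A K :=
  link (fun i : Bool => bif i then M' else M) false
    fun i b => if i then some false else if b then some true else none

variable {M M' : Component A K} {t : Test A} {c c' : Program A}

theorem Run.seq {w : List A} {R : ℕ} {D D' D'' : Memory K} {b b' : Bool}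
    (h : M.Run w R M.start D b D') (h' : M'.Run w R M'.start D' b' D'') :
    (M.seq M').Run w R (M.seq M').start D b' D'' :=
  Run.link_trans (i := false) h rfl (Run.link_exit (i := true) h' rfl)

theorem Implements.seq (hM : M.Implements c) (hM' : M'.Implements c') :
    (M.seq M').Implements (.seq c c') := by
  intro w B s s'' D hs h
  cases hs with
  | seq h₁ h₂ =>
    obtain ⟨_, D', hD', hrun⟩ := hM w B _ _ D h₁ h
    obtain ⟨_, D'', hD'', hrun'⟩ := hM' w B _ _ D' h₂ hD'
    exact ⟨_, D'', hD'', hrun.seq hrun'⟩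

theorem Implements.ifThen (hM : M.ImplementsTest t) (hM' : M'.Implements c) :
    (M.ifThen M').Implements (.ifThen t c) := by
  intro w B s s' D hs h
  obtain ⟨b, hb, hrun⟩ := hM w B s D h
  cases hs with
  | if_true ht hc =>
    obtain ⟨_, D', hD', hrun'⟩ := hM' w B _ _ D hc h
    exact ⟨_, D', hD', Run.link_trans (i := false) hrun (if_pos (hb.2 ht))
      (Run.link_exit (i := true) hrun' rfl)⟩
  | if_false ht =>
    exact ⟨_, D, h, Run.link_exit (i := false) hrun (if_neg (ht ∘ hb.1))⟩

theorem Implements.whileDo (hM : M.ImplementsTest t) (hM' : M'.Implements c) :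
    (M.whileDo M').Implements (.whileDo t c) := by
  intro w B s s' D hs h
  generalize hp : Program.whileDo t c = p at hs
  induction hs generalizing D with cases hp
  | while_true ht hc _ _ ih =>
    obtain ⟨b, hb, hrun⟩ := hM w B _ D h
    obtain ⟨_, D', hD', hrun'⟩ := hM' w B _ _ D hc h
    obtain ⟨_, D'', hD'', hrun''⟩ := ih D' hD' rfl
    exact ⟨_, D'', hD'', Run.link_trans (i := false) hrun (if_pos (hb.2 ht))
      (Run.link_trans (i := true) hrun' rfl hrun'')⟩
  | while_false ht =>
    obtain ⟨b, hb, hrun⟩ := hM w B _ D h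
    exact ⟨_, D, h, Run.link_exit (i := false) hrun (if_neg (ht ∘ hb.1))⟩

theorem eventually_exists_implementsTest (t : Test A) :
    ∀ᶠ K in atTop, ∃ M : Component A K, M.ImplementsTest t := by
  cases t with
  | nonzero i =>
    filter_upwards [eventually_gt_atTop i] with K hK using ⟨_, implementsTest_nonzero ⟨i, hK⟩⟩
  | sees p => exact .of_forall fun K => ⟨_, implementsTest_sees p⟩

theorem eventually_exists_implements (c : Program A) :
    ∀ᶠ K in atTop, ∃ M : Component A K, M.Implements c := by
  induction c with
  | inc i => filter_upwards [eventually_gt_atTop i] with K hK using ⟨_, implements_inc ⟨i, hK⟩⟩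
  | dec i => filter_upwards [eventually_gt_atTop i] with K hK using ⟨_, implements_dec ⟨i, hK⟩⟩
  | move d => exact .of_forall fun K => ⟨_, implements_move d⟩
  | seq c c' ih ih' =>
    filter_upwards [ih, ih'] with K ⟨M, hM⟩ ⟨M', hM'⟩ using ⟨_, hM.seq hM'⟩
  | ifThen t c ih =>
    filter_upwards [eventually_exists_implementsTest t, ih] with K ⟨M, hM⟩ ⟨M', hM'⟩
      using ⟨_, .ifThen hM hM'⟩
  | whileDo t c ih =>
    filter_upwards [eventually_exists_implementsTest t, ih] with K ⟨M, hM⟩ ⟨M', hM'⟩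
      using ⟨_, .whileDo hM hM'⟩

/-! ### From components to machines -/

/-- The machine that runs a component and accepts if the result is `true`. -/
def toMachine (M : Component A K) : Machine A where
  State := M.State ⊕ Bool
  finite_state :=
    have := M.finite_state
    inferInstance
  WorkSym := Option Bool
  finite_workSym := inferInstance
  blank := none
  tapes := K
  start := Sum.inl M.start
  accept := {Sum.inr true}
  trans q a x :=
    match q with
    | Sum.inl q => some (M.trans q a x)
    | Sum.inr _ => none

/-- The configuration of `M.toMachine` with the given state and memory. -/
def toCfg (M : Component A K) (q : M.State ⊕ Bool) (D : Memory K) : M.toMachine.Cfg where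
  state := q
  inputHead := D.inputHead
  work := D.work
  workHead := D.workHead

theorem step_toMachine (M : Component A K) (w : List A) (q : M.State) (D : Memory K) :
    M.toMachine.step w (M.toCfg (Sum.inl q) D) =
      some (M.toCfg (M.next w q D).1 (M.next w q D).2) := rfl

variable {w : List A} {R : ℕ} {q : M.State} {D' : Memory K} {b : Bool}

theorem Run.reflTransGen_toMachine (h : M.Run w R q D b D') :
    Relation.ReflTransGen (fun c₁ c₂ => M.toMachine.step w c₁ = some c₂)
      (M.toCfg (Sum.inl q) D) (M.toCfg (Sum.inr b) D') := by
  induction h with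
  | exit _ _ h => exact .single (by rw [step_toMachine, h])
  | step _ h _ ih => exact .head (by rw [step_toMachine, h]) ih

theorem Run.natAbs_workHead_le (h : M.Run w R q D b D') {c : M.toMachine.Cfg}
    (hc : Relation.ReflTransGen (fun c₁ c₂ => M.toMachine.step w c₁ = some c₂)
      (M.toCfg (Sum.inl q) D) c) (i : Fin K) : (c.workHead i).natAbs ≤ R := by
  induction h with
  | exit hD hD' h =>
    obtain rfl | ⟨c₁, hstep, hc⟩ := hc.cases_head
    · exact hD i
    rw [step_toMachine, h, Option.some_inj] at hstep
    subst hstep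
    obtain rfl | ⟨c₂, hstep, -⟩ := hc.cases_head
    · exact hD' i
    · exact absurd hstep (by simp [Machine.step, toMachine, toCfg])
  | step hD h _ ih =>
    obtain rfl | ⟨c₁, hstep, hc⟩ := hc.cases_head
    · exact hD i
    rw [step_toMachine, h, Option.some_inj] at hstep
    subst hstep
    exact ih hc

end Component

theorem add_two_le_two_pow_log (n : ℕ) : n + 2 ≤ 2 ^ (Nat.log 2 n + 2) := by
  have := Nat.lt_pow_succ_log_self (b := 2) (by norm_num) n
  have := Nat.one_le_two_pow (n := Nat.log 2 n)
  simp only [Nat.succ_eq_add_one, pow_succ] at *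
  omega

theorem spaceBound_pow_le (d n : ℕ) :
    spaceBound ((n + 2) ^ d) ≤ (3 * d + 3) * (Nat.log 2 n + 1) := by
  have hlog : Nat.log 2 (2 * (n + 2) ^ d) ≤ (Nat.log 2 n + 2) * d + 1 :=
    calc Nat.log 2 (2 * (n + 2) ^ d)
        ≤ Nat.log 2 (2 * (2 ^ (Nat.log 2 n + 2)) ^ d) := by
          gcongr
          exact add_two_le_two_pow_log n
      _ = Nat.log 2 (2 ^ ((Nat.log 2 n + 2) * d + 1)) := by
          rw [pow_succ _ (_ * d), pow_mul, mul_comm]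
      _ = (Nat.log 2 n + 2) * d + 1 := Nat.log_pow (by norm_num) _
  unfold spaceBound
  nlinarith

theorem Store.encodedBy_zero (hB : 0 < B) :
    Store.EncodedBy B (0, fun _ => 0) (⟨0, fun _ _ => none, fun _ => 0⟩ : Memory K) :=
  ⟨rfl, fun _ => ⟨[], rfl, by simpa using by omega, by funext z; simp [listTape], rfl⟩⟩

theorem inLogspace_of_exec [Finite A] {X : Language A} (c : Program A) (d : ℕ)
    (h : ∀ w : List A, ∃ s, Exec w ((w.length + 2) ^ d) c (0, fun _ => 0) s ∧
      (s.2 0 ≠ 0 ↔ w ∈ X)) : InLogspace X := by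
  obtain ⟨K, ⟨M₁, hM₁⟩, M₂, hM₂⟩ := ((Component.eventually_exists_implements c).and
    (Component.eventually_exists_implementsTest (.nonzero 0))).exists
  let M := M₁.seq M₂
  have hrun : ∀ w : List A, ∃ b D, (b = true ↔ w ∈ X) ∧
      M.Run w (spaceBound ((w.length + 2) ^ d)) M.start ⟨0, fun _ _ => none, fun _ => 0⟩ b D := by
    intro w
    obtain ⟨s, hs, hX⟩ := h w
    obtain ⟨_, D, hD, hrun₁⟩ := hM₁ w _ _ _ _ hs (Store.encodedBy_zero (by positivity))
    obtain ⟨b, hb, hrun₂⟩ := hM₂ w _ _ _ hD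
    exact ⟨b, D, hb.trans hX, hrun₁.seq hrun₂⟩
  refine ⟨M.toMachine, fun w => ?_, 3 * d + 3, fun w c hc i => ?_⟩
  · obtain ⟨b, D, hb, hr⟩ := hrun w
    refine ⟨M.toCfg (Sum.inr b) D, hr.reflTransGen_toMachine, rfl, ?_⟩
    rw [← hb]
    exact Sum.inr_injective.eq_iff
  · obtain ⟨b, D, -, hr⟩ := hrun w
    exact (hr.natAbs_workHead_le hc i).trans (spaceBound_pow_le d w.length)

end Compilation

end Logspace

namespace Logspace

variable {A : Type u}

/-! ### Programs with polynomially bounded registers -/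

/-- Whenever `P w σ σ'` holds, the program `c` transforms the registers `σ` into `σ'` on the input
`w`, and the registers stay below a fixed power of any common bound on `|w| + 2` and on `σ`. The
positions of the input head are disregarded. -/
def Realizes (c : Program A) (P : List A → (ℕ → ℕ) → (ℕ → ℕ) → Prop) : Prop :=
  ∃ d, ∀ (w : List A) (N pos : ℕ) (σ σ' : ℕ → ℕ), w.length + 2 ≤ N → (∀ i, σ i ≤ N) → P w σ σ' →
    ∃ pos', Exec w (N ^ d) c (pos, σ) (pos', σ')

theorem Exec.registers_le {w : List A} {B : ℕ} {c : Program A} {s s' : Store}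
    (h : Exec w B c s s') (hs : ∀ i, s.2 i ≤ B) : ∀ i, s'.2 i ≤ B := by
  induction h with
  | inc i s h => intro j; grind [Function.update_apply]
  | dec i s h => intro j; grind [Function.update_apply]
  | move _ _ => exact hs
  | seq _ _ ih ih' => exact ih' (ih hs)
  | if_true _ _ ih => exact ih hs
  | if_false _ => exact hs
  | while_true _ _ _ ih ih' => exact ih' (ih hs)
  | while_false _ => exact hs

namespace Realizes

variable {c c' : Program A} {P P' : List A → (ℕ → ℕ) → (ℕ → ℕ) → Prop}

theorem exists_succ (h : Realizes c P) :
    ∃ d, ∀ (w : List A) (N pos : ℕ) (σ σ' : ℕ → ℕ), w.length + 2 ≤ N → (∀ i, σ i ≤ N) → P w σ σ' →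
      (∀ i, σ' i ≤ N ^ (d + 1)) ∧ ∃ pos', Exec w (N ^ (d + 1)) c (pos, σ) (pos', σ') := by
  obtain ⟨d, hd⟩ := h
  refine ⟨d, fun w N pos σ σ' hN hσ hP => ?_⟩
  obtain ⟨pos', hexec⟩ := hd w N pos σ σ' hN hσ hP
  have hexec' := hexec.mono (Nat.pow_le_pow_right (by omega) (Nat.le_succ d))
  exact ⟨hexec'.registers_le fun i => (hσ i).trans (Nat.le_self_pow d.succ_ne_zero N), pos', hexec'⟩

theorem mono (h : Realizes c P) (hP : ∀ w σ σ', P' w σ σ' → P w σ σ') : Realizes c P' := by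
  obtain ⟨d, hd⟩ := h
  exact ⟨d, fun w N pos σ σ' hN hσ h' => hd w N pos σ σ' hN hσ (hP _ _ _ h')⟩

theorem seq (h : Realizes c P) (h' : Realizes c' P') :
    Realizes (.seq c c') fun w σ σ'' => ∃ σ', P w σ σ' ∧ P' w σ' σ'' := by
  obtain ⟨d, hd⟩ := h.exists_succ
  obtain ⟨d', hd'⟩ := h'.exists_succ
  refine ⟨(d + 1) * (d' + 1), ?_⟩
  rintro w N pos σ σ'' hN hσ ⟨σ', hP, hP'⟩
  obtain ⟨hσ', pos', hexec⟩ := hd w N pos σ σ' hN hσ hP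
  have hN' : N ≤ N ^ (d + 1) := Nat.le_self_pow d.succ_ne_zero N
  obtain ⟨-, pos'', hexec'⟩ := hd' w (N ^ (d + 1)) pos' σ' σ'' (hN.trans hN') hσ' hP'
  rw [← pow_mul] at hexec'
  exact ⟨pos'', .seq (hexec.mono (Nat.pow_le_pow_right (by omega)
    (Nat.le_mul_of_pos_right _ (by omega)))) hexec'⟩

theorem ifThen (h : Realizes c P) (r : ℕ) :
    Realizes (.ifThen (.nonzero r) c)
      fun w σ σ' => (σ r ≠ 0 ∧ P w σ σ') ∨ (σ r = 0 ∧ σ' = σ) := by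
  obtain ⟨d, hd⟩ := h
  refine ⟨d, ?_⟩
  rintro w N pos σ σ' hN hσ (⟨hr, hP⟩ | ⟨hr, rfl⟩)
  · obtain ⟨pos', hexec⟩ := hd w N pos σ σ' hN hσ hP
    exact ⟨pos', .if_true hr hexec⟩
  · exact ⟨pos, .if_false (· hr)⟩

theorem whileDo (h : Realizes c P) (r e : ℕ) :
    Realizes (.whileDo (.nonzero r) c) fun w σ σ' => ∃ (t : ℕ) (f : ℕ → ℕ → ℕ),
      f 0 = σ ∧ f t = σ' ∧ (∀ j < t, f j r ≠ 0 ∧ P w (f j) (f (j + 1))) ∧ f t r = 0 ∧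
      ∀ N, w.length + 2 ≤ N → (∀ i, σ i ≤ N) → ∀ j ≤ t, ∀ i, f j i ≤ N ^ e := by
  obtain ⟨d, hd⟩ := h
  refine ⟨(e + 1) * d, ?_⟩
  rintro w N pos _ _ hN hσ ⟨t, f, rfl, rfl, hf, ht, hbound⟩
  have hN' : N ≤ N ^ (e + 1) := Nat.le_self_pow e.succ_ne_zero N
  have from_round (k : ℕ) : ∀ j pos, j + k = t →
      ∃ pos', Exec w (N ^ ((e + 1) * d)) (.whileDo (.nonzero r) c) (pos, f j) (pos', f t) := by
    induction k with
    | zero =>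
      rintro j pos rfl
      exact ⟨pos, .while_false (· ht)⟩
    | succ k ih =>
      intro j pos hjk
      obtain ⟨hr, hP⟩ := hf j (by omega)
      obtain ⟨pos', hexec⟩ := hd w (N ^ (e + 1)) pos _ _ (hN.trans hN')
        (fun i => (hbound N hN hσ j (by omega) i).trans
          (Nat.pow_le_pow_right (by omega) (Nat.le_succ e))) hP
      obtain ⟨pos'', hexec'⟩ := ih (j + 1) pos' (by omega)
      rw [← pow_mul] at hexec
      exact ⟨pos'', .while_true hr hexec hexec'⟩
  exact from_round t 0 pos (by omega)

end Realizes

theorem realizes_inc (i : ℕ) :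
    Realizes (A := A) (.inc i) fun _ σ σ' => σ' = Function.update σ i (σ i + 1) := by
  refine ⟨2, ?_⟩
  rintro w N pos σ _ hN hσ rfl
  have hi : σ i + 1 ≤ N ^ 2 := by nlinarith [hσ i]
  exact ⟨pos, .inc i (pos, σ) hi⟩

theorem realizes_dec (i : ℕ) :
    Realizes (A := A) (.dec i) fun _ σ σ' => σ i ≠ 0 ∧ σ' = Function.update σ i (σ i - 1) := by
  refine ⟨0, ?_⟩
  rintro w N pos σ _ - - ⟨hi, rfl⟩
  exact ⟨pos, .dec i (pos, σ) hi⟩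

/-- Do nothing. -/
def Program.skip : Program A := .ifThen (.sees fun _ => false) (.dec 0)

theorem realizes_skip : Realizes (A := A) .skip fun _ σ σ' => σ' = σ := by
  refine ⟨0, ?_⟩
  rintro w N pos σ _ - - rfl
  exact ⟨pos, .if_false (by simp [Test.Holds])⟩

/-- Set the register `r` to zero. -/
def Program.clear (r : ℕ) : Program A := .whileDo (.nonzero r) (.dec r)

theorem realizes_clear (r : ℕ) :
    Realizes (A := A) (.clear r) fun _ σ σ' => σ' = Function.update σ r 0 := by
  refine ((realizes_dec r).whileDo r 1).mono ?_
  rintro w σ _ rfl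
  refine ⟨σ r, fun j => Function.update σ r (σ r - j), by simp, by simp, fun j hj => ⟨?_, ?_, ?_⟩,
    by simp, fun N _ hσ j _ i => ?_⟩
  · simpa using by omega
  · simpa using by omega
  · grind [Function.update_apply]
  · grind [Function.update_apply]

/-- Move the contents of the register `r` to the register `s`. -/
def Program.transfer (r s : ℕ) : Program A :=
  .seq (.clear s) (.whileDo (.nonzero r) (.seq (.dec r) (.inc s)))

theorem realizes_transfer {r s : ℕ} (hrs : r ≠ s) : Realizes (A := A) (.transfer r s)
    fun _ σ σ' => σ' = Function.update (Function.update σ s (σ r)) r 0 := by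
  refine ((realizes_clear s).seq
    (((realizes_dec r).seq (realizes_inc s)).whileDo r 1)).mono ?_
  rintro w σ _ rfl
  refine ⟨_, rfl, σ r, fun j => Function.update (Function.update σ s j) r (σ r - j), ?_, by simp,
    fun j hj => ⟨?_, _, ⟨?_, rfl⟩, ?_⟩, by simp, fun N _ hσ j hj i => ?_⟩
  · grind [Function.update_apply]
  · grind [Function.update_apply]
  · grind [Function.update_apply]
  · grind [Function.update_apply]
  · have := hσ r
    have := hσ i
    grind [Function.update_apply]

/-- Copy the register `r` to the register `s`, with the help of the register `t`. -/
def Program.copy (r s t : ℕ) : Program A :=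
  .seq (.whileDo (.nonzero r) (.seq (.dec r) (.seq (.inc s) (.inc t)))) (.transfer t r)

theorem realizes_copy {r s t : ℕ} (hrs : r ≠ s) (hrt : r ≠ t) (hst : s ≠ t) :
    Realizes (A := A) (.copy r s t)
      fun _ σ σ' => σ s = 0 ∧ σ t = 0 ∧ σ' = Function.update σ s (σ r) := by
  refine ((((realizes_dec r).seq ((realizes_inc s).seq (realizes_inc t))).whileDo r 1).seq
    (realizes_transfer hrt.symm)).mono ?_
  rintro w σ _ ⟨hs, ht, rfl⟩
  refine ⟨_, ⟨σ r, fun j => Function.update (Function.update (Function.update σ t j) s j) r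
    (σ r - j), ?_, rfl, fun j hj => ⟨?_, _, ⟨?_, rfl⟩, _, rfl, ?_⟩, by simp,
    fun N _ hσ j hj i => ?_⟩, ?_⟩
  · grind [Function.update_apply]
  · grind [Function.update_apply]
  · grind [Function.update_apply]
  · grind [Function.update_apply]
  · have := hσ r
    have := hσ i
    grind [Function.update_apply]
  · grind [Function.update_apply]

/-- Set the registers `m, …, m + k - 1` to zero. -/
def Program.clearBlock (m : ℕ) : ℕ → Program A
  | 0 => .skip
  | k + 1 => .seq (.clearBlock m k) (.clear (m + k))

theorem realizes_clearBlock (m k : ℕ) : Realizes (A := A) (.clearBlock m k)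
    fun _ σ σ' => σ' = fun i => if m ≤ i ∧ i < m + k then 0 else σ i := by
  induction k with
  | zero =>
    refine realizes_skip.mono ?_
    rintro - σ _ rfl
    grind
  | succ k ih =>
    refine (ih.seq (realizes_clear _)).mono ?_
    rintro - σ _ rfl
    exact ⟨_, rfl, by grind [Function.update_apply]⟩

/-- Shift the contents of the registers `m + δ, …, m + δ + k - 1` down by `δ`. -/
def Program.shiftBlock (m δ : ℕ) : ℕ → Program A
  | 0 => .skip
  | k + 1 => .seq (.shiftBlock m δ k) (.transfer (m + k + δ) (m + k))

theorem realizes_shiftBlock (m k : ℕ) {δ : ℕ} (hδ : δ ≠ 0) : Realizes (A := A) (.shiftBlock m δ k)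
    fun _ σ σ' => σ' = fun i => if m ≤ i ∧ i < m + k then σ (i + δ) else
      if m + δ ≤ i ∧ i < m + δ + k then 0 else σ i := by
  induction k with
  | zero =>
    refine realizes_skip.mono ?_
    rintro - σ _ rfl
    grind
  | succ k ih =>
    refine (ih.seq (realizes_transfer (by omega))).mono ?_
    rintro - σ _ rfl
    exact ⟨_, rfl, by grind [Function.update_apply]⟩

end Logspace

namespace Logspace

variable {A : Type u}

/-! ### Functions computable in logarithmic space -/

/-- Types whose elements are tuples of natural numbers, the arguments and values of the functions
computed by register programs. Only the coordinates `coord a i` with `i < dim` matter. -/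
class NatTuple (α : Type v) where
  dim : ℕ
  coord : α → ℕ → ℕ

namespace NatTuple

instance : NatTuple ℕ := ⟨1, fun n _ => n⟩

instance : NatTuple Unit := ⟨0, fun _ _ => 0⟩

instance {α β : Type*} [NatTuple α] [NatTuple β] : NatTuple (α × β) :=
  ⟨dim α + dim β, fun x i => if i < dim α then coord x.1 i else coord x.2 (i - dim α)⟩

instance (t : ℕ) : NatTuple (Fin t → ℕ) := ⟨t, fun x i => if h : i < t then x ⟨i, h⟩ else 0⟩

variable {α β : Type*} [NatTuple α] [NatTuple β]

@[simp]
theorem coord_nat (n i : ℕ) : coord n i = n := rfl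

@[simp]
theorem dim_nat : dim ℕ = 1 := rfl

theorem dim_prod : dim (α × β) = dim α + dim β := rfl

theorem coord_prod (x : α × β) (i : ℕ) :
    coord x i = if i < dim α then coord x.1 i else coord x.2 (i - dim α) := rfl

/-- All coordinates of `a` are at most `N`. -/
def BoundedBy (a : α) (N : ℕ) : Prop := ∀ i < dim α, coord a i ≤ N

theorem BoundedBy.mono {a : α} {N N' : ℕ} (h : BoundedBy a N) (hN : N ≤ N') : BoundedBy a N' :=
  fun i hi => (h i hi).trans hN

@[simp]
theorem boundedBy_nat {n N : ℕ} : BoundedBy n N ↔ n ≤ N :=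
  ⟨fun h => h 0 Nat.one_pos, fun h _ _ => h⟩

@[simp]
theorem boundedBy_prod {x : α × β} {N : ℕ} : BoundedBy x N ↔ BoundedBy x.1 N ∧ BoundedBy x.2 N := by
  refine ⟨fun h => ⟨fun i hi => ?_, fun i hi => ?_⟩, fun ⟨h₁, h₂⟩ i hi => ?_⟩
  · simpa [coord_prod, hi] using h i (by rw [dim_prod]; omega)
  · simpa [coord_prod] using h (dim α + i) (by rw [dim_prod]; omega)
  · rw [dim_prod] at hi
    rw [coord_prod]
    split_ifs with h
    · exact h₁ i h
    · exact h₂ _ (by omega)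

end NatTuple

open NatTuple

/-- Write the values `v 0, …, v (k - 1)` into the registers `m, …, m + k - 1`. -/
def writeBlock (σ : ℕ → ℕ) (m k : ℕ) (v : ℕ → ℕ) : ℕ → ℕ :=
  fun i => if m ≤ i ∧ i < m + k then v (i - m) else σ i

theorem writeBlock_add (σ : ℕ → ℕ) (m : ℕ) {k : ℕ} (v : ℕ → ℕ) {i : ℕ} (hi : i < k) :
    writeBlock σ m k v (m + i) = v i := by
  simp [writeBlock, hi]

theorem writeBlock_of_lt (σ : ℕ → ℕ) {m : ℕ} (k : ℕ) (v : ℕ → ℕ) {i : ℕ} (hi : i < m) :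
    writeBlock σ m k v i = σ i := by
  grind [writeBlock]

theorem writeBlock_of_ge (σ : ℕ → ℕ) {m k : ℕ} (v : ℕ → ℕ) {i : ℕ} (hi : m + k ≤ i) :
    writeBlock σ m k v i = σ i := by
  grind [writeBlock]

theorem writeBlock_nat (σ : ℕ → ℕ) (m n : ℕ) :
    writeBlock σ m (dim ℕ) (coord n) = Function.update σ m n := by
  grind [writeBlock, dim_nat, coord_nat, Function.update_apply]

/-- The registers `args` hold the value `a`, and the registers from `m` on are empty. -/
def HoldsInput {α : Type v} [NatTuple α] (σ : ℕ → ℕ) (args : ℕ → ℕ) (m : ℕ) (a : α) : Prop :=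
  (∀ i < dim α, σ (args i) = coord a i) ∧ ∀ i, m ≤ i → σ i = 0

/-- The function `f`, relative to an input word, is computed by register programs whose registers
are polynomially bounded: for any choice `args` of argument registers below `m`, there is a program
that writes the value of `f` into the registers from `m` on, using these registers as its memory. -/
def LogspaceFun {α β : Type*} [NatTuple α] [NatTuple β] (f : List A → α → β) : Prop :=
  ∀ (args : ℕ → ℕ) (m : ℕ), (∀ i < dim α, args i < m) → ∃ c : Program A, Realizes c fun w σ σ' =>
    ∃ a, HoldsInput σ args m a ∧ σ' = writeBlock σ m (dim β) (coord (f w a))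

/-- The values of `f` are polynomially bounded in the length of the input word and the argument. -/
def PolyBounded {α β : Type*} [NatTuple α] [NatTuple β] (f : List A → α → β) : Prop :=
  ∃ d, ∀ (w : List A) (N : ℕ) (a : α), w.length + 2 ≤ N → BoundedBy a N → BoundedBy (f w a) (N ^ d)

namespace LogspaceFun

variable {α β γ : Type*} [NatTuple α] [NatTuple β] [NatTuple γ]

theorem polyBounded {f : List A → α → β} (hf : LogspaceFun f) : PolyBounded f := by
  obtain ⟨c, hc⟩ := hf id (dim α) (fun _ hi => hi)
  obtain ⟨d, hd⟩ := hc.exists_succ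
  refine ⟨d + 1, fun w N a hN ha i hi => ?_⟩
  obtain ⟨hbound, -⟩ := hd w N 0 (fun i => if i < dim α then coord a i else 0) _ hN
    (fun i => by split_ifs with h; exacts [ha i h, Nat.zero_le _])
    ⟨a, ⟨fun i hi => if_pos hi, fun i hi => if_neg (by omega)⟩, rfl⟩
  simpa only [writeBlock_add _ _ _ hi] using hbound (dim α + i)

theorem congr {f g : List A → α → β} (hf : LogspaceFun f)
    (h : ∀ w a, ∀ i < dim β, coord (f w a) i = coord (g w a) i) : LogspaceFun g := by
  intro args m hm
  obtain ⟨c, hc⟩ := hf args m hm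
  refine ⟨c, hc.mono ?_⟩
  rintro w σ _ ⟨a, ha, rfl⟩
  exact ⟨a, ha, by grind [writeBlock]⟩

theorem comp {g : List A → β → γ} {f : List A → α → β} (hg : LogspaceFun g) (hf : LogspaceFun f) :
    LogspaceFun fun w a => g w (f w a) := by
  intro args m hm
  obtain ⟨c, hc⟩ := hf args (m + 1) (fun i hi => (hm i hi).trans (Nat.lt_succ_self m))
  obtain ⟨c', hc'⟩ := hg (fun i => m + 1 + i) (m + 1 + dim β) (fun i hi => by omega)
  refine ⟨_, (((hc.seq hc').seq (realizes_shiftBlock m (dim γ) (δ := 1 + dim β) (by omega))).seq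
    (realizes_clearBlock (m + dim γ) (1 + dim β))).mono ?_⟩
  rintro w σ _ ⟨a, ha, rfl⟩
  have hempty := ha.2
  refine ⟨_, ⟨_, ⟨_, ⟨a, ⟨ha.1, fun i hi => hempty i (by omega)⟩, rfl⟩, f w a,
    ⟨fun i hi => writeBlock_add _ _ _ hi, fun i hi => ?_⟩, rfl⟩, rfl⟩, ?_⟩
  · rw [writeBlock_of_ge _ _ hi]
    exact hempty i (by omega)
  · funext i
    simp only [writeBlock]
    grind

theorem coordinate (j : ℕ) (hj : j < dim α) :
    LogspaceFun fun (_ : List A) (a : α) => coord a j := by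
  intro args m hm
  have := hm j hj
  refine ⟨_, (realizes_copy (r := args j) (s := m) (t := m + 1) (by omega) (by omega)
    (by omega)).mono ?_⟩
  rintro w σ _ ⟨a, ha, rfl⟩
  exact ⟨ha.2 _ le_rfl, ha.2 _ (by omega), by rw [ha.1 j hj, writeBlock_nat]⟩

theorem of_coord {f : List A → α → β}
    (h : ∀ j < dim β, LogspaceFun fun w a => coord (f w a) j) : LogspaceFun f := by
  intro args m hm
  have first_coords (k : ℕ) (hk : k ≤ dim β) : ∃ c : Program A, Realizes c fun w σ σ' =>
      ∃ a, HoldsInput σ args m a ∧ σ' = writeBlock σ m k (coord (f w a)) := by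
    induction k with
    | zero =>
      refine ⟨_, realizes_skip.mono ?_⟩
      rintro w σ _ ⟨a, -, rfl⟩
      grind [writeBlock]
    | succ k ih =>
      obtain ⟨c, hc⟩ := ih (by omega)
      obtain ⟨c', hc'⟩ := h k (by omega) args (m + k) (fun i hi => (hm i hi).trans_le (by omega))
      refine ⟨_, (hc.seq hc').mono ?_⟩
      rintro w σ _ ⟨a, ha, rfl⟩
      refine ⟨_, ⟨a, ha, rfl⟩, a, ⟨fun i hi => ?_, fun i hi => ?_⟩, ?_⟩
      · rw [writeBlock_of_lt _ _ _ (hm i hi)]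
        exact ha.1 i hi
      · rw [writeBlock_of_ge _ _ hi]
        exact ha.2 i (by omega)
      · rw [writeBlock_nat]
        grind [writeBlock, Function.update_apply]
  exact first_coords _ le_rfl

theorem fst : LogspaceFun fun (_ : List A) (x : α × β) => x.1 :=
  .of_coord fun j hj => (coordinate (α := α × β) j (by rw [dim_prod]; omega)).congr
    fun _ a i _ => by simp [coord_prod, hj]

theorem snd : LogspaceFun fun (_ : List A) (x : α × β) => x.2 :=
  .of_coord fun j hj => (coordinate (α := α × β) (dim α + j) (by rw [dim_prod]; omega)).congr
    fun _ a i _ => by simp [coord_prod]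

theorem id : LogspaceFun fun (_ : List A) (x : α) => x := .of_coord coordinate

theorem pair {f : List A → α → β} {g : List A → α → γ} (hf : LogspaceFun f) (hg : LogspaceFun g) :
    LogspaceFun fun w a => (f w a, g w a) := by
  refine .of_coord fun j hj => ?_
  rw [dim_prod] at hj
  rcases lt_or_ge j (dim β) with h | h
  · exact ((coordinate j h).comp hf).congr fun w a i _ => by simp [coord_prod, h]
  · exact ((coordinate (j - dim β) (by omega)).comp hg).congr fun w a i _ => by
      simp [coord_prod, not_lt.2 h]

theorem pi {t : ℕ} {f : List A → α → Fin t → ℕ} (hf : ∀ i, LogspaceFun fun w a => f w a i) :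
    LogspaceFun f :=
  .of_coord fun j hj => (hf ⟨j, hj⟩).congr fun w a _ _ =>
    (dif_pos (c := j < t) (t := fun h => f w a ⟨j, h⟩) (e := fun _ => 0) hj).symm

theorem proj {t : ℕ} (i : Fin t) : LogspaceFun fun (_ : List A) (x : Fin t → ℕ) => x i :=
  (coordinate (α := Fin t → ℕ) i.1 i.2).congr fun _ a j _ => by simp [coord]

theorem of_realizes {f : List A → ℕ → ℕ}
    (h : ∀ r m, r < m → ∃ c : Program A, Realizes c fun w σ σ' =>
      (∀ i, m ≤ i → σ i = 0) ∧ σ' = Function.update σ m (f w (σ r))) : LogspaceFun f := by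
  intro args m hm
  obtain ⟨c, hc⟩ := h (args 0) m (hm 0 Nat.one_pos)
  refine ⟨c, hc.mono ?_⟩
  rintro w σ _ ⟨a, ha, rfl⟩
  have harg : σ (args 0) = a := ha.1 0 Nat.one_pos
  exact ⟨ha.2, by rw [harg, writeBlock_nat]⟩

end LogspaceFun

/-! ### Basic functions -/

theorem exists_realizes_const (m n : ℕ) : ∃ c : Program A,
    Realizes c fun _ σ σ' => σ m = 0 ∧ σ' = Function.update σ m n := by
  induction n with
  | zero =>
    refine ⟨_, realizes_skip.mono ?_⟩
    rintro - σ _ ⟨h, rfl⟩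
    rw [← h, Function.update_eq_self]
  | succ n ih =>
    obtain ⟨c, hc⟩ := ih
    refine ⟨_, (hc.seq (realizes_inc m)).mono ?_⟩
    rintro - σ _ ⟨h, rfl⟩
    exact ⟨_, ⟨h, rfl⟩, by simp⟩

/-- Move the input head to the left end marker. -/
def Program.rewind : Program A :=
  .whileDo (.sees fun | .leftEnd => false | _ => true) (.move .left)

theorem exec_rewind (w : List A) (B pos : ℕ) (σ : ℕ → ℕ) :
    Exec w B .rewind (pos, σ) (0, σ) := by
  induction pos with
  | zero => exact .while_false (by simp [Test.Holds, inputCell])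
  | succ n ih =>
    refine .while_true ?_ (.move _ _) ih
    simp only [Test.Holds, inputCell]
    cases w[n]? <;> simp

/-- Move the input head to the right as often as the register `m` says, and empty this register. -/
def Program.advance (m : ℕ) : Program A := .whileDo (.nonzero m) (.seq (.dec m) (.move .right))

theorem exec_advance (w : List A) (B pos m : ℕ) (σ : ℕ → ℕ) :
    Exec w B (.advance m) (min pos (w.length + 1), σ)
      (min (pos + σ m) (w.length + 1), Function.update σ m 0) := by
  induction hx : σ m generalizing pos σ with
  | zero =>
    rw [← hx, Function.update_eq_self, hx]
    exact .while_false (by simp [Test.Holds, hx])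
  | succ x ih =>
    have hrest := ih (pos + 1) (Function.update σ m x) (by simp)
    have hpos : min (pos + 1) (w.length + 1) =
      min (min pos (w.length + 1) + 1) (w.length + 1) := by omega
    rw [Function.update_idem, add_assoc, add_comm 1 x, hpos] at hrest
    refine .while_true (by simp [Test.Holds, hx]) (.seq (.dec m _ (by simp [hx])) (.move _ _)) ?_
    simpa [hx, moveInput, Program.advance] using hrest

theorem inputCell_min (w : List A) (x : ℕ) :
    inputCell w (min x (w.length + 1)) = inputCell w x := by
  rcases le_or_gt x (w.length + 1) with h | h
  · rw [min_eq_left h]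
  · obtain ⟨y, rfl⟩ : ∃ y, x = y + 1 := ⟨x - 1, by omega⟩
    rw [min_eq_right h.le]
    simp only [inputCell]
    rw [List.getElem?_eq_none le_rfl, List.getElem?_eq_none (by omega)]

theorem exec_readCell (p : InSym A → Bool) (w : List A) {B : ℕ} (hB : 1 ≤ B) (pos : ℕ) {m : ℕ}
    {σ : ℕ → ℕ} (hm : σ m = 0) (x : ℕ) :
    ∃ pos', Exec w B (.seq .rewind (.seq (.advance m) (.ifThen (.sees p) (.inc m))))
      (pos, Function.update σ m x)
      (pos', Function.update σ m (if p (inputCell w x) then 1 else 0)) := by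
  have hadvance := exec_advance w B 0 m (Function.update σ m x)
  rw [Function.update_self, Function.update_idem, ← hm, Function.update_eq_self, hm, zero_add,
    Nat.zero_min] at hadvance
  refine ⟨min x (w.length + 1), .seq (exec_rewind ..) (.seq hadvance ?_)⟩
  cases hp : p (inputCell w x) with
  | false =>
    rw [if_neg (by simp), ← hm, Function.update_eq_self]
    exact .if_false (by simp [Test.Holds, inputCell_min, hp])
  | true =>
    refine .if_true (by simp [Test.Holds, inputCell_min, hp]) ?_
    simpa [hm] using Exec.inc (w := w) (B := B) m (min x (w.length + 1), σ) (by simpa [hm] using hB)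

namespace LogspaceFun

variable {α β : Type*} [NatTuple α] [NatTuple β]

theorem const_nat (n : ℕ) : LogspaceFun fun (_ : List A) (_ : α) => n := by
  intro args m _
  obtain ⟨c, hc⟩ := exists_realizes_const (A := A) m n
  refine ⟨c, hc.mono ?_⟩
  rintro - σ _ ⟨a, ha, rfl⟩
  exact ⟨ha.2 _ le_rfl, writeBlock_nat _ _ _⟩

theorem succ : LogspaceFun fun (_ : List A) (n : ℕ) => n + 1 := by
  refine .of_realizes fun r m hr => ⟨_, ((realizes_copy (r := r) (s := m) (t := m + 1) (by omega)
    (by omega) (by omega)).seq (realizes_inc m)).mono ?_⟩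
  rintro - σ _ ⟨hempty, rfl⟩
  exact ⟨_, ⟨hempty _ le_rfl, hempty _ (by omega), rfl⟩, by simp⟩

theorem pred : LogspaceFun fun (_ : List A) (n : ℕ) => n - 1 := by
  refine .of_realizes fun r m hr => ⟨_, ((realizes_copy (r := r) (s := m) (t := m + 1) (by omega)
    (by omega) (by omega)).seq ((realizes_dec m).ifThen m)).mono ?_⟩
  rintro - σ _ ⟨hempty, rfl⟩
  refine ⟨_, ⟨hempty _ le_rfl, hempty _ (by omega), rfl⟩, ?_⟩
  grind [Function.update_apply]

theorem isZero : LogspaceFun fun (_ : List A) (n : ℕ) => if n = 0 then 1 else 0 := by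
  refine .of_realizes fun r m hr =>
    ⟨_, ((realizes_inc m).seq ((realizes_dec m).ifThen r)).mono ?_⟩
  rintro - σ _ ⟨hempty, rfl⟩
  have hm := hempty m le_rfl
  refine ⟨_, rfl, ?_⟩
  grind [Function.update_apply]

theorem sees (p : InSym A → Bool) :
    LogspaceFun fun w (x : ℕ) => if p (inputCell w x) then 1 else 0 := by
  refine .of_realizes fun r m hr => ?_
  obtain ⟨d, hd⟩ := realizes_copy (A := A) (r := r) (s := m) (t := m + 1) (by omega) (by omega)
    (by omega)
  refine ⟨.seq (.copy r m (m + 1))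
    (.seq .rewind (.seq (.advance m) (.ifThen (.sees p) (.inc m)))), d, ?_⟩
  rintro w N pos σ _ hN hσ ⟨hempty, rfl⟩
  obtain ⟨pos', hcopy⟩ := hd w N pos σ _ hN hσ ⟨hempty m le_rfl, hempty _ (by omega), rfl⟩
  obtain ⟨pos'', hread⟩ := exec_readCell p w (Nat.one_le_pow d N (by omega)) pos'
    (hempty m le_rfl) (σ r)
  exact ⟨pos'', .seq hcopy hread⟩

/-! ### Iteration -/

theorem exists_realizes_update {f : List A → α × β → β} (hf : LogspaceFun f) (hβ : dim β ≠ 0)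
    {args : ℕ → ℕ} {m : ℕ} (hm : ∀ i < dim α, args i < m) :
    ∃ c : Program A, Realizes c fun w σ σ' => ∃ (σ₀ : ℕ → ℕ) (a : α) (b : β),
      HoldsInput σ₀ args m a ∧ σ = writeBlock σ₀ m (dim β) (coord b) ∧
      σ' = writeBlock σ₀ m (dim β) (coord (f w (a, b))) := by
  have hargs : ∀ i < dim (α × β),
      (if i < dim α then args i else m + (i - dim α)) < m + dim β := by
    intro i hi
    rw [dim_prod] at hi
    split_ifs with h
    · exact (hm i h).trans_le (by omega)
    · omega
  obtain ⟨c, hc⟩ := hf _ _ hargs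
  refine ⟨_, (hc.seq (realizes_shiftBlock m (dim β) hβ)).mono ?_⟩
  rintro w _ _ ⟨σ₀, a, b, ha, rfl, rfl⟩
  have hempty := ha.2
  refine ⟨_, ⟨(a, b), ⟨fun i hi => ?_, fun i hi => ?_⟩, rfl⟩, ?_⟩
  · rw [dim_prod] at hi
    rw [coord_prod]
    split_ifs with h <;> simp only [h, if_true, if_false]
    · rw [writeBlock_of_lt _ _ _ (hm i h), ha.1 i h]
    · rw [writeBlock_add _ _ _ (by omega)]
  · rw [writeBlock_of_ge _ _ hi, hempty i (by omega)]
  · funext i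
    simp only [writeBlock]
    grind

/-- The first component of the state `s w a j` after `j` rounds is the flag that keeps the loop
running. -/
theorem whileLoop {s : List A → α → ℕ → ℕ × β} {t : List A → α → ℕ}
    {step : List A → α × (ℕ × β) → ℕ × β} (hinit : LogspaceFun fun w a => s w a 0)
    (hstep : LogspaceFun step) (hs : ∀ w a, ∀ j < t w a, s w a (j + 1) = step w (a, s w a j))
    (hflag : ∀ w a, ∀ j < t w a, (s w a j).1 ≠ 0) (hend : ∀ w a, (s w a (t w a)).1 = 0) {e : ℕ}
    (hbound : ∀ (w : List A) (N : ℕ) (a : α), w.length + 2 ≤ N → BoundedBy a N →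
      ∀ j ≤ t w a, BoundedBy (s w a j) (N ^ e)) :
    LogspaceFun fun w a => s w a (t w a) := by
  intro args m hm
  obtain ⟨c₀, hc₀⟩ := hinit args m hm
  obtain ⟨c, hc⟩ := exists_realizes_update hstep (by simp [dim_prod]) hm
  refine ⟨_, (hc₀.seq (hc.whileDo m (e + 1))).mono ?_⟩
  rintro w σ _ ⟨a, ha, rfl⟩
  have hreg (j : ℕ) : writeBlock σ m (dim (ℕ × β)) (coord (s w a j)) m = (s w a j).1 := by
    simpa [coord_prod] using
      writeBlock_add σ m (k := dim (ℕ × β)) (coord (s w a j)) (i := 0) (by simp [dim_prod])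
  refine ⟨_, ⟨a, ha, rfl⟩, t w a,
    fun j => writeBlock σ m (dim (ℕ × β)) (coord (s w a j)), rfl, rfl,
    fun j hj => ⟨?_, σ, a, s w a j, ha, rfl, ?_⟩, ?_, fun N hN hσ₀ j hj i => ?_⟩
  · exact (hreg j).trans_ne (hflag w a j hj)
  · simp only [hs w a j hj]
  · exact (hreg (t w a)).trans (hend w a)
  · have hσ (i : ℕ) : σ i ≤ N := by
      rcases lt_or_ge i m with hi | hi
      · simpa only [writeBlock_of_lt _ _ _ hi] using hσ₀ i
      · exact (ha.2 i hi).trans_le (Nat.zero_le N)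
    have hstate := (hbound w N a hN (fun i hi => (ha.1 i hi).symm.trans_le (hσ _)) j hj).mono
      (Nat.pow_le_pow_right (by omega) (Nat.le_succ e))
    simp only [writeBlock]
    split_ifs with hi
    · exact hstate _ (by omega)
    · exact (hσ i).trans (Nat.le_self_pow e.succ_ne_zero N)

theorem inLogspace [Finite A] {X : Language A} {f : List A → ℕ}
    (hf : LogspaceFun fun w (_ : Unit) => f w) (hX : ∀ w, f w ≠ 0 ↔ w ∈ X) : InLogspace X := by
  obtain ⟨c, d, hd⟩ := hf (fun _ => 0) 0 (fun i hi => absurd hi (Nat.not_lt_zero i))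
  refine inLogspace_of_exec c d fun w => ?_
  obtain ⟨pos, h⟩ := hd w (w.length + 2) 0 (fun _ => 0) _ le_rfl (fun _ => Nat.zero_le _)
    ⟨(), ⟨fun i hi => absurd hi (Nat.not_lt_zero i), fun _ _ => rfl⟩, rfl⟩
  exact ⟨_, h, by simpa only [writeBlock_nat, Function.update_self] using hX w⟩

end LogspaceFun

end Logspace

namespace Logspace

open NatTuple

variable {A : Type u} {α β : Type*} [NatTuple α] [NatTuple β]

namespace LogspaceFun

/-! ### Primitive recursion and arithmetic -/

theorem primrec {r : List A → α → ℕ → β} {step : List A → α × (β × ℕ) → β}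
    (hzero : LogspaceFun fun w a => r w a 0) (hstep : LogspaceFun step)
    (hsucc : ∀ w a i, r w a (i + 1) = step w (a, (r w a i, i)))
    (hbound : PolyBounded fun w (x : α × ℕ) => r w x.1 x.2) :
    LogspaceFun fun w (x : α × ℕ) => r w x.1 x.2 := by
  obtain ⟨d, hd⟩ := hbound
  refine (fst.comp snd).comp (whileLoop (α := α × ℕ) (β := β × ℕ)
    (s := fun w x j => (x.2 - j, (r w x.1 j, j))) (t := fun _ x => x.2)
    (step := fun w y => (y.2.1 - 1, (step w (y.1.1, y.2.2), y.2.2.2 + 1)))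
    ?_ ?_ ?_ ?_ ?_ (e := d + 1) ?_)
  · exact snd.pair ((hzero.comp fst).pair (const_nat 0))
  · exact (pred.comp (fst.comp snd)).pair
      ((hstep.comp ((fst.comp fst).pair (snd.comp snd))).pair
        (succ.comp (snd.comp (snd.comp snd))))
  · rintro w ⟨a, n⟩ j -
    simp only [hsucc, Nat.sub_sub]
  · rintro - ⟨a, n⟩ j hj
    exact Nat.sub_ne_zero_of_lt hj
  · exact fun _ x => Nat.sub_self x.2
  · rintro w N ⟨a, n⟩ hN ha j hj
    simp only [boundedBy_prod, boundedBy_nat] at ha hj ⊢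
    have hjN : j ≤ N := hj.trans ha.2
    have hNd : N ≤ N ^ (d + 1) := Nat.le_self_pow d.succ_ne_zero N
    have hr := (hd w N (a, j) hN (boundedBy_prod.2 ⟨ha.1, boundedBy_nat.2 hjN⟩)).mono
      (Nat.pow_le_pow_right (show 0 < N by omega) d.le_succ)
    exact ⟨by omega, hr, by omega⟩

theorem polyBounded_of_le {f g : List A → α → ℕ} (hg : LogspaceFun g)
    (h : ∀ w a, f w a ≤ g w a) : PolyBounded f := by
  obtain ⟨d, hd⟩ := hg.polyBounded
  refine ⟨d, fun w N a hN ha => ?_⟩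
  rw [boundedBy_nat]
  exact (h w a).trans (boundedBy_nat.1 (hd w N a hN ha))

theorem add {f g : List A → α → ℕ} (hf : LogspaceFun f) (hg : LogspaceFun g) :
    LogspaceFun fun w a => f w a + g w a := by
  have hadd : LogspaceFun fun (_ : List A) (x : ℕ × ℕ) => x.1 + x.2 :=
    primrec (r := fun _ a i => a + i) (step := fun _ y => y.2.1 + 1) id
      (succ.comp (fst.comp snd)) (fun _ _ _ => rfl)
      ⟨2, fun w N x hN hx => by
        simp only [boundedBy_prod, boundedBy_nat] at hx ⊢
        nlinarith⟩
  exact hadd.comp (hf.pair hg)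

theorem mul {f g : List A → α → ℕ} (hf : LogspaceFun f) (hg : LogspaceFun g) :
    LogspaceFun fun w a => f w a * g w a := by
  have hmul : LogspaceFun fun (_ : List A) (x : ℕ × ℕ) => x.1 * x.2 :=
    primrec (r := fun _ a i => a * i) (step := fun _ y => y.2.1 + y.1) (const_nat 0)
      ((fst.comp snd).add fst) (fun _ _ _ => rfl)
      ⟨2, fun _ N x _ hx => by
        simp only [boundedBy_prod, boundedBy_nat] at hx ⊢
        nlinarith⟩
  exact hmul.comp (hf.pair hg)

theorem sub {f g : List A → α → ℕ} (hf : LogspaceFun f) (hg : LogspaceFun g) :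
    LogspaceFun fun w a => f w a - g w a := by
  have hsub : LogspaceFun fun (_ : List A) (x : ℕ × ℕ) => x.1 - x.2 :=
    primrec (r := fun _ a i => a - i) (step := fun _ y => y.2.1 - 1) id
      (pred.comp (fst.comp snd)) (fun _ _ _ => rfl)
      (polyBounded_of_le fst fun _ _ => Nat.sub_le _ _)
  exact hsub.comp (hf.pair hg)

end LogspaceFun

/-! ### Predicates decidable in logarithmic space -/

open Classical in
/-- The predicate `P`, relative to an input word, has a characteristic function that is computed by
register programs with polynomially bounded registers. -/
def LogspacePred (P : List A → α → Prop) : Prop := LogspaceFun fun w a => if P w a then 1 else 0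

namespace LogspacePred

open LogspaceFun

theorem congr {P Q : List A → α → Prop} (hP : LogspacePred P) (h : ∀ w a, P w a ↔ Q w a) :
    LogspacePred Q := by
  obtain rfl : P = Q := funext fun w => funext fun a => propext (h w a)
  exact hP

theorem comp {P : List A → β → Prop} {f : List A → α → β} (hP : LogspacePred P)
    (hf : LogspaceFun f) : LogspacePred fun w a => P w (f w a) := LogspaceFun.comp hP hf

theorem eq_zero {f : List A → α → ℕ} (hf : LogspaceFun f) : LogspacePred fun w a => f w a = 0 :=
  (isZero.comp hf).congr fun w a i _ => by split_ifs <;> rfl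

theorem not {P : List A → α → Prop} (hP : LogspacePred P) : LogspacePred fun w a => ¬ P w a :=
  (eq_zero hP).congr fun w a => by simp

theorem and {P Q : List A → α → Prop} (hP : LogspacePred P) (hQ : LogspacePred Q) :
    LogspacePred fun w a => P w a ∧ Q w a :=
  (LogspaceFun.mul hP hQ).congr fun w a i _ => by
    by_cases h : P w a <;> by_cases h' : Q w a <;> simp [h, h']

theorem or {P Q : List A → α → Prop} (hP : LogspacePred P) (hQ : LogspacePred Q) :
    LogspacePred fun w a => P w a ∨ Q w a :=
  (hP.not.and hQ.not).not.congr fun w a => by tauto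

theorem imp {P Q : List A → α → Prop} (hP : LogspacePred P) (hQ : LogspacePred Q) :
    LogspacePred fun w a => P w a → Q w a :=
  (hP.not.or hQ).congr fun w a => by tauto

theorem const (p : Prop) : LogspacePred fun (_ : List A) (_ : α) => p := by
  by_cases hp : p
  · exact (const_nat 1).congr fun w a i _ => by simp [hp]
  · exact (const_nat 0).congr fun w a i _ => by simp [hp]

theorem le {f g : List A → α → ℕ} (hf : LogspaceFun f) (hg : LogspaceFun g) :
    LogspacePred fun w a => f w a ≤ g w a :=
  (eq_zero (hf.sub hg)).congr fun w a => by omega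

theorem lt {f g : List A → α → ℕ} (hf : LogspaceFun f) (hg : LogspaceFun g) :
    LogspacePred fun w a => f w a < g w a :=
  (le hg hf).not.congr fun w a => by omega

theorem eq {f g : List A → α → ℕ} (hf : LogspaceFun f) (hg : LogspaceFun g) :
    LogspacePred fun w a => f w a = g w a :=
  ((le hf hg).and (le hg hf)).congr fun w a => by omega

theorem cell (p : InSym A → Prop) {f : List A → α → ℕ} (hf : LogspaceFun f) :
    LogspacePred fun w a => p (inputCell w (f w a)) := by
  classical
  exact ((sees fun s => decide (p s)).comp hf).congr fun w a i _ => by simp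

theorem ite {P : List A → α → Prop} [∀ w a, Decidable (P w a)] {f g : List A → α → β}
    (hP : LogspacePred P) (hf : LogspaceFun f) (hg : LogspaceFun g) :
    LogspaceFun fun w a => if P w a then f w a else g w a := by
  refine .of_coord fun j hj => ?_
  refine ((LogspaceFun.mul hP ((coordinate j hj).comp hf)).add
    (LogspaceFun.mul hP.not ((coordinate j hj).comp hg))).congr fun w a i _ => ?_
  by_cases h : P w a <;> simp [h]

/-! ### Bounded quantifiers -/

theorem count {P : List A → α → ℕ → Prop} [inst : ∀ w a, DecidablePred (P w a)]
    (hP : LogspacePred fun w (x : α × ℕ) => P w x.1 x.2) {n : List A → α → ℕ}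
    (hn : LogspaceFun n) : LogspaceFun fun w a => Nat.count (P w a) (n w a) := by
  obtain rfl : inst = fun _ _ _ => Classical.propDecidable _ := Subsingleton.elim _ _
  classical
  have hcount : LogspaceFun fun w (x : α × ℕ) => Nat.count (P w x.1) x.2 :=
    primrec (r := fun w a i => Nat.count (P w a) i)
      (step := fun w y => y.2.1 + if P w y.1 y.2.2 then 1 else 0) (const_nat 0)
      ((fst.comp snd).add (hP.comp (fst.pair (snd.comp snd))))
      (fun w a i => Nat.count_succ _ _) (polyBounded_of_le snd fun w x => Nat.count_le _)
  exact hcount.comp (id.pair hn)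

theorem exists_lt {P : List A → α → ℕ → Prop}
    (hP : LogspacePred fun w (x : α × ℕ) => P w x.1 x.2) {n : List A → α → ℕ}
    (hn : LogspaceFun n) : LogspacePred fun w a => ∃ i < n w a, P w a i := by
  classical
  refine (eq_zero (hP.count hn)).not.congr fun w a => ?_
  rw [Nat.count_eq_card_filter_range, Finset.card_eq_zero, ← ne_eq,
    ← Finset.nonempty_iff_ne_empty]
  simp [Finset.Nonempty]

theorem forall_lt {P : List A → α → ℕ → Prop}
    (hP : LogspacePred fun w (x : α × ℕ) => P w x.1 x.2) {n : List A → α → ℕ}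
    (hn : LogspaceFun n) : LogspacePred fun w a => ∀ i < n w a, P w a i :=
  (exists_lt (P := fun w a i => ¬ P w a i) hP.not hn).not.congr fun w a => by
    push Not
    rfl

theorem exists_finite {ι : Type*} [Finite ι] {P : ι → List A → α → Prop}
    (hP : ∀ i, LogspacePred (P i)) : LogspacePred fun w a => ∃ i, P i w a := by
  have exists_mem (s : Set ι) (hs : s.Finite) : LogspacePred fun w a => ∃ i ∈ s, P i w a := by
    induction s, hs using Set.Finite.induction_on with
    | empty => exact (const False).congr fun w a => by simp
    | @insert i _ _ _ ih => exact ((hP i).or ih).congr fun w a => by simp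
  exact (exists_mem Set.univ Set.finite_univ).congr fun w a => by simp

theorem forall_finite {ι : Type*} [Finite ι] {P : ι → List A → α → Prop}
    (hP : ∀ i, LogspacePred (P i)) : LogspacePred fun w a => ∀ i, P i w a :=
  (exists_finite fun i => (hP i).not).not.congr fun w a => by simp

theorem exists_tuple_lt {t : ℕ} {P : List A → α → (Fin t → ℕ) → Prop}
    (hP : LogspacePred fun w (x : α × (Fin t → ℕ)) => P w x.1 x.2) {n : List A → α → ℕ}
    (hn : LogspaceFun n) :
    LogspacePred fun w a => ∃ κ : Fin t → ℕ, (∀ i, κ i < n w a) ∧ P w a κ := by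
  induction t generalizing α with
  | zero =>
    refine (hP.comp (id.pair (pi (f := fun _ _ => Fin.elim0) fun i => i.elim0))).congr
      fun w a => ⟨fun h => ⟨_, fun i => i.elim0, h⟩, ?_⟩
    rintro ⟨κ, -, h⟩
    rwa [Subsingleton.elim κ] at h
  | succ t ih =>
    have hcons : LogspacePred fun w (x : (α × ℕ) × (Fin t → ℕ)) =>
        P w x.1.1 (Fin.cons x.1.2 x.2) := by
      refine hP.comp ((fst.comp fst).pair (pi fun i => ?_))
      refine Fin.cases ?_ (fun i => ?_) i
      · exact snd.comp fst
      · exact (proj i).comp snd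
    have hexists := exists_lt (P := fun w a i => ∃ κ : Fin t → ℕ, (∀ j, κ j < n w a) ∧
      P w a (Fin.cons i κ)) (ih (P := fun w x κ => P w x.1 (Fin.cons x.2 κ)) hcons
        (hn.comp fst)) hn
    refine hexists.congr fun w a => ⟨?_, ?_⟩
    · rintro ⟨i, hi, κ, hκ, h⟩
      exact ⟨_, fun j => Fin.cases (by simpa using hi) (fun j => by simpa using hκ j) j, h⟩
    · rintro ⟨κ, hκ, h⟩
      exact ⟨κ 0, hκ 0, Fin.tail κ, fun j => hκ j.succ, by rwa [Fin.cons_self_tail]⟩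

end LogspacePred

namespace LogspaceFun

open LogspacePred (cell ite)

theorem cases {ι : Type*} [Finite ι] {h : List A → α → ι}
    (hh : ∀ i, LogspacePred fun w a => h w a = i) {F : ι → List A → α → β}
    (hF : ∀ i, LogspaceFun (F i)) : LogspaceFun fun w a => F (h w a) w a := by
  classical
  refine .of_coord fun j hj => ?_
  have cases_mem (s : Set ι) (hs : s.Finite) : LogspaceFun fun w a =>
      if h w a ∈ s then coord (F (h w a) w a) j else 0 := by
    induction s, hs using Set.Finite.induction_on with
    | empty => exact (const_nat 0).congr fun w a => by simp
    | @insert i s _ _ ih =>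
      refine ((hh i).ite ((coordinate j hj).comp (hF i)) ih).congr fun w a _ _ => ?_
      by_cases hi : h w a = i <;> simp [hi]
  exact (cases_mem Set.univ Set.finite_univ).congr fun w a => by simp

theorem div_const {f : List A → α → ℕ} (hf : LogspaceFun f) (b : ℕ) :
    LogspaceFun fun w a => f w a / b := by
  classical
  rcases Nat.eq_zero_or_pos b with rfl | hb
  · exact (const_nat 0).congr fun w a => by simp
  have hdiv : LogspaceFun fun (_ : List A) (x : ℕ × ℕ) => x.2 / b := by
    have hquot : LogspaceFun fun (_ : List A) (y : ℕ × (ℕ × ℕ)) => y.2.1 := fst.comp snd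
    refine primrec (r := fun _ _ i => i / b)
      (step := fun _ y => if (y.2.1 + 1) * b ≤ y.2.2 + 1 then y.2.1 + 1 else y.2.1)
      ((const_nat 0).congr fun _ _ => by simp)
      ((LogspacePred.le ((succ.comp hquot).mul (const_nat b)) (succ.comp (snd.comp snd))).ite
        (succ.comp hquot) hquot)
      (fun _ _ i => ?_) (polyBounded_of_le snd fun _ _ => Nat.div_le_self _ _)
    have hi := Nat.div_add_mod i b
    have hmod := Nat.mod_lt i hb
    dsimp only
    split_ifs with h
    · exact Nat.div_eq_of_lt_le h (by nlinarith)
    · exact Nat.div_eq_of_lt_le ((Nat.div_mul_le_self i b).trans (Nat.le_succ i)) (by omega)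
  exact hdiv.comp ((const_nat 0).pair hf)

theorem mod_const {f : List A → α → ℕ} (hf : LogspaceFun f) (b : ℕ) :
    LogspaceFun fun w a => f w a % b :=
  (hf.sub ((const_nat b).mul (hf.div_const b))).congr fun w a _ _ => by
    have := Nat.div_add_mod (f w a) b
    simp only [coord_nat]
    omega

theorem length : LogspaceFun fun (w : List A) (_ : α) => w.length := by
  classical
  have hflag : LogspaceFun fun (w : List A) (i : ℕ) =>
      if inputCell w (i + 1) = .rightEnd then 0 else 1 :=
    ite (cell (· = .rightEnd) succ) (const_nat 0) (const_nat 1)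
  refine snd.comp (whileLoop (β := ℕ)
    (s := fun w _ j => (if inputCell w (j + 1) = .rightEnd then 0 else 1, j))
    (t := fun w _ => w.length)
    (step := fun w y => (if inputCell w (y.2.2 + 1 + 1) = .rightEnd then 0 else 1, y.2.2 + 1))
    ((hflag.comp (const_nat 0)).pair (const_nat 0)) ?_ (fun _ _ _ _ => rfl) (fun w _ j hj => ?_)
    (fun w _ => ?_) (e := 1) (fun w N _ hN _ j hj => ?_))
  · have hnext : LogspaceFun fun (_ : List A) (y : α × (ℕ × ℕ)) => y.2.2 + 1 :=
      succ.comp (snd.comp snd)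
    exact (hflag.comp hnext).pair hnext
  · simp [inputCell, hj]
  · simp [inputCell]
  · simp only [boundedBy_prod, boundedBy_nat, pow_one]
    split_ifs <;> omega

end LogspaceFun

end Logspace

namespace Logspace

open NatTuple

/-! ### Digits -/

/-- The base-`b` digits of `x`, from the least significant one on, are given by `d`. -/
def HasDigits (b x : ℕ) (d : ℕ → Fin b) : Prop := ∀ j, x / b ^ j % b = d j

namespace HasDigits

variable {b x : ℕ} {d : ℕ → Fin b}

theorem congr {d' : ℕ → Fin b} (h : HasDigits b x d) (hd : ∀ j, d j = d' j) : HasDigits b x d' :=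
  funext hd ▸ h

theorem div (h : HasDigits b x d) : HasDigits b (x / b) fun j => d (j + 1) := fun j => by
  rw [Nat.div_div_eq_div_mul, ← pow_succ', h (j + 1)]

theorem mod (h : HasDigits b x d) : x % b = d 0 := by
  simpa using h 0

theorem mul_add {d' : ℕ → Fin b} (h : HasDigits b x d) (hd : ∀ j, d' (j + 1) = d j) :
    HasDigits b (b * x + d' 0) d'
  | 0 => by
    rw [pow_zero, Nat.div_one, Nat.mul_add_mod, Nat.mod_eq_of_lt (d' 0).2]
  | j + 1 => by
    rw [pow_succ', ← Nat.div_div_eq_div_mul, Nat.mul_add_div (d' 0).pos, Nat.div_eq_of_lt (d' 0).2,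
      add_zero, h j, hd]

theorem lt_pow (h : HasDigits b x d) (hb : 1 < b) {k : ℕ} (hd : ∀ j, k ≤ j → (d j : ℕ) = 0) :
    x < b ^ k := by
  have lt_pow_add (n : ℕ) (hn : x < b ^ (k + n)) : x < b ^ k := by
    induction n with
    | zero => exact hn
    | succ n ih =>
      refine ih ?_
      have hdigit := h (k + n)
      rw [hd _ (by omega), Nat.mod_eq_of_lt (Nat.div_lt_of_lt_mul (by rwa [← pow_succ])),
        Nat.div_eq_zero_iff] at hdigit
      exact hdigit.resolve_left (pow_ne_zero _ (by omega))
  exact lt_pow_add x ((Nat.lt_pow_self hb).trans_le (Nat.pow_le_pow_right (by omega) (by omega)))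

end HasDigits

/-- A numbering of the elements of `T` by the digits in some base, in which `zero` is numbered `0`.
The base is at least `2`, so that numbers are bounded by the powers of the base. -/
structure Coding (T : Type*) (zero : T) where
  base : ℕ
  one_lt_base : 1 < base
  code : T → Fin base
  code_injective : code.Injective
  code_zero : (code zero : ℕ) = 0

namespace Coding

variable {T : Type*} {zero : T}

theorem nonempty [Finite T] (zero : T) : Nonempty (Coding T zero) := by
  classical
  obtain ⟨n, ⟨e⟩⟩ := Finite.exists_equiv_fin T
  refine ⟨n + 1, Nat.succ_lt_succ ((Nat.zero_le _).trans_lt (e zero).2),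
    fun s => if s = zero then 0 else (e s).succ, fun s s' h => ?_, by simp⟩
  have hne (s : T) : (e s).succ ≠ 0 := Fin.succ_ne_zero _
  grind [Fin.succ_inj, Equiv.apply_eq_iff_eq]

/-- The element whose number is the last digit of `n`. -/
noncomputable def decode (κ : Coding T zero) (n : ℕ) : T :=
  haveI : Nonempty T := ⟨zero⟩
  Function.invFun (fun s => (κ.code s : ℕ)) (n % κ.base)

theorem decode_of_mod_eq (κ : Coding T zero) {n : ℕ} {s : T} (h : n % κ.base = κ.code s) :
    κ.decode n = s := by
  have : Nonempty T := ⟨zero⟩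
  rw [decode, h]
  exact Function.leftInverse_invFun (Fin.val_injective.comp κ.code_injective) s

theorem decode_mod (κ : Coding T zero) (n : ℕ) : κ.decode (n % κ.base) = κ.decode n := by
  rw [decode, decode, Nat.mod_mod]

end Coding

/-! ### Tapes -/

/-- The tape `f` with the head at `h` is represented by the numbers `l` and `r`: the digits of `r`
are the symbols from the head on to the right, and those of `l` the symbols to the left of the
head. -/
def TapeEncodes {T : Type*} {b : ℕ} (code : T → Fin b) (f : ℤ → T) (h : ℤ) (l r : ℕ) : Prop :=
  HasDigits b l (fun j => code (f (h - 1 - j))) ∧ HasDigits b r fun j => code (f (h + j))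

/-- The left half of a tape after writing the symbol with the code `s` and a move. -/
def newLeft (b s : ℕ) (l : ℕ) : Move → ℕ
  | .left => l / b
  | .stay => l
  | .right => b * l + s

/-- The right half of a tape after writing the symbol with the code `s` and a move. -/
def newRight (b s : ℕ) (l r : ℕ) : Move → ℕ
  | .left => b * (b * (r / b) + s) + l % b
  | .stay => b * (r / b) + s
  | .right => r / b

namespace TapeEncodes

variable {T : Type*} {b : ℕ} {code : T → Fin b} {f : ℤ → T} {h : ℤ} {l r : ℕ}

theorem write (H : TapeEncodes code f h l r) (s : T) :
    TapeEncodes code (Function.update f h s) h l (b * (r / b) + code s) := by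
  refine ⟨H.1.congr fun j => ?_, ?_⟩
  · rw [Function.update_of_ne (by omega)]
  · have hright := H.2.div.mul_add (d' := fun j => code (Function.update f h s (h + j)))
      fun j => by rw [Function.update_of_ne (by omega)]
    simpa using hright

theorem move_right (H : TapeEncodes code f h l r) :
    TapeEncodes code f (h + 1) (b * l + code (f h)) (r / b) := by
  refine ⟨?_, H.2.div.congr fun j => by push_cast; congr 2; ring⟩
  have hleft := H.1.mul_add (d' := fun j => code (f (h - j))) fun j => by push_cast; congr 2; ring
  simpa using hleft

theorem move_left (H : TapeEncodes code f h l r) :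
    TapeEncodes code f (h - 1) (l / b) (b * r + l % b) := by
  refine ⟨H.1.div.congr fun j => by push_cast; congr 2; ring, ?_⟩
  have hright := H.2.mul_add (d' := fun j => code (f (h - 1 + j)))
    fun j => by push_cast; congr 2; ring
  rw [H.1.mod]
  simpa using hright

theorem update (H : TapeEncodes code f h l r) (s : T) (m : Move) :
    TapeEncodes code (Function.update f h s) (moveWork m h) (newLeft b (code s) l m)
      (newRight b (code s) l r m) := by
  cases m with
  | stay => exact H.write s
  | left => exact (H.write s).move_left
  | right =>
    have hright := (H.write s).move_right
    rwa [Function.update_self, Nat.mul_add_div (code s).pos, Nat.div_eq_of_lt (code s).2,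
      add_zero] at hright

end TapeEncodes

/-! ### Configurations as tuples of numbers -/

/-- The tuples of numbers that encode the configurations of a machine with `t` work tapes: state,
position of the input head, left and right halves of the work tapes. -/
abbrev CfgCode (t : ℕ) := ℕ × (ℕ × ((Fin t → ℕ) × (Fin t → ℕ)))

namespace Machine

variable {B : Type v} {M : Machine B}

/-- The configuration `c` is encoded by `x`. -/
def Encodes (κ : Coding M.State M.start) (σ : Coding M.WorkSym M.blank) (c : M.Cfg)
    (x : CfgCode M.tapes) : Prop :=
  x.1 = κ.code c.state ∧ x.2.1 = c.inputHead ∧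
    ∀ i, TapeEncodes σ.code (c.work i) (c.workHead i) (x.2.2.1 i) (x.2.2.2 i)

variable (κ : Coding M.State M.start) (σ : Coding M.WorkSym M.blank)

/-- The arguments of the transition function of `M` in a configuration encoded by `x`. -/
noncomputable def view (v : List B) (x : CfgCode M.tapes) :
    M.State × InSym B × (Fin M.tapes → M.WorkSym) :=
  (κ.decode x.1, inputCell v x.2.1, fun i => σ.decode (x.2.2.2 i))

/-- The effect of a transition on the encodings of configurations. -/
def codeStep (n : ℕ) (x : CfgCode M.tapes) :
    Option (M.State × Move × (Fin M.tapes → M.WorkSym × Move)) → CfgCode M.tapes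
  | none => x
  | some r => (κ.code r.1, (moveInput n r.2.1 x.2.1,
      (fun i => newLeft σ.base (σ.code (r.2.2 i).1) (x.2.2.1 i) (r.2.2 i).2,
        fun i => newRight σ.base (σ.code (r.2.2 i).1) (x.2.2.1 i) (x.2.2.2 i) (r.2.2 i).2)))

/-- The transition of `M` in a configuration encoded by `x`. -/
noncomputable def codeTrans (v : List B) (x : CfgCode M.tapes) :
    Option (M.State × Move × (Fin M.tapes → M.WorkSym × Move)) :=
  M.trans (view κ σ v x).1 (view κ σ v x).2.1 (view κ σ v x).2.2

/-- The encoding of the configuration reached by `M` on the input `v` after `j` steps. -/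
noncomputable def codeRun (v : List B) : ℕ → CfgCode M.tapes
  | 0 => (κ.code M.start, (0, (fun _ => 0, fun _ => 0)))
  | j + 1 => codeStep κ σ v.length (codeRun v j) (codeTrans κ σ v (codeRun v j))

variable {κ σ} {v : List B} {c c' : M.Cfg} {x : CfgCode M.tapes}

theorem encodes_initCfg : Encodes κ σ M.initCfg (codeRun κ σ v 0) := by
  refine ⟨rfl, rfl, fun i => ⟨fun j => ?_, fun j => ?_⟩⟩ <;>
    simp [codeRun, initCfg, σ.code_zero]

namespace Encodes

theorem decode_state (h : Encodes κ σ c x) : κ.decode x.1 = c.state :=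
  κ.decode_of_mod_eq (by rw [h.1, Nat.mod_eq_of_lt (Fin.is_lt _)])

theorem codeTrans_eq (h : Encodes κ σ c x) : codeTrans κ σ v x =
    M.trans c.state (inputCell v c.inputHead) fun i => c.work i (c.workHead i) := by
  have hwork (i) : σ.decode (x.2.2.2 i) = c.work i (c.workHead i) :=
    σ.decode_of_mod_eq (by simpa using (h.2.2 i).2.mod)
  simp only [codeTrans, view, h.decode_state, h.2.1, hwork]

theorem codeTrans_eq_none_iff (h : Encodes κ σ c x) :
    codeTrans κ σ v x = none ↔ M.step v c = none := by
  rw [h.codeTrans_eq, Machine.step, Option.map_eq_none_iff]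

theorem step (h : Encodes κ σ c x) (hs : M.step v c = some c') :
    Encodes κ σ c' (codeStep κ σ v.length x (codeTrans κ σ v x)) := by
  rw [h.codeTrans_eq]
  obtain ⟨r, hr, rfl⟩ := Option.map_eq_some_iff.1 hs
  rw [hr]
  exact ⟨rfl, congrArg (moveInput v.length r.2.1) h.2.1, fun i => (h.2.2 i).update _ _⟩

end Encodes

theorem Visits.exists_encodes (hc : M.Visits v c) : ∃ t, Encodes κ σ c (codeRun κ σ v t) ∧
    ∀ j < t, ∃ c', M.Visits v c' ∧ Encodes κ σ c' (codeRun κ σ v j) ∧ M.step v c' ≠ none := by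
  induction hc with
  | refl => exact ⟨0, encodes_initCfg, fun j hj => absurd hj (Nat.not_lt_zero j)⟩
  | @tail c c' hc hs ih =>
    obtain ⟨t, ht, hbefore⟩ := ih
    refine ⟨t + 1, ht.step hs, fun j hj => ?_⟩
    rcases Nat.lt_succ_iff_lt_or_eq.1 hj with hj | rfl
    · exact hbefore j hj
    · exact ⟨c, hc, ht, by simp [hs]⟩

/-! ### The size of configurations -/

theorem Visits.inputHead_le (hc : M.Visits v c) : c.inputHead ≤ v.length + 1 := by
  induction hc with
  | refl => exact Nat.zero_le _
  | tail _ hs ih =>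
    obtain ⟨r, -, rfl⟩ := Option.map_eq_some_iff.1 hs
    dsimp only
    cases r.2.1 <;> simp only [moveInput] <;> omega

theorem Visits.work_eq_blank {K : ℕ}
    (hK : ∀ c : M.Cfg, M.Visits v c → ∀ i, (c.workHead i).natAbs ≤ K) (hc : M.Visits v c)
    (i : Fin M.tapes) {z : ℤ} (hz : K < z.natAbs) : c.work i z = M.blank := by
  induction hc with
  | refl => rfl
  | @tail c _ hc hs ih =>
    obtain ⟨r, -, rfl⟩ := Option.map_eq_some_iff.1 hs
    have hne : z ≠ c.workHead i := by
      rintro rfl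
      exact hz.not_ge (hK c hc i)
    exact (Function.update_of_ne hne _ _).trans ih

theorem Encodes.boundedBy (h : Encodes κ σ c x) {n K : ℕ} (hhead : c.inputHead ≤ n)
    (hK : ∀ i, (c.workHead i).natAbs ≤ K)
    (hblank : ∀ i, ∀ z : ℤ, K < z.natAbs → c.work i z = M.blank) :
    BoundedBy x (κ.base + n + σ.base ^ (2 * K + 1)) := by
  have htape (i) : x.2.2.1 i < σ.base ^ (2 * K + 1) ∧ x.2.2.2 i < σ.base ^ (2 * K + 1) := by
    have hi := hK i
    constructor
    · refine (h.2.2 i).1.lt_pow σ.one_lt_base fun j hj => ?_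
      rw [hblank i _ (by omega), σ.code_zero]
    · refine (h.2.2 i).2.lt_pow σ.one_lt_base fun j hj => ?_
      rw [hblank i _ (by omega), σ.code_zero]
  simp only [boundedBy_prod, boundedBy_nat]
  refine ⟨?_, ?_, fun i hi => ?_, fun i hi => ?_⟩
  · rw [h.1]
    have := (κ.code c.state).2
    omega
  · rw [h.2.1]
    omega
  · have := (htape ⟨i, hi⟩).1
    exact (dif_pos (c := i < M.tapes) hi).trans_le (by omega)
  · have := (htape ⟨i, hi⟩).2
    exact (dif_pos (c := i < M.tapes) hi).trans_le (by omega)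

end Machine

theorem two_pow_log_succ_le {n N d : ℕ} (hN : 2 ≤ N) (hn : n ≤ N ^ d) :
    2 ^ (Nat.log 2 n + 1) ≤ N ^ (d + 2) := by
  have hlog : 2 ^ Nat.log 2 n ≤ n + 1 := by
    rcases Nat.eq_zero_or_pos n with rfl | h
    · simp
    · exact (Nat.pow_log_le_self 2 h.ne').trans (Nat.le_succ n)
  have hpos : 1 ≤ N ^ d := Nat.one_le_pow _ _ (by omega)
  calc 2 ^ (Nat.log 2 n + 1) = 2 * 2 ^ Nat.log 2 n := by ring
    _ ≤ 2 * (2 * N ^ d) := by omega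
    _ = N ^ d * (2 * 2) := by ring
    _ ≤ N ^ d * (N * N) := Nat.mul_le_mul_left _ (Nat.mul_le_mul hN hN)
    _ = N ^ (d + 2) := by ring

theorem pow_log_le {b C n N d : ℕ} (hN : 2 ≤ N) (hn : n ≤ N ^ d) :
    b ^ (2 * (C * (Nat.log 2 n + 1)) + 1) ≤ N ^ ((d + 2) * (b * (2 * C + 1))) := by
  have hexp : b * (2 * (C * (Nat.log 2 n + 1)) + 1) ≤
      (Nat.log 2 n + 1) * (b * (2 * C + 1)) := by
    have : b * 1 ≤ b * (Nat.log 2 n + 1) := Nat.mul_le_mul_left b (Nat.le_add_left 1 _)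
    linarith
  calc b ^ (2 * (C * (Nat.log 2 n + 1)) + 1)
      ≤ (2 ^ b) ^ (2 * (C * (Nat.log 2 n + 1)) + 1) :=
        Nat.pow_le_pow_left Nat.lt_two_pow_self.le _
    _ = 2 ^ (b * (2 * (C * (Nat.log 2 n + 1)) + 1)) := by rw [← pow_mul]
    _ ≤ 2 ^ ((Nat.log 2 n + 1) * (b * (2 * C + 1))) := Nat.pow_le_pow_right (by norm_num) hexp
    _ = (2 ^ (Nat.log 2 n + 1)) ^ (b * (2 * C + 1)) := by rw [pow_mul]
    _ ≤ (N ^ (d + 2)) ^ (b * (2 * C + 1)) :=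
        Nat.pow_le_pow_left (two_pow_log_succ_le hN hn) _
    _ = N ^ ((d + 2) * (b * (2 * C + 1))) := by rw [← pow_mul]

theorem exists_codeSize_le (q b C d : ℕ) : ∃ e, ∀ n N : ℕ, 2 ≤ N → n ≤ N ^ d →
    q + (n + 1) + b ^ (2 * (C * (Nat.log 2 n + 1)) + 1) ≤ N ^ e := by
  refine ⟨q + d + (d + 2) * (b * (2 * C + 1)) + 2, fun n N hN hn => ?_⟩
  set E := q + d + (d + 2) * (b * (2 * C + 1))
  have hpow {k : ℕ} (hk : k ≤ E) : N ^ k ≤ N ^ E := Nat.pow_le_pow_right (by omega) hk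
  have hq : q ≤ N ^ E :=
    (Nat.lt_two_pow_self.le.trans (Nat.pow_le_pow_left hN q)).trans (hpow (by omega))
  have hnE : n ≤ N ^ E := hn.trans (hpow (by omega))
  have htape := (pow_log_le (b := b) (C := C) hN hn).trans (hpow (by omega))
  have hone : 1 ≤ N ^ E := Nat.one_le_pow _ _ (by omega)
  calc q + (n + 1) + b ^ (2 * (C * (Nat.log 2 n + 1)) + 1) ≤ N ^ E * (2 * 2) := by omega
    _ ≤ N ^ E * (N * N) := Nat.mul_le_mul_left _ (Nat.mul_le_mul hN hN)
    _ = N ^ (E + 2) := by ring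

/-! ### Simulation of logspace machines on virtual inputs -/

section Simulation

open LogspaceFun

variable {A : Type u} {B : Type v} {α : Type*} [NatTuple α]

theorem inputCell_succ (w : List A) (i : ℕ) :
    inputCell w (i + 1) = w[i]?.elim .rightEnd .letter := by
  cases h : w[i]? <;> simp [inputCell, h]

namespace LogspacePred

theorem mod_const {f : List A → α → ℕ} (hf : LogspaceFun f) {b : ℕ} (hb : 0 < b) (P : ℕ → Prop) :
    LogspacePred fun w a => P (f w a % b) := by
  refine (exists_finite (ι := Fin b) (P := fun k w a => f w a % b = k ∧ P k) fun k =>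
    (eq (hf.mod_const b) (const_nat k.1)).and (const _)).congr fun w a => ?_
  constructor
  · rintro ⟨k, hk, h⟩
    rwa [hk]
  · exact fun h => ⟨⟨_, Nat.mod_lt _ hb⟩, rfl, h⟩

theorem decode {T : Type*} {zero : T} (κ : Coding T zero) {f : List A → α → ℕ}
    (hf : LogspaceFun f) (P : T → Prop) : LogspacePred fun w a => P (κ.decode (f w a)) :=
  (mod_const hf (Nat.zero_lt_of_lt κ.one_lt_base) fun n => P (κ.decode n)).congr fun w a => by
    rw [κ.decode_mod]

theorem inputCell_eq [Finite B] {V : List A → α → List B}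
    (hV : ∀ b, LogspacePred fun w (x : α × ℕ) => (V w x.1)[x.2]? = some b) (s : InSym B) :
    LogspacePred fun w (x : α × ℕ) => inputCell (V w x.1) x.2 = s := by
  have hzero : LogspacePred fun (_ : List A) (x : α × ℕ) => x.2 = 0 := eq_zero snd
  have hpred : LogspaceFun fun (_ : List A) (x : α × ℕ) => (x.1, x.2 - 1) :=
    fst.pair (pred.comp snd)
  cases s with
  | leftEnd =>
    refine hzero.congr fun w x => ?_
    rcases x with ⟨a, _ | i⟩
    · simp [inputCell]
    · rw [inputCell_succ]
      cases (V w a)[i]? <;> simp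
  | rightEnd =>
    refine (hzero.not.and ((exists_finite hV).not.comp hpred)).congr fun w x => ?_
    rcases x with ⟨a, _ | i⟩
    · simp [inputCell]
    · rw [inputCell_succ]
      cases h : (V w a)[i]? <;> simp [h]
  | letter b =>
    refine (hzero.not.and ((hV b).comp hpred)).congr fun w x => ?_
    rcases x with ⟨a, _ | i⟩
    · simp [inputCell]
    · rw [inputCell_succ]
      cases h : (V w a)[i]? <;> simp [h]

end LogspacePred

namespace LogspaceFun

theorem newLeft (b s : ℕ) {l : List A → α → ℕ} (hl : LogspaceFun l) (m : Move) :
    LogspaceFun fun w a => newLeft b s (l w a) m := by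
  cases m
  · exact hl.div_const b
  · exact hl
  · exact ((const_nat b).mul hl).add (const_nat s)

theorem newRight (b s : ℕ) {l r : List A → α → ℕ} (hl : LogspaceFun l) (hr : LogspaceFun r)
    (m : Move) : LogspaceFun fun w a => newRight b s (l w a) (r w a) m := by
  have hwrite := ((const_nat (α := α) (A := A) b).mul (hr.div_const b)).add (const_nat s)
  cases m
  · exact ((const_nat b).mul hwrite).add (hl.mod_const b)
  · exact hwrite
  · exact hr.div_const b

theorem moveInput {n i : List A → α → ℕ} (hn : LogspaceFun n) (hi : LogspaceFun i) (m : Move) :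
    LogspaceFun fun w a => moveInput (n w a) m (i w a) := by
  cases m
  · exact pred.comp hi
  · exact hi
  · refine ((LogspacePred.le (succ.comp hi) (succ.comp hn)).ite (succ.comp hi)
      (succ.comp hn)).congr fun w a _ _ => ?_
    simp only [coord_nat, Logspace.moveInput]
    split_ifs <;> omega

end LogspaceFun

instance [Finite B] : Finite (InSym B) :=
  .of_injective (β := Option (Option B))
    (fun | .leftEnd => none | .rightEnd => some none | .letter a => some (some a)) <| by
    rintro (_ | _ | a) (_ | _ | a') h <;> simp_all

section Machine

variable {M : Machine B} (κ : Coding M.State M.start) (σ : Coding M.WorkSym M.blank)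

theorem LogspacePred.view [Finite B] {V : List A → α → List B}
    (hV : ∀ b, LogspacePred fun w (x : α × ℕ) => (V w x.1)[x.2]? = some b)
    (i : M.State × InSym B × (Fin M.tapes → M.WorkSym)) :
    LogspacePred fun w (y : α × CfgCode M.tapes) => M.view κ σ (V w y.1) y.2 = i := by
  obtain ⟨q, s, τ⟩ := i
  have hstate : LogspacePred fun (_ : List A) (y : α × CfgCode M.tapes) => κ.decode y.2.1 = q :=
    decode κ (fst.comp snd) (· = q)
  have hinput := (inputCell_eq hV s).comp (α := α × CfgCode M.tapes)
    (f := fun _ y => (y.1, y.2.2.1)) (fst.pair (fst.comp (snd.comp snd)))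
  have hwork (j) : LogspacePred fun (_ : List A) (y : α × CfgCode M.tapes) =>
      σ.decode (y.2.2.2.2 j) = τ j :=
    decode σ ((proj j).comp (snd.comp (snd.comp (snd.comp snd)))) (· = τ j)
  exact (hstate.and (hinput.and (forall_finite hwork))).congr fun w y => by
    simp [Machine.view, Prod.ext_iff, funext_iff]

theorem LogspaceFun.codeStep {n : List A → α → ℕ} (hn : LogspaceFun n)
    (r : Option (M.State × Move × (Fin M.tapes → M.WorkSym × Move))) :
    LogspaceFun fun w (y : α × CfgCode M.tapes) => M.codeStep κ σ (n w y.1) y.2 r := by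
  cases r with
  | none => exact snd
  | some r =>
    have hleft (i) : LogspaceFun fun (_ : List A) (y : α × CfgCode M.tapes) => y.2.2.2.1 i :=
      (proj i).comp (fst.comp (snd.comp (snd.comp snd)))
    have hright (i) : LogspaceFun fun (_ : List A) (y : α × CfgCode M.tapes) => y.2.2.2.2 i :=
      (proj i).comp (snd.comp (snd.comp (snd.comp snd)))
    exact (const_nat _).pair ((moveInput (hn.comp fst) (fst.comp (snd.comp snd)) _).pair
      ((pi fun i => newLeft _ _ (hleft i) _).pair
        (pi fun i => newRight _ _ (hleft i) (hright i) _)))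

theorem LogspaceFun.codeRun [Finite B] {V : List A → α → List B}
    (hlength : LogspaceFun fun w a => (V w a).length)
    (hV : ∀ b, LogspacePred fun w (x : α × ℕ) => (V w x.1)[x.2]? = some b) {t : List A → α → ℕ}
    (hrunning : ∀ w a, ∀ j < t w a, M.codeTrans κ σ (V w a) (M.codeRun κ σ (V w a) j) ≠ none)
    (hhalt : ∀ w a, M.codeTrans κ σ (V w a) (M.codeRun κ σ (V w a) (t w a)) = none)
    (hbound : ∃ e, ∀ (w : List A) (N : ℕ) (a : α), w.length + 2 ≤ N → BoundedBy a N →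
      ∀ j ≤ t w a, BoundedBy (M.codeRun κ σ (V w a) j) (N ^ e)) :
    LogspaceFun fun w a => M.codeRun κ σ (V w a) (t w a) := by
  classical
  have := M.finite_state
  have := M.finite_workSym
  have hflag : LogspaceFun fun w (y : α × CfgCode M.tapes) =>
      if M.codeTrans κ σ (V w y.1) y.2 = none then 0 else 1 :=
    .cases (LogspacePred.view κ σ hV)
      (F := fun i _ _ => if M.trans i.1 i.2.1 i.2.2 = none then 0 else 1) fun i => const_nat _
  have hnext : LogspaceFun fun w (y : α × CfgCode M.tapes) =>
      M.codeStep κ σ (V w y.1).length y.2 (M.codeTrans κ σ (V w y.1) y.2) :=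
    .cases (LogspacePred.view κ σ hV) fun i => codeStep κ σ hlength (M.trans i.1 i.2.1 i.2.2)
  have hinit : LogspaceFun fun w (a : α) => M.codeRun κ σ (V w a) 0 :=
    (const_nat _).pair ((const_nat 0).pair
      ((pi fun _ => const_nat 0).pair (pi fun _ => const_nat 0)))
  obtain ⟨e, hbound⟩ := hbound
  let next (w : List A) (y : α × (ℕ × CfgCode M.tapes)) : CfgCode M.tapes :=
    M.codeStep κ σ (V w y.1).length y.2.2 (M.codeTrans κ σ (V w y.1) y.2.2)
  refine snd.comp (whileLoop (β := CfgCode M.tapes) (t := t)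
    (s := fun w a j => (if M.codeTrans κ σ (V w a) (M.codeRun κ σ (V w a) j) = none then 0 else 1,
      M.codeRun κ σ (V w a) j))
    (step := fun w y => (if M.codeTrans κ σ (V w y.1) (next w y) = none then 0 else 1, next w y))
    ((hflag.comp (id.pair hinit)).pair hinit) ?_ (fun _ _ _ _ => rfl) ?_ ?_ (e := e) ?_)
  · have hnext' : LogspaceFun next := hnext.comp (α := α × (ℕ × CfgCode M.tapes))
      (f := fun _ y => (y.1, y.2.2)) (fst.pair (snd.comp snd))
    exact (hflag.comp (fst.pair hnext')).pair hnext'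
  · exact fun w a j hj => by simp [hrunning w a j hj]
  · exact fun w a => if_pos (hhalt w a)
  · intro w N a hN ha j hj
    have hone : 1 ≤ N ^ e := Nat.one_le_pow _ _ (by omega)
    rw [boundedBy_prod, boundedBy_nat]
    exact ⟨by split_ifs <;> omega, hbound w N a hN ha j hj⟩

end Machine

theorem InLogspace.logspacePred [Finite B] {X : Language B} (hX : InLogspace X)
    {V : List A → α → List B} (hlength : LogspaceFun fun w a => (V w a).length)
    (hV : ∀ b, LogspacePred fun w (x : α × ℕ) => (V w x.1)[x.2]? = some b) :
    LogspacePred fun w a => V w a ∈ X := by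
  obtain ⟨M, hdecides, C, hspace⟩ := hX
  have := M.finite_state
  have := M.finite_workSym
  obtain ⟨κ⟩ := Coding.nonempty M.start
  obtain ⟨σ⟩ := Coding.nonempty M.blank
  choose c hvisits hhalt haccept using hdecides
  choose t hencodes hbefore using fun v => (hvisits v).exists_encodes (κ := κ) (σ := σ)
  have hrunning (v) (j) (hj : j < t v) : M.codeTrans κ σ v (M.codeRun κ σ v j) ≠ none := by
    obtain ⟨c', -, hc', hne⟩ := hbefore v j hj
    exact mt hc'.codeTrans_eq_none_iff.1 hne
  have hreached (v) (j) (hj : j ≤ t v) :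
      ∃ c', M.Visits v c' ∧ M.Encodes κ σ c' (M.codeRun κ σ v j) := by
    rcases hj.lt_or_eq with hj | rfl
    · obtain ⟨c', hc', henc, -⟩ := hbefore v j hj
      exact ⟨c', hc', henc⟩
    · exact ⟨c v, hvisits v, hencodes v⟩
  obtain ⟨d, hd⟩ := hlength.polyBounded
  obtain ⟨e, he⟩ := exists_codeSize_le κ.base σ.base C d
  have hrun := LogspaceFun.codeRun κ σ hlength hV (t := fun w a => t (V w a))
    (fun w a => hrunning (V w a)) (fun w a => (hencodes _).codeTrans_eq_none_iff.2 (hhalt _))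
    ⟨e, fun w N a hN ha j hj => by
      obtain ⟨c', hc', henc⟩ := hreached (V w a) j hj
      exact (henc.boundedBy hc'.inputHead_le (hspace _ c' hc')
        fun i z => hc'.work_eq_blank (hspace (V w a)) i).mono
          (he _ N (by omega) (boundedBy_nat.1 (hd w N a hN ha)))⟩
  refine (LogspacePred.decode κ (fst.comp hrun) (· ∈ M.accept)).congr fun w a => ?_
  rw [(hencodes (V w a)).decode_state, haccept]

end Simulation

end Logspace

namespace GraphProduct

variable {L : Type u} {G : L → Type v} [∀ α, Group (G α)] {I : SimpleGraph L}

/-! ### Dependence graphs and projections -/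

namespace DepEquiv

theorem refl (w : List (Letter G)) : DepEquiv I w w :=
  ⟨Equiv.refl _, fun _ => rfl, fun _ _ => Iff.rfl⟩

theorem trans {w w' w'' : List (Letter G)} : DepEquiv I w w' → DepEquiv I w' w'' →
    DepEquiv I w w''
  | ⟨e, hlabel, harc⟩, ⟨e', hlabel', harc'⟩ =>
    ⟨e.trans e', fun i => (hlabel' _).trans (hlabel i),
      fun i j => (harc' _ _).trans (harc i j)⟩

theorem symm {w w' : List (Letter G)} : DepEquiv I w w' → DepEquiv I w' w
  | ⟨e, hlabel, harc⟩ =>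
    ⟨e.symm, fun i => by rw [← hlabel, e.apply_symm_apply],
      fun i j => by rw [← harc, e.apply_symm_apply, e.apply_symm_apply]⟩

theorem cons (a : Letter G) {w w' : List (Letter G)} (h : DepEquiv I w w') :
    DepEquiv I (a :: w) (a :: w') := by
  obtain ⟨e, hlabel, harc⟩ := h
  refine ⟨⟨Fin.cases (0 : Fin (w'.length + 1)) (fun i => (e i).succ),
    Fin.cases (0 : Fin (w.length + 1)) (fun i => (e.symm i).succ), fun i => ?_, fun i => ?_⟩,
    fun i => ?_, fun i j => ?_⟩
  · refine Fin.cases ?_ (fun i => ?_) i <;> simp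
  · refine Fin.cases ?_ (fun i => ?_) i <;> simp
  · exact Fin.cases rfl hlabel i
  · simp only [List.get_eq_getElem] at hlabel
    refine Fin.cases ?_ (fun i => ?_) i <;> refine Fin.cases ?_ (fun j => ?_) j
    · simp [dependenceGraph]
    · simp [dependenceGraph, hlabel]
    · simp [dependenceGraph]
    · simpa [dependenceGraph] using harc i j

theorem swap {a b : Letter G} (hab : I.Adj a.node b.node) (w : List (Letter G)) :
    DepEquiv I (a :: b :: w) (b :: a :: w) := by
  have hfix (i : Fin w.length) :
      Equiv.swap (0 : Fin (w.length + 2)) 1 i.succ.succ = i.succ.succ :=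
    Equiv.swap_apply_of_ne_of_ne (Fin.succ_ne_zero _)
      fun h => Fin.succ_ne_zero i (Fin.succ_injective _ h)
  have hone_lt (i : Fin w.length) : (1 : Fin (w.length + 2)) < i.succ.succ :=
    Nat.succ_lt_succ i.1.succ_pos
  refine ⟨Equiv.swap (0 : Fin (w.length + 2)) 1, fun i => ?_, fun i j => ?_⟩
  · refine Fin.cases ?_ (fun i => Fin.cases ?_ (fun i => ?_) i) i
    · simp
    · simp
    · exact (congrArg (b :: a :: w).get (hfix i)).trans rfl
  · refine Fin.cases ?_ (fun i => Fin.cases ?_ (fun i => ?_) i) i <;>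
      refine Fin.cases ?_ (fun j => Fin.cases ?_ (fun j => ?_) j) j <;>
      simp [dependenceGraph, hfix, hone_lt, hab, hab.symm]

theorem move_front {a : Letter G} {u : List (Letter G)} (hu : ∀ b ∈ u, I.Adj b.node a.node)
    (v : List (Letter G)) : DepEquiv I (u ++ a :: v) (a :: (u ++ v)) := by
  induction u with
  | nil => exact .refl _
  | cons b u ih =>
    exact ((ih fun c hc => hu c (List.mem_cons_of_mem _ hc)).cons b).trans
      (.swap (hu b List.mem_cons_self) _)

end DepEquiv

open Classical in
/-- The projection of a word to the letters of the nodes `α` and `β`. -/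
noncomputable def proj (α β : L) (w : List (Letter G)) : List (Letter G) :=
  w.filter fun a => a.node = α ∨ a.node = β

section Projections

variable {α β : L} {a : Letter G}

@[simp]
theorem mem_proj {w : List (Letter G)} :
    a ∈ proj α β w ↔ a ∈ w ∧ (a.node = α ∨ a.node = β) := by
  simp [proj]

theorem proj_append (α β : L) (w w' : List (Letter G)) :
    proj α β (w ++ w') = proj α β w ++ proj α β w' := List.filter_append _ _

theorem proj_cons_of_mem (h : a.node = α ∨ a.node = β) (w : List (Letter G)) :
    proj α β (a :: w) = a :: proj α β w := by
  simp [proj, h]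

theorem proj_cons_of_notMem (h : ¬ (a.node = α ∨ a.node = β)) (w : List (Letter G)) :
    proj α β (a :: w) = proj α β w := by
  simp [proj, h]

theorem not_adj_of_mem_pair (hαβ : ¬ I.Adj α β) {γ δ : L} (hγ : γ = α ∨ γ = β)
    (hδ : δ = α ∨ δ = β) : ¬ I.Adj γ δ := by
  rcases hγ with rfl | rfl <;> rcases hδ with rfl | rfl
  · exact I.loopless.irrefl _
  · exact hαβ
  · exact fun h => hαβ h.symm
  · exact I.loopless.irrefl _

end Projections

theorem filter_eq_map_get {X : Type*} (P : X → Bool) (w : List X) :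
    w.filter P = ((List.finRange w.length).filter fun i => P (w.get i)).map w.get := by
  conv_lhs => rw [← List.map_get_finRange w, List.filter_map]
  rfl

theorem filter_finRange_eq_map {m n : ℕ} (e : Fin m ≃ Fin n) {P : Fin m → Bool} {Q : Fin n → Bool}
    (hPQ : ∀ i, Q (e i) = P i) (hmono : ∀ i j, P i → P j → i < j → e i < e j) :
    (List.finRange n).filter Q = ((List.finRange m).filter P).map e := by
  refine List.Perm.eq_of_pairwise (le := (· < ·)) (fun _ _ _ _ h h' => absurd h (lt_asymm h'))
    ((List.pairwise_lt_finRange _).filter _) ?_ ?_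
  · rw [List.pairwise_map]
    exact ((List.pairwise_lt_finRange _).filter _).imp_of_mem fun hi hj hij =>
      hmono _ _ (List.mem_filter.1 hi).2 (List.mem_filter.1 hj).2 hij
  · rw [List.perm_ext_iff_of_nodup ((List.nodup_finRange _).filter _)
      (((List.nodup_finRange _).filter _).map e.injective)]
    intro i
    obtain ⟨i, rfl⟩ := e.surjective i
    simp [hPQ]

theorem DepEquiv.proj_eq {t s : List (Letter G)} (h : DepEquiv I t s) {α β : L}
    (hαβ : ¬ I.Adj α β) : proj α β t = proj α β s := by
  classical
  obtain ⟨e, hlabel, harc⟩ := h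
  have hpositions := filter_finRange_eq_map e
    (P := fun i => (t.get i).node = α ∨ (t.get i).node = β)
    (Q := fun i => (s.get i).node = α ∨ (s.get i).node = β) (fun i => by rw [hlabel])
    fun i j hi hj hij => ((harc i j).2 ⟨hij, not_adj_of_mem_pair hαβ (by simpa using hi)
      (by simpa using hj)⟩).1
  rw [proj, proj, filter_eq_map_get _ t, filter_eq_map_get _ s, hpositions, List.map_map]
  exact List.map_congr_left fun i _ => (hlabel i).symm

theorem adj_of_proj_cons_eq {a : Letter G} {p u v : List (Letter G)}
    (h : ∀ α β, ¬ I.Adj α β → proj α β (a :: p) = proj α β (u ++ a :: v))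
    (hu : ∀ b ∈ u, b.node ≠ a.node) : ∀ b ∈ u, I.Adj b.node a.node := by
  intro b hb
  by_contra hab
  have hproj := h b.node a.node hab
  rw [proj_cons_of_mem (.inr rfl), proj_append] at hproj
  cases hfirst : proj b.node a.node u with
  | nil => simpa [hfirst] using (mem_proj (α := b.node) (β := a.node)).2 ⟨hb, .inl rfl⟩
  | cons c l =>
    rw [hfirst, List.cons_append, List.cons.injEq] at hproj
    exact hu c (mem_proj.1 (hfirst ▸ List.mem_cons_self)).1 (by rw [hproj.1])

theorem proj_eq_of_proj_cons_eq {a : Letter G} {p u v : List (Letter G)} {α β : L}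
    (hαβ : ¬ I.Adj α β) (h : proj α β (a :: p) = proj α β (u ++ a :: v))
    (hu : ∀ b ∈ u, I.Adj b.node a.node) : proj α β p = proj α β (u ++ v) := by
  by_cases ha : a.node = α ∨ a.node = β
  · have hproj_u : proj α β u = [] := List.eq_nil_iff_forall_not_mem.2 fun b hb =>
      not_adj_of_mem_pair hαβ (mem_proj.1 hb).2 ha (hu b (mem_proj.1 hb).1)
    rwa [proj_append, hproj_u, proj_cons_of_mem ha, proj_cons_of_mem ha, List.nil_append,
      List.cons.injEq, and_iff_right rfl, ← List.nil_append (proj α β v), ← hproj_u,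
      ← proj_append] at h
  · rwa [proj_append, proj_cons_of_notMem ha, proj_cons_of_notMem ha, ← proj_append] at h

theorem depEquiv_of_proj {p q : List (Letter G)}
    (h : ∀ α β, ¬ I.Adj α β → proj α β p = proj α β q) : DepEquiv I p q := by
  induction p generalizing q with
  | nil =>
    cases q with
    | nil => exact .refl _
    | cons a q =>
      have hproj := h a.node a.node (I.loopless.irrefl _)
      rw [proj_cons_of_mem (.inl rfl)] at hproj
      cases hproj
  | cons a p ih =>
    have hproj := h a.node a.node (I.loopless.irrefl _)
    rw [proj_cons_of_mem (.inl rfl)] at hproj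
    obtain ⟨u, v, rfl, hu, -, -⟩ := List.filter_eq_cons_iff.1 hproj.symm
    have hindep := adj_of_proj_cons_eq h (by simpa using hu)
    exact ((ih fun α β hαβ => proj_eq_of_proj_cons_eq hαβ (h α β hαβ) hindep).cons a).trans
      (DepEquiv.move_front hindep v).symm

/-! ### Factors -/

open Classical in
/-- The number of letters of the node `α` in a word. -/
noncomputable def nodeCount (α : L) (w : List (Letter G)) : ℕ := w.countP fun a => a.node = α

theorem nodeCount_append (α : L) (w w' : List (Letter G)) :
    nodeCount α (w ++ w') = nodeCount α w + nodeCount α w' := List.countP_append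

theorem nodeCount_cons_self (a : Letter G) (w : List (Letter G)) :
    nodeCount a.node (a :: w) = nodeCount a.node w + 1 := by
  simp [nodeCount]

theorem nodeCount_cons_of_ne {α : L} {a : Letter G} (h : a.node ≠ α) (w : List (Letter G)) :
    nodeCount α (a :: w) = nodeCount α w := by
  simp [nodeCount, h]

theorem nodeCount_proj {α β γ : L} (h : γ = α ∨ γ = β) (w : List (Letter G)) :
    nodeCount γ (proj α β w) = nodeCount γ w := by
  rw [nodeCount, nodeCount, proj, List.countP_filter]
  refine List.countP_congr fun a _ => ?_
  simp only [Bool.and_eq_true, decide_eq_true_eq, and_iff_left_iff_imp]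
  rintro rfl
  exact h

open Classical in
/-- The first `κ α` letters of each node `α` in a word. -/
noncomputable def takeCount (κ : L → ℕ) : List (Letter G) → List (Letter G)
  | [] => []
  | a :: w => if κ a.node = 0 then takeCount κ w else
      a :: takeCount (Function.update κ a.node (κ a.node - 1)) w

open Classical in
/-- What is left of a word when the first `κ α` letters of each node `α` are deleted. -/
noncomputable def dropCount (κ : L → ℕ) : List (Letter G) → List (Letter G)
  | [] => []
  | a :: w => if κ a.node = 0 then a :: dropCount κ w else
      dropCount (Function.update κ a.node (κ a.node - 1)) w

theorem takeCount_dropCount_congr {κ κ' : L → ℕ} {w : List (Letter G)}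
    (h : ∀ a ∈ w, κ a.node = κ' a.node) :
    takeCount κ w = takeCount κ' w ∧ dropCount κ w = dropCount κ' w := by
  classical
  induction w generalizing κ κ' with
  | nil => exact ⟨rfl, rfl⟩
  | cons a w ih =>
    have ha := h a List.mem_cons_self
    have hw (b) (hb : b ∈ w) := h b (List.mem_cons_of_mem _ hb)
    have hupdate := ih (κ := Function.update κ a.node (κ a.node - 1))
      (κ' := Function.update κ' a.node (κ' a.node - 1)) fun b hb => by
        simp only [Function.update_apply, hw b hb, ha]
    rw [ha] at hupdate
    simp only [takeCount, dropCount, ih hw, hupdate, ha, and_self]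

theorem proj_takeCount_dropCount (α β : L) (κ : L → ℕ) (w : List (Letter G)) :
    proj α β (takeCount κ w) = takeCount κ (proj α β w) ∧
      proj α β (dropCount κ w) = dropCount κ (proj α β w) := by
  classical
  induction w generalizing κ with
  | nil => exact ⟨rfl, rfl⟩
  | cons a w ih =>
    by_cases ha : a.node = α ∨ a.node = β
    · rw [proj_cons_of_mem ha, takeCount, takeCount, dropCount, dropCount]
      split_ifs
      · exact ⟨(ih κ).1, by rw [proj_cons_of_mem ha, (ih κ).2]⟩
      · exact ⟨by rw [proj_cons_of_mem ha, (ih _).1], (ih _).2⟩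
    · have hupdate := takeCount_dropCount_congr (w := proj α β w) (κ' := κ)
        (κ := Function.update κ a.node (κ a.node - 1)) fun b hb =>
          Function.update_of_ne (fun h : b.node = a.node => ha (h ▸ (mem_proj.1 hb).2)) _ _
      rw [proj_cons_of_notMem ha, takeCount, dropCount]
      split_ifs
      · exact ⟨(ih κ).1, by rw [proj_cons_of_notMem ha, (ih κ).2]⟩
      · exact ⟨by rw [proj_cons_of_notMem ha, (ih _).1, hupdate.1], by rw [(ih _).2, hupdate.2]⟩

theorem takeCount_dropCount_append {κ : L → ℕ} {x y : List (Letter G)}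
    (h : ∀ a ∈ x ++ y, nodeCount a.node x = κ a.node) :
    takeCount κ (x ++ y) = x ∧ dropCount κ (x ++ y) = y := by
  classical
  induction x generalizing κ with
  | nil =>
    induction y with
    | nil => exact ⟨rfl, rfl⟩
    | cons a y ih =>
      have hzero : κ a.node = 0 := (h a List.mem_cons_self).symm
      have htail := ih fun b hb => h b (List.mem_cons_of_mem _ hb)
      rw [List.nil_append] at htail ⊢
      simp only [takeCount, dropCount, hzero, if_true, htail, and_self]
  | cons a x ih =>
    have hcount : nodeCount a.node x + 1 = κ a.node :=
      (nodeCount_cons_self a x).symm.trans (h a List.mem_cons_self)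
    have htail := ih (κ := Function.update κ a.node (κ a.node - 1)) fun b hb => by
      by_cases hab : a.node = b.node
      · rw [← hab, Function.update_self, ← hcount, Nat.add_sub_cancel]
      · rw [Function.update_of_ne (Ne.symm hab), ← nodeCount_cons_of_ne hab]
        exact h b (List.mem_cons_of_mem _ hb)
    have hne : κ a.node ≠ 0 := by omega
    simp only [List.cons_append, takeCount, dropCount, if_neg hne, htail, and_self]

theorem exists_depEquiv_append_iff {p t : List (Letter G)} :
    (∃ x y, DepEquiv I t (x ++ p ++ y)) ↔ ∃ κ : L → ℕ, ∀ α β, ¬ I.Adj α β →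
      ∃ x y, proj α β t = x ++ proj α β p ++ y ∧ nodeCount α x = κ α ∧ nodeCount β x = κ β := by
  constructor
  · rintro ⟨x, y, h⟩
    refine ⟨fun α => nodeCount α x, fun α β hαβ => ⟨proj α β x, proj α β y, ?_,
      nodeCount_proj (.inl rfl) x, nodeCount_proj (.inr rfl) x⟩⟩
    rw [h.proj_eq hαβ, proj_append, proj_append]
  · rintro ⟨κ, h⟩
    refine ⟨takeCount κ t, dropCount (fun α => κ α + nodeCount α p) t,
      depEquiv_of_proj fun α β hαβ => ?_⟩
    obtain ⟨x, y, hxy, hα, hβ⟩ := h α β hαβ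
    have hx (a) (ha : a ∈ proj α β t) : nodeCount a.node x = κ a.node := by
      rcases (mem_proj.1 ha).2 with h | h <;> rwa [h]
    have hxp (a) (ha : a ∈ proj α β t) :
        nodeCount a.node (x ++ proj α β p) = κ a.node + nodeCount a.node p := by
      rw [nodeCount_append, nodeCount_proj (mem_proj.1 ha).2, hx a ha]
    have htake : takeCount κ (proj α β t) = x := by
      rw [hxy, List.append_assoc] at hx ⊢
      exact (takeCount_dropCount_append hx).1
    have hdrop : dropCount (fun α => κ α + nodeCount α p) (proj α β t) = y := by
      rw [hxy] at hxp ⊢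
      exact (takeCount_dropCount_append hxp).2
    rw [proj_append, proj_append, (proj_takeCount_dropCount α β _ t).1,
      (proj_takeCount_dropCount α β _ t).2, htake, hdrop, hxy]

end GraphProduct

/-! ### Enumerations of the values of a partial function -/

/-- The defined values among `f 0, …, f (n - 1)`. -/
def valuesBelow {X : Type*} (f : ℕ → Option X) (n : ℕ) : List X := (List.range n).filterMap f

section ValuesBelow

variable {X : Type*} {f g : ℕ → Option X}

@[simp]
theorem valuesBelow_zero (f : ℕ → Option X) : valuesBelow f 0 = [] := rfl

theorem valuesBelow_succ (f : ℕ → Option X) (n : ℕ) :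
    valuesBelow f (n + 1) = valuesBelow f n ++ (f n).toList := by
  cases h : f n <;> simp [valuesBelow, List.range_succ, List.filterMap_append, h]

theorem valuesBelow_add (f : ℕ → Option X) (m n : ℕ) :
    valuesBelow f (m + n) = valuesBelow f m ++ valuesBelow (fun i => f (m + i)) n := by
  induction n with
  | zero => simp
  | succ n ih => rw [← add_assoc, valuesBelow_succ, ih, valuesBelow_succ, List.append_assoc]

theorem valuesBelow_filter (P : X → Bool) (f : ℕ → Option X) (n : ℕ) :
    (valuesBelow f n).filter P = valuesBelow (fun i => (f i).filter P) n := by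
  simp [valuesBelow, List.filter_filterMap]

theorem length_valuesBelow_le (f : ℕ → Option X) (n : ℕ) : (valuesBelow f n).length ≤ n :=
  (List.length_filterMap_le _ _).trans_eq List.length_range

theorem countP_valuesBelow (P : X → Bool) (f : ℕ → Option X) (n : ℕ) :
    (valuesBelow f n).countP P = Nat.count (fun i => (f i).any P) n := by
  induction n with
  | zero => simp
  | succ n ih =>
    rw [valuesBelow_succ, List.countP_append, ih, Nat.count_succ]
    cases f n <;> simp [List.countP_singleton]

theorem length_valuesBelow (f : ℕ → Option X) (n : ℕ) :
    (valuesBelow f n).length = Nat.count (fun i => (f i).isSome) n := by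
  induction n with
  | zero => simp
  | succ n ih =>
    rw [valuesBelow_succ, List.length_append, ih, Nat.count_succ]
    cases f n <;> simp

theorem getElem?_valuesBelow {n k : ℕ} {x : X} : (valuesBelow f n)[k]? = some x ↔
    ∃ i < n, f i = some x ∧ Nat.count (fun i => (f i).isSome) i = k := by
  induction n with
  | zero => simp
  | succ n ih =>
    rw [valuesBelow_succ, List.getElem?_append, length_valuesBelow]
    simp only [Nat.lt_succ_iff_lt_or_eq, or_and_right, exists_or, exists_eq_left, ← ih]
    rw [← length_valuesBelow]
    split_ifs with hk
    · refine (or_iff_left fun h => ?_).symm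
      omega
    · rw [List.getElem?_eq_none (not_lt.1 hk)]
      cases f n <;> grind

theorem valuesBelow_prefix_iff {n m : ℕ} : valuesBelow f n <+: valuesBelow g m ↔
    ∀ i < n, (f i).isSome → ∃ j < m, (∃ x, f i = some x ∧ g j = some x) ∧
      Nat.count (fun i => (g i).isSome) j = Nat.count (fun i => (f i).isSome) i := by
  rw [List.prefix_iff_getElem?]
  constructor
  · intro h i hi hf
    obtain ⟨x, hx⟩ := Option.isSome_iff_exists.1 hf
    obtain ⟨hlt, hget⟩ := List.getElem?_eq_some_iff.1 (getElem?_valuesBelow.2 ⟨i, hi, hx, rfl⟩)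
    obtain ⟨j, hj, hgj, hcount⟩ := getElem?_valuesBelow.1 (hget ▸ h _ hlt)
    exact ⟨j, hj, ⟨x, hx, hgj⟩, hcount⟩
  · intro h k hk
    obtain ⟨i, hi, hfi, hcount⟩ := getElem?_valuesBelow.1 (List.getElem?_eq_getElem hk)
    obtain ⟨j, hj, ⟨x, hx, hgj⟩, hcount'⟩ := h i hi (by rw [hfi]; rfl)
    rw [getElem?_valuesBelow]
    exact ⟨j, hj, hgj.trans (hx.symm.trans hfi), hcount'.trans hcount⟩

theorem exists_length_valuesBelow_eq {n k : ℕ} (hk : k ≤ (valuesBelow f n).length) :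
    ∃ r ≤ n, (valuesBelow f r).length = k := by
  induction n with
  | zero => exact ⟨0, le_rfl, (Nat.le_zero.1 hk).symm⟩
  | succ n ih =>
    rcases le_or_gt k (valuesBelow f n).length with hle | hlt
    · obtain ⟨r, hr, hlength⟩ := ih hle
      exact ⟨r, by omega, hlength⟩
    · refine ⟨n + 1, le_rfl, ?_⟩
      rw [valuesBelow_succ, List.length_append] at hk ⊢
      have := Option.length_toList_le (o := f n)
      omega

theorem exists_valuesBelow_eq_append_iff {n : ℕ} {l : List X} {P : List X → Prop} :
    (∃ x y, valuesBelow f n = x ++ l ++ y ∧ P x) ↔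
      ∃ r < n + 1, P (valuesBelow f r) ∧ l <+: valuesBelow (fun i => f (r + i)) (n - r) := by
  constructor
  · rintro ⟨x, y, h, hx⟩
    rw [List.append_assoc] at h
    obtain ⟨r, hr, hlength⟩ := exists_length_valuesBelow_eq (f := f) (n := n) (k := x.length)
      (by simp [h])
    rw [← Nat.add_sub_cancel' hr, valuesBelow_add] at h
    obtain ⟨rfl, hrest⟩ := List.append_inj h hlength
    exact ⟨r, Nat.lt_succ_of_le hr, hx, y, hrest.symm⟩
  · rintro ⟨r, hr, hP, y, hy⟩
    refine ⟨_, y, ?_, hP⟩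
    rw [List.append_assoc, hy, ← valuesBelow_add, Nat.add_sub_cancel' (Nat.le_of_lt_succ hr)]

end ValuesBelow

namespace GraphProduct

section WellFormed

variable {L : Type u} {G : L → Type v} {S : ∀ α, Finset (G α)}

/-! ### Well-formed inputs -/

/-- The pairs of tokens that may follow each other in the input; `none` is a margin. -/
def Follows : Option (Token S) → Option (Token S) → Prop
  | some .opening, some (.gen _ _) => True
  | some .opening, _ => False
  | some (.gen α _), some (.gen β _) => α = β
  | some (.gen _ _), some .closing => True
  | some (.gen _ _), _ => False
  | _, some .opening => True
  | _, some .sep => True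
  | _, none => True
  | _, _ => False

/-- Any two consecutive tokens of `z` may follow each other, when `z` is preceded by `p` and
followed by the right margin. -/
def Admissible : Option (Token S) → List (Token S) → Prop
  | p, [] => Follows p none
  | p, a :: z => Follows p (some a) ∧ Admissible (some a) z

theorem admissible_iff {p : Option (Token S)} {z : List (Token S)} : Admissible p z ↔
    ∀ i < z.length + 1, Follows (if i = 0 then p else z[i - 1]?) z[i]? := by
  induction z generalizing p with
  | nil => simp [Admissible]
  | cons a z ih =>
    rw [Admissible, ih, List.length_cons, Nat.forall_lt_succ_left (n := z.length + 1)]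
    refine and_congr (by simp) (forall₂_congr fun i _ => ?_)
    cases i <;> simp

theorem Admissible.of_append {p : Option (Token S)} {x : List (Token S)} {a : Token S}
    {y : List (Token S)} (h : Admissible p (x ++ a :: y)) : Admissible (some a) y := by
  induction x generalizing p with
  | nil => exact h.2
  | cons b x ih => exact ih h.2

theorem code_cons (α : L) (w : List (S α)) (b : List (Σ α, List (S α))) :
    code (⟨α, w⟩ :: b) = Token.opening :: (w.map (Token.gen α) ++ Token.closing :: code b) := by
  simp [code]

/-- The string `l` completes a string of blocks whose last token before `l` is `p`. -/
def CompletesBlocks (l : List (Token S)) : Option (Token S) → Prop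
  | some .opening => ∃ (α : L) (u : List (S α)) (b : List (Σ α, List (S α))),
      l = u.map (Token.gen α) ++ .closing :: code b
  | some (.gen α _) => ∃ (u : List (S α)) (b : List (Σ α, List (S α))),
      l = u.map (Token.gen α) ++ .closing :: code b
  | _ => ∃ b : List (Σ α, List (S α)), l = code b

theorem Admissible.completesBlocks {l r : List (Token S)} (hl : Token.sep ∉ l)
    (hr : r.head? = none ∨ r.head? = some .sep) {p : Option (Token S)}
    (h : Admissible p (l ++ r)) : CompletesBlocks l p := by
  induction l generalizing p with
  | nil =>
    have hend : Follows p r.head? := by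
      cases r with
      | nil => exact h
      | cons a r => exact h.1
    rcases p with _ | (_ | _ | _ | _)
    case none | some.closing | some.sep => exact ⟨[], rfl⟩
    all_goals rcases hr with hr | hr <;> rw [hr] at hend <;> exact hend.elim
  | cons a l ih =>
    obtain ⟨hfollows, htail⟩ := h
    have hcompletes := ih (fun h => hl (List.mem_cons_of_mem _ h)) htail
    cases a with
    | sep => exact absurd List.mem_cons_self hl
    | opening =>
      obtain ⟨α, u, b, rfl⟩ := hcompletes
      rcases p with _ | (_ | _ | _ | _)
      case some.gen | some.opening => exact hfollows.elim
      all_goals exact ⟨⟨α, u⟩ :: b, (code_cons α u b).symm⟩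
    | closing =>
      obtain ⟨b, rfl⟩ := hcompletes
      rcases p with _ | (_ | _ | _ | _)
      case some.gen => exact ⟨[], b, rfl⟩
      all_goals exact hfollows.elim
    | gen α s =>
      obtain ⟨u, b, rfl⟩ := hcompletes
      rcases p with _ | (⟨β, s'⟩ | _ | _ | _)
      case some.gen =>
        obtain rfl : β = α := hfollows
        exact ⟨s :: u, b, rfl⟩
      case some.opening => exact ⟨α, s :: u, b, rfl⟩
      all_goals exact hfollows.elim

theorem admissible_gens {α : L} {r : List (Token S)} (hr : Admissible (some .closing) r)
    (s : S α) (w : List (S α)) :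
    Admissible (some (.gen α s)) (w.map (Token.gen α) ++ .closing :: r) := by
  induction w generalizing s with
  | nil => exact ⟨trivial, hr⟩
  | cons s' w ih => exact ⟨rfl, ih s'⟩

theorem Admissible.code_append {p : Option (Token S)} {r : List (Token S)} (hp : Admissible p r)
    (hclosing : Admissible (some .closing) r) (hopening : Follows p (some .opening))
    {b : List (Σ α, List (S α))} (hb : ∀ x ∈ b, x.2 ≠ []) : Admissible p (code b ++ r) := by
  induction b generalizing p with
  | nil => exact hp
  | cons x b ih =>
    obtain ⟨α, _ | ⟨s, w⟩⟩ := x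
    · exact absurd rfl (hb _ List.mem_cons_self)
    · have hrest := ih hclosing trivial fun x hx => hb x (List.mem_cons_of_mem _ hx)
      rw [code_cons, List.cons_append, List.append_assoc]
      exact ⟨hopening, trivial, admissible_gens hrest s w⟩

theorem sep_notMem_code (b : List (Σ α, List (S α))) : Token.sep ∉ code b := by
  simp [code]

theorem admissible_code_sep_code {b b' : List (Σ α, List (S α))} (hb : ∀ x ∈ b, x.2 ≠ [])
    (hb' : ∀ x ∈ b', x.2 ≠ []) : Admissible none (code b ++ .sep :: code b') := by
  have hsep : Admissible (some .sep) (code b') := by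
    rw [← List.append_nil (code b')]
    exact Admissible.code_append (p := some .sep) (r := []) trivial trivial trivial hb'
  exact Admissible.code_append (p := none) (r := .sep :: code b')
    ⟨trivial, hsep⟩ ⟨trivial, hsep⟩ trivial hb

theorem Admissible.exists_code_sep {u v : List (Token S)} (h : Admissible none (u ++ .sep :: v))
    (hu : Token.sep ∉ u) (hv : Token.sep ∉ v) :
    ∃ b b' : List (Σ α, List (S α)), u = code b ∧ v = code b' := by
  obtain ⟨b, hb⟩ := h.completesBlocks hu (.inr rfl)
  have hsep := h.of_append
  rw [← List.append_nil v] at hsep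
  obtain ⟨b', hb'⟩ := hsep.completesBlocks hv (.inl rfl)
  exact ⟨b, b', hb, hb'⟩

/-- The only separator of `z` is at the position `s`. -/
def IsSeparator (z : List (Token S)) (s : ℕ) : Prop :=
  z[s]? = some .sep ∧ ∀ j < z.length, z[j]? = some .sep → j = s

theorem isSeparator_length {u v : List (Token S)} (hu : Token.sep ∉ u) (hv : Token.sep ∉ v) :
    IsSeparator (u ++ .sep :: v) u.length := by
  refine ⟨by simp, fun j _ hj => ?_⟩
  rcases lt_trichotomy j u.length with h | h | h
  · rw [List.getElem?_append_left h] at hj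
    exact absurd (List.mem_of_getElem? hj) hu
  · exact h
  · obtain ⟨k, rfl⟩ := Nat.exists_eq_add_of_lt h
    rw [add_assoc, List.getElem?_append_right (Nat.le_add_right _ _), Nat.add_sub_cancel_left,
      List.getElem?_cons_succ] at hj
    exact absurd (List.mem_of_getElem? hj) hv

theorem IsSeparator.exists_append {z : List (Token S)} {s : ℕ} (h : IsSeparator z s) :
    ∃ u v : List (Token S), z = u ++ .sep :: v ∧ u.length = s ∧ Token.sep ∉ u ∧ Token.sep ∉ v := by
  obtain ⟨hs, hsep⟩ := List.getElem?_eq_some_iff.1 h.1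
  refine ⟨z.take s, z.drop (s + 1), ?_, List.length_take_of_le hs.le, fun hmem => ?_,
    fun hmem => ?_⟩
  · rw [← hsep, ← List.drop_eq_getElem_cons, List.take_append_drop]
  · obtain ⟨j, hj, hget⟩ := List.mem_take_iff_getElem.1 hmem
    have := h.2 j (by omega) (List.getElem?_eq_some_iff.2 ⟨_, hget⟩)
    omega
  · obtain ⟨j, hj, hget⟩ := List.mem_drop_iff_getElem.1 hmem
    have := h.2 (s + 1 + j) (by omega) (List.getElem?_eq_some_iff.2 ⟨_, hget⟩)
    omega

/-! ### Leading generators -/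

open Classical in
/-- The generator of `G α` given by a token. -/
noncomputable def toGenerator (α : L) : Token S → Option (S α)
  | .gen β s => if h : β = α then some (h ▸ s) else none
  | _ => none

theorem toGenerator_eq_some {α : L} {a : Token S} {s : S α} :
    toGenerator α a = some s ↔ a = .gen α s := by
  cases a with
  | gen β s' =>
    by_cases hβ : β = α
    · subst hβ
      simp [toGenerator]
    · simp [toGenerator, hβ]
  | opening => simp [toGenerator]
  | closing => simp [toGenerator]
  | sep => simp [toGenerator]

@[simp]
theorem toGenerator_gen (α : L) (s : S α) : toGenerator α (Token.gen α s) = some s :=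
  toGenerator_eq_some.2 rfl

theorem toGenerator_gen_of_ne {α β : L} (h : β ≠ α) (s : S β) :
    toGenerator α (Token.gen β s) = none := by
  simp [toGenerator, h]

/-- The generators of `G α` at the beginning of a string of tokens. -/
noncomputable def leading (α : L) : List (Token S) → List (S α)
  | [] => []
  | a :: z => (toGenerator α a).elim [] fun s => s :: leading α z

theorem leading_gens (α : L) (w : List (S α)) (r : List (Token S)) :
    leading α (w.map (Token.gen α) ++ .closing :: r) = w := by
  induction w with
  | nil => rfl
  | cons s w ih => simp [leading, ih]

theorem getElem?_leading {α : L} {z : List (Token S)} {k : ℕ} {s : S α} :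
    (leading α z)[k]? = some s ↔
      (∀ j < k, ∃ s' : S α, z[j]? = some (.gen α s')) ∧ z[k]? = some (.gen α s) := by
  induction z generalizing k with
  | nil => simp [leading]
  | cons a z ih =>
    cases k with
    | zero => cases h : toGenerator α a <;> simp [leading, h, ← toGenerator_eq_some]
    | succ k =>
      rw [Nat.forall_lt_succ_left, List.getElem?_cons_zero, List.getElem?_cons_succ]
      simp only [List.getElem?_cons_succ, Option.some.injEq, ← toGenerator_eq_some]
      cases h : toGenerator α a <;> simp [leading, h, ih]

theorem lt_length_leading {α : L} {z : List (Token S)} {k : ℕ} :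
    k < (leading α z).length ↔ ∀ j < k + 1, ∃ s : S α, z[j]? = some (.gen α s) := by
  rw [Nat.forall_lt_succ_right, ← not_le, ← List.getElem?_eq_none_iff, ← ne_eq,
    Option.ne_none_iff_exists']
  simp only [getElem?_leading, exists_and_left]

theorem length_leading_le (α : L) (z : List (Token S)) : (leading α z).length ≤ z.length := by
  induction z with
  | nil => exact le_rfl
  | cons a z ih => cases h : toGenerator α a <;> simp [leading, h, ih]

end WellFormed

end GraphProduct

namespace GraphProduct

section Letters

variable {L : Type u} {G : L → Type v} [∀ α, Group (G α)] {S : ∀ α, Finset (G α)}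

/-! ### The letters of an input -/

/-- The element of `G α` that a word over the generators represents. -/
def value {α : L} (w : List (S α)) : G α := (w.map Subtype.val).prod

open Classical in
/-- The letter that the block `[u]` represents, if the value of `u` is not `1`. -/
noncomputable def blockLetter (x : Σ α, List (S α)) : Option (Letter G) :=
  if h : value x.2 ≠ 1 then some ⟨⟨x.1, value x.2⟩, h⟩ else none

theorem blockLetter_eq_some {x : Σ α, List (S α)} {a : Letter G} :
    blockLetter x = some a ↔ (⟨x.1, value x.2⟩ : Σ α, G α) = a.1 := by
  rw [blockLetter, Option.dite_none_right_eq_some]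
  refine ⟨fun ⟨_, h⟩ => congrArg Subtype.val (Option.some.inj h), fun h => ⟨?_, ?_⟩⟩
  · have ha := a.2
    rwa [← h] at ha
  · exact congrArg some (Subtype.ext h)

theorem blockLetter_nil (α : L) : blockLetter (⟨α, []⟩ : Σ α, List (S α)) = none := by
  simp [blockLetter, value]

theorem represents_iff {b : List (Σ α, List (S α))} {w : List (Letter G)} :
    Represents b w ↔ (∀ x ∈ b, (blockLetter x).isSome) ∧ w = b.filterMap blockLetter := by
  induction b generalizing w with
  | nil =>
    exact eq_comm.trans (List.map_eq_nil_iff.trans ⟨fun h => ⟨List.forall_mem_nil _, h⟩, And.right⟩)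
  | cons x b ih =>
    have hcons : Represents (x :: b) w ↔
        ∃ a w', w = a :: w' ∧ blockLetter x = some a ∧ Represents b w' := by
      simp only [blockLetter_eq_some]
      refine eq_comm.trans (List.map_eq_cons_iff.trans ?_)
      exact exists₂_congr fun a w' => and_congr_right fun _ => and_congr eq_comm eq_comm
    simp only [hcons, ih, List.forall_mem_cons]
    cases h : blockLetter x with
    | none => simp
    | some a => simp [h]; tauto

/-- The letter that the block at the beginning of a string of tokens represents, if any. -/
noncomputable def firstLetter : List (Token S) → Option (Letter G)
  | .opening :: z => z.head?.bind fun
    | .gen α _ => blockLetter ⟨α, leading α z⟩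
    | _ => none
  | _ => none

theorem firstLetter_eq_some {z : List (Token S)} {a : Letter G} : firstLetter z = some a ↔
    z.head? = some .opening ∧ value (leading a.node z.tail) = a.1.2 := by
  have hempty : value ([] : List (S a.node)) ≠ a.1.2 := a.2.symm
  rcases z with _ | ⟨_ | _ | _ | _, _ | ⟨⟨α, s⟩ | _ | _ | _, z⟩⟩
  case cons.opening.cons.gen =>
    refine blockLetter_eq_some.trans ?_
    obtain ⟨⟨β, g⟩, hg⟩ := a
    by_cases hα : α = β
    · subst hα
      simp [Letter.node]
    · have hempty : value ([] : List (S β)) ≠ g := hg.symm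
      simp [Letter.node, hα, leading, toGenerator_gen_of_ne hα, hempty]
  all_goals simp [firstLetter, leading, toGenerator, hempty]

theorem firstLetter_block (α : L) (w : List (S α)) (r : List (Token S)) :
    firstLetter (.opening :: (w.map (Token.gen α) ++ .closing :: r)) = blockLetter ⟨α, w⟩ := by
  cases w with
  | nil => rw [blockLetter_nil]; rfl
  | cons s w => exact congrArg (fun u => blockLetter ⟨α, u⟩) (leading_gens α (s :: w) r)

/-- The letters that the blocks starting at the first `n` positions of `z` represent. -/
noncomputable def lettersBelow (z : List (Token S)) (n : ℕ) : List (Letter G) :=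
  valuesBelow (fun i => firstLetter (z.drop i)) n

theorem lettersBelow_cons (a : Token S) (z : List (Token S)) (n : ℕ) :
    lettersBelow (a :: z) (n + 1) = (firstLetter (a :: z)).toList ++ lettersBelow z n := by
  rw [lettersBelow, add_comm, valuesBelow_add]
  simp [valuesBelow_succ, lettersBelow, add_comm 1]

theorem lettersBelow_gens (α : L) (w : List (S α)) (r : List (Token S)) (n : ℕ) :
    lettersBelow (w.map (Token.gen α) ++ r) (w.length + n) = lettersBelow r n := by
  induction w with
  | nil => simp
  | cons s w ih =>
    rw [List.length_cons, Nat.succ_add, List.map_cons, List.cons_append, lettersBelow_cons, ih]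
    rfl

theorem lettersBelow_code (b : List (Σ α, List (S α))) (r : List (Token S)) :
    lettersBelow (code b ++ r) (code b).length = b.filterMap blockLetter := by
  induction b with
  | nil => rfl
  | cons x b ih =>
    obtain ⟨α, w⟩ := x
    rw [code_cons, List.length_cons, List.cons_append, lettersBelow_cons, List.append_assoc,
      List.cons_append, firstLetter_block, List.length_append, List.length_map, List.length_cons,
      lettersBelow_gens, lettersBelow_cons, ih]
    cases h : blockLetter ⟨α, w⟩ <;> simp [h, firstLetter]

/-- Every opening bracket of `z` starts a block that represents a letter. -/
def HasNontrivialBlocks (z : List (Token S)) : Prop :=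
  ∀ i < z.length, z[i]? = some .opening → (firstLetter (z.drop i)).isSome

theorem hasNontrivialBlocks_nil : HasNontrivialBlocks ([] : List (Token S)) := by
  simp [HasNontrivialBlocks]

theorem hasNontrivialBlocks_cons {a : Token S} {z : List (Token S)} :
    HasNontrivialBlocks (a :: z) ↔
      (a = .opening → (firstLetter (a :: z)).isSome) ∧ HasNontrivialBlocks z := by
  rw [HasNontrivialBlocks, List.length_cons, Nat.forall_lt_succ_left]
  simp [HasNontrivialBlocks]

theorem hasNontrivialBlocks_gens {α : L} {w : List (S α)} {r : List (Token S)} :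
    HasNontrivialBlocks (w.map (Token.gen α) ++ r) ↔ HasNontrivialBlocks r := by
  induction w with
  | nil => rfl
  | cons s w ih => simp [hasNontrivialBlocks_cons, ih]

theorem hasNontrivialBlocks_code {b : List (Σ α, List (S α))} {r : List (Token S)} :
    HasNontrivialBlocks (code b ++ r) ↔
      (∀ x ∈ b, (blockLetter x).isSome) ∧ HasNontrivialBlocks r := by
  induction b with
  | nil => simp [code]
  | cons x b ih =>
    obtain ⟨α, w⟩ := x
    rw [code_cons, List.cons_append, List.append_assoc, List.cons_append,
      hasNontrivialBlocks_cons, hasNontrivialBlocks_gens, hasNontrivialBlocks_cons, ih,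
      firstLetter_block]
    simp [and_assoc]

/-! ### Recognizing the inputs -/

variable {I : SimpleGraph L}

theorem mem_patternMatching_iff_exists_code {z : List (Token S)} : z ∈ patternMatching I S ↔
    ∃ bp bt : List (Σ α, List (S α)), z = code bp ++ .sep :: code bt ∧
      (∀ x ∈ bp, (blockLetter x).isSome) ∧ (∀ x ∈ bt, (blockLetter x).isSome) ∧
      ∃ x y, DepEquiv I (bt.filterMap blockLetter) (x ++ bp.filterMap blockLetter ++ y) := by
  simp only [patternMatching, represents_iff]
  constructor
  · rintro ⟨bp, bt, _, _, hz, ⟨hp, rfl⟩, ⟨ht, rfl⟩, h⟩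
    exact ⟨bp, bt, hz, hp, ht, h⟩
  · rintro ⟨bp, bt, hz, hp, ht, h⟩
    exact ⟨bp, bt, _, _, hz, ⟨hp, rfl⟩, ⟨ht, rfl⟩, h⟩

theorem mem_patternMatching_iff_exists_isSeparator {z : List (Token S)} :
    z ∈ patternMatching I S ↔ Admissible none z ∧ HasNontrivialBlocks z ∧
      ∃ s < z.length, IsSeparator z s ∧ ∃ x y,
        DepEquiv I (lettersBelow (z.drop (s + 1)) (z.length - (s + 1)))
          (x ++ lettersBelow z s ++ y) := by
  have hletters (bp bt : List (Σ α, List (S α))) :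
      lettersBelow (code bp ++ .sep :: code bt) (code bp).length = bp.filterMap blockLetter ∧
      lettersBelow ((code bp ++ .sep :: code bt).drop ((code bp).length + 1))
        ((code bp ++ .sep :: code bt).length - ((code bp).length + 1)) =
        bt.filterMap blockLetter := by
    refine ⟨lettersBelow_code _ _, ?_⟩
    rw [← List.drop_drop, List.drop_left, List.length_append, Nat.add_sub_add_left]
    simpa using lettersBelow_code bt []
  have hblocks (bp bt : List (Σ α, List (S α))) :
      HasNontrivialBlocks (code bp ++ .sep :: code bt) ↔
        (∀ x ∈ bp, (blockLetter x).isSome) ∧ ∀ x ∈ bt, (blockLetter x).isSome := by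
    have := hasNontrivialBlocks_code (b := bt) (r := [])
    rw [List.append_nil] at this
    simp [hasNontrivialBlocks_code, hasNontrivialBlocks_cons, this, hasNontrivialBlocks_nil]
  have hne {b : List (Σ α, List (S α))} (hb : ∀ x ∈ b, (blockLetter x).isSome) :
      ∀ x ∈ b, x.2 ≠ [] := by
    rintro ⟨α, w⟩ hx (rfl : w = [])
    simpa [blockLetter_nil] using hb _ hx
  rw [mem_patternMatching_iff_exists_code]
  constructor
  · rintro ⟨bp, bt, rfl, hp, ht, h⟩
    refine ⟨admissible_code_sep_code (hne hp) (hne ht), (hblocks bp bt).2 ⟨hp, ht⟩,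
      (code bp).length, by simp, isSeparator_length (sep_notMem_code bp) (sep_notMem_code bt), ?_⟩
    rwa [(hletters bp bt).1, (hletters bp bt).2]
  · rintro ⟨hz, hnontrivial, s, -, hs, h⟩
    obtain ⟨u, v, rfl, rfl, hu, hv⟩ := hs.exists_append
    obtain ⟨bp, bt, rfl, rfl⟩ := hz.exists_code_sep hu hv
    rw [(hletters bp bt).1, (hletters bp bt).2] at h
    obtain ⟨hp, ht⟩ := (hblocks bp bt).1 hnontrivial
    exact ⟨bp, bt, rfl, hp, ht, h⟩

theorem exists_depEquiv_append_iff_bounded {p t : List (Letter G)} {n : ℕ} (hn : t.length < n) :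
    (∃ x y, DepEquiv I t (x ++ p ++ y)) ↔ ∃ κ : L → ℕ, (∀ α, κ α < n) ∧
      ∀ α β, ¬ I.Adj α β → ∃ x y, proj α β t = x ++ proj α β p ++ y ∧
        nodeCount α x = κ α ∧ nodeCount β x = κ β := by
  rw [exists_depEquiv_append_iff]
  refine exists_congr fun κ => ⟨fun h => ⟨fun α => ?_, h⟩, And.right⟩
  obtain ⟨x, y, hproj, hκ, -⟩ := h α α (I.loopless.irrefl α)
  calc κ α = nodeCount α x := hκ.symm
    _ ≤ x.length := List.countP_le_length
    _ ≤ (proj α α t).length := by rw [hproj]; simp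
    _ ≤ t.length := List.length_filter_le _ _
    _ < n := hn

/-- The projection to two nodes of the text of an input with the separator at `s` has a factor equal
to the projection of the pattern, and `k` and `l` letters of these nodes precede this factor. -/
def HasFactor (z : List (Token S)) (α β : L) (s k l : ℕ) : Prop :=
  ∃ x y, proj α β (lettersBelow (z.drop (s + 1)) (z.length - (s + 1))) =
    x ++ proj α β (lettersBelow z s) ++ y ∧ nodeCount α x = k ∧ nodeCount β x = l

theorem mem_patternMatching_iff {z : List (Token S)} : z ∈ patternMatching I S ↔
    Admissible none z ∧ HasNontrivialBlocks z ∧ ∃ s < z.length, IsSeparator z s ∧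
      ∃ κ : L → ℕ, (∀ α, κ α < z.length + 1) ∧
        ∀ α β, ¬ I.Adj α β → HasFactor z α β s (κ α) (κ β) := by
  rw [mem_patternMatching_iff_exists_isSeparator]
  refine and_congr_right fun _ => and_congr_right fun _ => exists_congr fun s =>
    and_congr_right fun _ => and_congr_right fun _ => exists_depEquiv_append_iff_bounded ?_
  exact Nat.lt_succ_of_le ((length_valuesBelow_le _ _).trans (Nat.sub_le _ _))

end Letters

end GraphProduct

namespace Logspace

open LogspaceFun

theorem LogspacePred.getElem? {A : Type u} {α : Type*} [NatTuple α] (p : Option A → Prop)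
    {f : List A → α → ℕ} (hf : LogspaceFun f) : LogspacePred fun w a => p w[f w a]? := by
  refine (LogspacePred.cell (fun | .letter b => p (some b) | _ => p none)
    (succ.comp hf)).congr fun w a => ?_
  rw [inputCell_succ]
  cases w[f w a]? <;> rfl

theorem LogspacePred.valuesBelow_prefix {A : Type u} {α : Type*} [NatTuple α] {X : Type*}
    {f g : List A → α → ℕ → Option X}
    (hf : LogspacePred fun w (x : α × ℕ) => (f w x.1 x.2).isSome)
    (hg : LogspacePred fun w (x : α × ℕ) => (g w x.1 x.2).isSome)
    (hfg : LogspacePred fun w (x : (α × ℕ) × ℕ) =>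
      ∃ c, f w x.1.1 x.1.2 = some c ∧ g w x.1.1 x.2 = some c)
    {m n : List A → α → ℕ} (hm : LogspaceFun m) (hn : LogspaceFun n) :
    LogspacePred fun w a => valuesBelow (f w a) (m w a) <+: valuesBelow (g w a) (n w a) := by
  have hcount {h : List A → α → ℕ → Option X}
      (hh : LogspacePred fun w (x : α × ℕ) => (h w x.1 x.2).isSome) :
      LogspaceFun fun w (x : α × ℕ) => Nat.count (fun i => (h w x.1 i).isSome) x.2 :=
    LogspacePred.count (P := fun w x i => (h w x.1 i).isSome)
      (hh.comp ((fst.comp fst).pair snd)) snd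
  exact (LogspacePred.forall_lt (hf.imp (LogspacePred.exists_lt (hfg.and (LogspacePred.eq
    ((hcount hg).comp ((fst.comp fst).pair snd)) ((hcount hf).comp fst))) (hn.comp fst))) hm).congr
    fun w a => valuesBelow_prefix_iff.symm

end Logspace

namespace GraphProduct

open Logspace Logspace.LogspaceFun

/-! ### Comparing group elements in logarithmic space -/

section Value

variable {L : Type u} {G : L → Type v} [∀ α, Group (G α)] {S : ∀ α, Finset (G α)}

theorem value_append {γ : L} (u v : List (S γ)) : value (u ++ v) = value u * value v := by
  simp [value]

/-- The word `sₙ⁻¹⋯s₁⁻¹` for a word `s₁⋯sₙ`. -/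
def inverseWord {γ : L} (hinv : ∀ g ∈ S γ, g⁻¹ ∈ S γ) (w : List (S γ)) : List (S γ) :=
  (w.map fun s => ⟨s⁻¹, hinv s s.2⟩).reverse

theorem value_inverseWord {γ : L} (hinv : ∀ g ∈ S γ, g⁻¹ ∈ S γ) (w : List (S γ)) :
    value (inverseWord hinv w) = (value w)⁻¹ := by
  simp [value, inverseWord, List.prod_inv_reverse, Function.comp_def, List.map_reverse]

theorem getElem?_append_inverseWord {γ : L} (hinv : ∀ g ∈ S γ, g⁻¹ ∈ S γ) {u v : List (S γ)}
    {k : ℕ} {s : S γ} : (u ++ inverseWord hinv v)[k]? = some s ↔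
      u[k]? = some s ∨ u.length ≤ k ∧ k < u.length + v.length ∧
        v[u.length + v.length - 1 - k]? = some ⟨s⁻¹, hinv s s.2⟩ := by
  rw [List.getElem?_append]
  split_ifs with hu
  · exact (or_iff_left fun h => by omega).symm
  · rw [List.getElem?_eq_none (not_lt.1 hu), or_iff_right (by simp), inverseWord]
    by_cases hk : k < u.length + v.length
    · have hindex : v.length - 1 - (k - u.length) = u.length + v.length - 1 - k := by omega
      rw [List.getElem?_reverse (by rw [List.length_map]; omega), List.length_map, hindex,
        List.getElem?_map, Option.map_eq_some_iff]
      simp only [not_lt.1 hu, hk, true_and]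
      constructor
      · rintro ⟨s', hs', rfl⟩
        simp [hs']
      · exact fun h => ⟨_, h, by simp⟩
    · rw [List.getElem?_eq_none (by simp; omega)]
      simp [hk]

theorem logspacePred_value_eq {A α : Type*} [NatTuple α] {γ : L}
    (hinv : ∀ g ∈ S γ, g⁻¹ ∈ S γ) (hwp : InLogspace (wordProblem (S γ)))
    {V W : List A → α → List (S γ)} (hlengthV : LogspaceFun fun w a => (V w a).length)
    (hV : ∀ s, LogspacePred fun w (x : α × ℕ) => (V w x.1)[x.2]? = some s)
    (hlengthW : LogspaceFun fun w a => (W w a).length)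
    (hW : ∀ s, LogspacePred fun w (x : α × ℕ) => (W w x.1)[x.2]? = some s) :
    LogspacePred fun w a => value (V w a) = value (W w a) := by
  have hV' : LogspaceFun fun w (x : α × ℕ) => (V w x.1).length := hlengthV.comp fst
  have hW' : LogspaceFun fun w (x : α × ℕ) => (W w x.1).length := hlengthW.comp fst
  refine (hwp.logspacePred (V := fun w a => V w a ++ inverseWord hinv (W w a)) ?_
    fun s => ?_).congr fun w a => ?_
  · exact (hlengthV.add hlengthW).congr fun w a i _ => by simp [inverseWord]
  · refine LogspacePred.congr ?_ fun w x => (getElem?_append_inverseWord hinv).symm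
    exact (hV s).or ((LogspacePred.le hV' snd).and ((LogspacePred.lt snd (hV'.add hW')).and
      ((hW _).comp (fst.pair (((hV'.add hW').sub (const_nat 1)).sub snd)))))
  · change value _ = 1 ↔ _
    rw [value_append, value_inverseWord, mul_inv_eq_one]

end Value

section Tokens

variable {L : Type u} {G : L → Type v} {S : ∀ α, Finset (G α)}

theorem logspacePred_admissible [Finite L] :
    LogspacePred fun (z : List (Token S)) (_ : Unit) => Admissible none z := by
  have hfollows : LogspacePred fun (z : List (Token S)) (i : ℕ) =>
      Follows (if i = 0 then none else z[i - 1]?) z[i]? := by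
    refine LogspacePred.congr (.or
      ((LogspacePred.eq_zero id).and (LogspacePred.getElem? (Follows none) id))
      ((LogspacePred.eq_zero id).not.and (LogspacePred.exists_finite fun a : Option (Token S) =>
        (LogspacePred.getElem? (· = a) pred).and (LogspacePred.getElem? (Follows a) id))))
      fun z i => ?_
    by_cases hi : i = 0 <;> simp [hi]
  exact (LogspacePred.forall_lt (hfollows.comp snd) (succ.comp length)).congr
    fun z _ => admissible_iff.symm

theorem logspacePred_isSeparator :
    LogspacePred fun (z : List (Token S)) (s : ℕ) => IsSeparator z s :=
  (LogspacePred.getElem? (· = some Token.sep) id).and (LogspacePred.forall_lt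
    (P := fun z s j => z[j]? = some Token.sep → j = s)
    ((LogspacePred.getElem? (· = some Token.sep) snd).imp (.eq snd fst)) length)

theorem count_lt_of_le {m n : ℕ} (h : m ≤ n) : Nat.count (· < m) n = m := by
  obtain ⟨k, rfl⟩ := Nat.exists_eq_add_of_le h
  rw [Nat.count_add, Nat.count_of_forall fun _ hi => hi,
    Nat.count_of_forall_not fun _ _ => by omega, add_zero]

theorem logspaceFun_length_leading (γ : L) :
    LogspaceFun fun (z : List (Token S)) (i : ℕ) => (leading γ (z.drop i)).length := by
  classical
  have hlt : LogspacePred fun (z : List (Token S)) (x : ℕ × ℕ) =>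
      x.2 < (leading γ (z.drop x.1)).length := by
    refine LogspacePred.congr (LogspacePred.forall_lt (α := ℕ × ℕ)
      (P := fun z x j => ∃ s : S γ, z[x.1 + j]? = some (Token.gen γ s))
      (LogspacePred.getElem? (fun a => ∃ s : S γ, a = some (Token.gen γ s))
        ((fst.comp fst).add snd)) (succ.comp snd)) fun z x => ?_
    simp only [lt_length_leading, List.getElem?_drop]
  refine (hlt.count (P := fun z i k => k < (leading γ (z.drop i)).length) length).congr
    fun z i _ _ => count_lt_of_le ?_
  exact (length_leading_le _ _).trans (by simp)

theorem logspacePred_getElem?_leading (γ : L) (s : S γ) :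
    LogspacePred fun (z : List (Token S)) (x : ℕ × ℕ) =>
      (leading γ (z.drop x.1))[x.2]? = some s := by
  refine LogspacePred.congr (.and (LogspacePred.forall_lt (α := ℕ × ℕ)
    (P := fun z x j => ∃ s : S γ, z[x.1 + j]? = some (Token.gen γ s))
    (LogspacePred.getElem? (fun a => ∃ s : S γ, a = some (Token.gen γ s))
      ((fst.comp fst).add snd)) snd)
    (LogspacePred.getElem? (· = some (Token.gen γ s)) (fst.add snd))) fun z x => ?_
  simp only [getElem?_leading, List.getElem?_drop]

end Tokens

section FirstLetter

variable {L : Type u} {G : L → Type v} [∀ α, Group (G α)] {S : ∀ α, Finset (G α)}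

theorem firstLetter_any_iff {z : List (Token S)} {q : L → Bool} :
    (firstLetter z).any (fun a => q a.node) ↔
      ∃ γ, q γ ∧ z.head? = some .opening ∧ value (leading γ z.tail) ≠ 1 := by
  rw [Option.any_eq_true]
  simp only [firstLetter_eq_some]
  constructor
  · rintro ⟨a, ⟨hopening, ha⟩, hq⟩
    exact ⟨a.node, hq, hopening, ha ▸ a.2⟩
  · rintro ⟨γ, hq, hopening, hγ⟩
    exact ⟨⟨⟨γ, _⟩, hγ⟩, ⟨hopening, rfl⟩, hq⟩

theorem exists_firstLetter_eq_iff {z z' : List (Token S)} {q : L → Bool} :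
    (∃ a, q a.node ∧ firstLetter z = some a ∧ firstLetter z' = some a) ↔
      ∃ γ, q γ ∧ (z.head? = some .opening ∧ value (leading γ z.tail) ≠ 1) ∧
        z'.head? = some .opening ∧ value (leading γ z.tail) = value (leading γ z'.tail) := by
  simp only [firstLetter_eq_some]
  constructor
  · rintro ⟨a, hq, ⟨hopening, ha⟩, hopening', ha'⟩
    exact ⟨a.node, hq, ⟨hopening, ha ▸ a.2⟩, hopening', ha.trans ha'.symm⟩
  · rintro ⟨γ, hq, ⟨hopening, hγ⟩, hopening', heq⟩
    exact ⟨⟨⟨γ, _⟩, hγ⟩, hq, ⟨hopening, rfl⟩, hopening', heq.symm⟩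

theorem logspacePred_leading_ne_one {γ : L} (hwp : InLogspace (wordProblem (S γ))) :
    LogspacePred fun (z : List (Token S)) (i : ℕ) => value (leading γ (z.drop i)) ≠ 1 :=
  (hwp.logspacePred (logspaceFun_length_leading γ) (logspacePred_getElem?_leading γ)).not

variable [Finite L] (hwp : ∀ α, InLogspace (wordProblem (S α)))
include hwp

theorem logspacePred_firstLetter_any (q : L → Bool) :
    LogspacePred fun (z : List (Token S)) (i : ℕ) =>
      (firstLetter (z.drop i)).any fun a => q a.node := by
  refine LogspacePred.congr (LogspacePred.exists_finite fun γ => (LogspacePred.const (q γ)).and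
    ((LogspacePred.getElem? (· = some Token.opening) id).and
      ((logspacePred_leading_ne_one (hwp γ)).comp succ))) fun z i => ?_
  rw [firstLetter_any_iff, List.head?_drop, List.tail_drop]

theorem logspacePred_hasNontrivialBlocks :
    LogspacePred fun (z : List (Token S)) (_ : Unit) => HasNontrivialBlocks z := by
  have hsome : LogspacePred fun (z : List (Token S)) (i : ℕ) => (firstLetter (z.drop i)).isSome :=
    (logspacePred_firstLetter_any hwp fun _ => true).congr fun z i => by simp
  exact LogspacePred.forall_lt (P := fun z _ i => z[i]? = some Token.opening →
    (firstLetter (z.drop i)).isSome)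
    ((LogspacePred.getElem? (· = some Token.opening) snd).imp (hsome.comp snd)) length

theorem logspacePred_exists_firstLetter_eq (hinv : ∀ α, ∀ g ∈ S α, g⁻¹ ∈ S α) (q : L → Bool) :
    LogspacePred fun (z : List (Token S)) (x : ℕ × ℕ) =>
      ∃ a, q a.node ∧ firstLetter (z.drop x.1) = some a ∧ firstLetter (z.drop x.2) = some a := by
  have hvalue (γ : L) : LogspacePred fun (z : List (Token S)) (x : ℕ × ℕ) =>
      value (leading γ (z.drop x.1)) = value (leading γ (z.drop x.2)) :=
    logspacePred_value_eq (hinv γ) (hwp γ) (V := fun z (x : ℕ × ℕ) => leading γ (z.drop x.1))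
      (W := fun z (x : ℕ × ℕ) => leading γ (z.drop x.2)) ((logspaceFun_length_leading γ).comp fst)
      (fun s => (logspacePred_getElem?_leading γ s).comp ((fst.comp fst).pair snd))
      ((logspaceFun_length_leading γ).comp snd)
      fun s => (logspacePred_getElem?_leading γ s).comp ((snd.comp fst).pair snd)
  refine LogspacePred.congr (LogspacePred.exists_finite fun γ => (LogspacePred.const (q γ)).and
    (((LogspacePred.getElem? (· = some Token.opening) fst).and
      ((logspacePred_leading_ne_one (hwp γ)).comp (succ.comp fst))).and
    ((LogspacePred.getElem? (· = some Token.opening) snd).and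
      ((hvalue γ).comp ((succ.comp fst).pair (succ.comp snd)))))) fun z x => ?_
  simp only [exists_firstLetter_eq_iff, List.head?_drop, List.tail_drop]

end FirstLetter

/-! ### Comparing projections in logarithmic space -/

section Factor

variable {L : Type u} {G : L → Type v} [∀ α, Group (G α)] {S : ∀ α, Finset (G α)}

open Classical in
/-- The letter that the block at the position `i` of `z` represents, provided that it belongs to one
of the nodes `α` and `β`. -/
noncomputable def pairLetter (α β : L) (z : List (Token S)) (i : ℕ) : Option (Letter G) :=
  (firstLetter (z.drop i)).filter fun a => a.node = α ∨ a.node = β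

theorem proj_lettersBelow_drop (α β : L) (z : List (Token S)) (s n : ℕ) :
    proj α β (lettersBelow (z.drop s) n) = valuesBelow (fun i => pairLetter α β z (s + i)) n := by
  simp only [proj, lettersBelow, valuesBelow_filter, pairLetter, List.drop_drop]

open Classical in
theorem nodeCount_valuesBelow_pairLetter {α β γ : L} (hγ : γ = α ∨ γ = β) (z : List (Token S))
    (s n : ℕ) : nodeCount γ (valuesBelow (fun i => pairLetter α β z (s + i)) n) =
      Nat.count (fun i => (firstLetter (z.drop (s + i))).any fun a => a.node = γ) n := by
  rw [← proj_lettersBelow_drop, nodeCount_proj hγ, nodeCount, lettersBelow, countP_valuesBelow]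
  simp only [List.drop_drop]

theorem hasFactor_iff {z : List (Token S)} {α β : L} {s k l : ℕ} : HasFactor z α β s k l ↔
    ∃ r < z.length - (s + 1) + 1,
      (nodeCount α (valuesBelow (fun i => pairLetter α β z (s + 1 + i)) r) = k ∧
        nodeCount β (valuesBelow (fun i => pairLetter α β z (s + 1 + i)) r) = l) ∧
      valuesBelow (pairLetter α β z) s <+:
        valuesBelow (fun i => pairLetter α β z (s + 1 + (r + i))) (z.length - (s + 1) - r) := by
  have hpattern : proj α β (lettersBelow z s) = valuesBelow (pairLetter α β z) s := by
    simpa using proj_lettersBelow_drop α β z 0 s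
  rw [HasFactor, hpattern, proj_lettersBelow_drop]
  exact exists_valuesBelow_eq_append_iff

variable [Finite L] (hwp : ∀ α, InLogspace (wordProblem (S α)))
include hwp

theorem logspacePred_isSome_pairLetter (α β : L) :
    LogspacePred fun (z : List (Token S)) (i : ℕ) => (pairLetter α β z i).isSome := by
  classical
  refine (logspacePred_firstLetter_any hwp fun γ => γ = α ∨ γ = β).congr fun z i => ?_
  rw [pairLetter, Option.isSome_filter]

theorem logspaceFun_nodeCount_valuesBelow_pairLetter {α β γ : L} (hγ : γ = α ∨ γ = β) :
    LogspaceFun fun (z : List (Token S)) (x : ℕ × ℕ) =>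
      nodeCount γ (valuesBelow (fun i => pairLetter α β z (x.1 + i)) x.2) := by
  classical
  simp only [nodeCount_valuesBelow_pairLetter hγ]
  exact LogspacePred.count
    (P := fun z x i => (firstLetter (z.drop (x.1 + i))).any fun a => a.node = γ)
    ((logspacePred_firstLetter_any hwp fun δ => δ = γ).comp ((fst.comp fst).add snd)) snd

variable (hinv : ∀ α, ∀ g ∈ S α, g⁻¹ ∈ S α)
include hinv

theorem logspacePred_exists_pairLetter_eq (α β : L) :
    LogspacePred fun (z : List (Token S)) (x : ℕ × ℕ) =>
      ∃ a, pairLetter α β z x.1 = some a ∧ pairLetter α β z x.2 = some a := by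
  classical
  refine (logspacePred_exists_firstLetter_eq hwp hinv fun γ => γ = α ∨ γ = β).congr fun z x => ?_
  simp only [pairLetter, Option.filter_eq_some_iff]
  exact exists_congr fun a => by tauto

theorem logspacePred_pattern_prefix (α β : L) :
    LogspacePred fun (z : List (Token S)) (x : ℕ × ℕ) =>
      valuesBelow (pairLetter α β z) x.1 <+:
        valuesBelow (fun i => pairLetter α β z (x.1 + 1 + (x.2 + i)))
          (z.length - (x.1 + 1) - x.2) := by
  have htext : LogspaceFun fun (_ : List (Token S)) (y : (ℕ × ℕ) × ℕ) =>
      y.1.1 + 1 + (y.1.2 + y.2) :=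
    (succ.comp (fst.comp fst)).add ((snd.comp fst).add snd)
  exact LogspacePred.valuesBelow_prefix
    ((logspacePred_isSome_pairLetter hwp α β).comp snd)
    ((logspacePred_isSome_pairLetter hwp α β).comp htext)
    ((logspacePred_exists_pairLetter_eq hwp hinv α β).comp
      ((snd.comp fst).pair (htext.comp ((fst.comp fst).pair snd))))
    fst ((length.sub (succ.comp fst)).sub snd)

theorem logspacePred_hasFactor (α β : L) :
    LogspacePred fun (z : List (Token S)) (x : ℕ × (ℕ × ℕ)) => HasFactor z α β x.1 x.2.1 x.2.2 := by
  have hcount {γ : L} (hγ : γ = α ∨ γ = β) :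
      LogspaceFun fun (z : List (Token S)) (y : (ℕ × (ℕ × ℕ)) × ℕ) =>
        nodeCount γ (valuesBelow (fun i => pairLetter α β z (y.1.1 + 1 + i)) y.2) :=
    (logspaceFun_nodeCount_valuesBelow_pairLetter hwp hγ).comp
      ((succ.comp (fst.comp fst)).pair snd)
  refine LogspacePred.congr (LogspacePred.exists_lt (P := fun z (x : ℕ × (ℕ × ℕ)) r =>
    (nodeCount α (valuesBelow (fun i => pairLetter α β z (x.1 + 1 + i)) r) = x.2.1 ∧
      nodeCount β (valuesBelow (fun i => pairLetter α β z (x.1 + 1 + i)) r) = x.2.2) ∧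
    valuesBelow (pairLetter α β z) x.1 <+:
      valuesBelow (fun i => pairLetter α β z (x.1 + 1 + (r + i))) (z.length - (x.1 + 1) - r))
    ?_ (succ.comp (length.sub (succ.comp fst)))) fun z x => hasFactor_iff.symm
  exact ((LogspacePred.eq (hcount (.inl rfl)) (fst.comp (snd.comp fst))).and
    (LogspacePred.eq (hcount (.inr rfl)) (snd.comp (snd.comp fst)))).and
    ((logspacePred_pattern_prefix hwp hinv α β).comp ((fst.comp fst).pair snd))

theorem logspacePred_patternMatching (I : SimpleGraph L) :
    LogspacePred fun (z : List (Token S)) (_ : Unit) => z ∈ patternMatching I S := by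
  obtain ⟨n, ⟨e⟩⟩ := Finite.exists_equiv_fin L
  have hfactors : LogspacePred fun (z : List (Token S)) (x : ℕ × (Fin n → ℕ)) =>
      ∀ α β, ¬ I.Adj α β → HasFactor z α β x.1 (x.2 (e α)) (x.2 (e β)) :=
    .forall_finite fun α => .forall_finite fun β => (LogspacePred.const (¬ I.Adj α β)).imp
      ((logspacePred_hasFactor hwp hinv α β).comp
        (fst.pair (((LogspaceFun.proj (e α)).comp snd).pair ((LogspaceFun.proj (e β)).comp snd))))
  have hcounts : LogspacePred fun (z : List (Token S)) (s : ℕ) =>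
      ∃ κ : L → ℕ, (∀ α, κ α < z.length + 1) ∧
        ∀ α β, ¬ I.Adj α β → HasFactor z α β s (κ α) (κ β) := by
    refine (hfactors.exists_tuple_lt (P := fun z s κ =>
      ∀ α β, ¬ I.Adj α β → HasFactor z α β s (κ (e α)) (κ (e β)))
      (succ.comp length)).congr fun z s => ?_
    refine (e.arrowCongr (.refl ℕ)).symm.exists_congr fun κ => and_congr ?_ Iff.rfl
    exact e.symm.forall_congr fun i => by simp
  refine LogspacePred.congr (logspacePred_admissible.and ((logspacePred_hasNontrivialBlocks hwp).and
    (LogspacePred.exists_lt (P := fun z _ s => IsSeparator z s ∧ ∃ κ : L → ℕ,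
      (∀ α, κ α < z.length + 1) ∧ ∀ α β, ¬ I.Adj α β → HasFactor z α β s (κ α) (κ β))
      ((logspacePred_isSeparator.and hcounts).comp snd) length))) fun z _ => ?_
  exact mem_patternMatching_iff.symm

end Factor

end GraphProduct

theorem mainTheorem10_general {L : Type u} [Finite L] (I : SimpleGraph L)
    (G : L → Type v) [∀ α, Group (G α)] (S : ∀ α, Finset (G α))
    (hinv : ∀ α, ∀ g ∈ S α, g⁻¹ ∈ S α)
    (hwp : ∀ α, Logspace.InLogspace (GraphProduct.wordProblem (S α))) :
    Logspace.InLogspace (GraphProduct.patternMatching I S) := by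
  classical
  exact Logspace.LogspaceFun.inLogspace
    (GraphProduct.logspacePred_patternMatching hwp hinv I) fun z => by simp

theorem mainTheorem10 {L : Type u} [Finite L] (I : SimpleGraph L)
    (G : L → Type v) [∀ α, Group (G α)] (S : ∀ α, Finset (G α))
    (hone : ∀ α, (1 : G α) ∉ S α)
    (hinv : ∀ α, ∀ g ∈ S α, g⁻¹ ∈ S α)
    (hgen : ∀ α, Subgroup.closure (S α : Set (G α)) = ⊤)
    (hwp : ∀ α, Logspace.InLogspace (GraphProduct.wordProblem (S α))) :
    Logspace.InLogspace (GraphProduct.patternMatching I S) :=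
  mainTheorem10_general I G S hinv hwp
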